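/- Identify $\mathbb R^2$ with $\mathbb C$, write $z=x_1+ix_2$, $\partial=\tfrac12(\partial_1-i\partial_2)$, and let $dx$ be Lebesgue measure. A *field* is a signed Borel measure $\mu$ on $\mathbb C$ of locally finite variation; a *potential* of $\mu$ is a locally integrable real function $\Psi$ with $\Delta\Psi=\mu$ in the sense of distributions. For a potential $\Psi$ and a closed null set $E\subset\mathbb C$ consider in $L_2(\mathbb R^2)$ the quadratic form $$\mathfrak p_-[\psi]=4\int|\partial_E(e^{\Psi}\psi)|^2e^{-2\Psi}\,dx ,$$ where $\partial_E$ is the derivative in the sense of distributions on $\mathbb C\setminus E$; its domain consists of those $\psi\in L_2$ for which $\partial_E(e^\Psi\psi)$ is a (locally integrable) function and $\mathfrak p_-[\psi]<\infty$. If the atoms of the field are located at the points of $\Lambda_0$, then $\mathcal P_{-\max}$ is the operator associated with this form for $E=\Lambda_0$, and, if all intensities (an atom of mass $2\pi\alpha$ has intensity $\alpha$) lie in $[-\frac12,\frac12)$, $\mathcal P_{-EV}$ is the operator associated with it for $E=\emptyset$. Zero modes are the elements of the kernel. A nonnegative measure $\nu$ *satisfies (C)* if there are $A_1$ and $R_1>0$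 with $\int_{|w-z|<R_1}|\ln|z-w||\,d\nu(w)\le A_1$ for all $z\in\mathbb C$. **Theorem.** Let $\mu_0$ be a field with discrete part $2\pi\sum_{\lambda\in\Lambda_0}\alpha_\lambda\delta(z-\lambda)$, where $\Lambda_0$ is uniformly discrete: for some $r^0>0$, any two distinct points of $\Lambda_0$ are at distance at least $r^0$. Let $\lambda_0(z)$ be a point of $\Lambda_0$ closest to $z$ (any of them, if there are several), and $\alpha(z)=\alpha_{\lambda_0(z)}$. Suppose that $\mu_0$ has a potential $\Psi_0$ such that, with some $\gamma>0$, $$\Psi_0(z)-\alpha(z)\ln|z-\lambda_0(z)|\ge\gamma|z|^2\qquad(*)$$ for all $z\notin\Lambda_0$ with $|z|$ sufficiently large (if $\Lambda_0=\emptyset$, the term with the logarithm is replaced by zero). Let $\mu$ be another field, without atoms, whose positive and negative parts $\mu_\pm$ (Jordan decomposition) satisfy (C). Let $\Phi:\mathbb C\to\mathbb C$ be a Borel mapping such that, for some $a\ge0$ and $\tau<1$, $|\Phi(w)-w|\le a|w|^\tau$ for $|w|$ large enough, let $\mu^*$ be the induced measure, $\mu^*(E)=\mu(\Phi^{-1}(E))$,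 and suppose that its positive and negative parts $\mu^*_\pm$ satisfy (C). Then: 1. the field $\mu_0+\mu-\mu^*$ has a potential $\Psi^*$ which satisfies $(*)$ with some $\gamma'$, $0<\gamma'<\gamma$, in place of $\gamma$; 2. if $0<\alpha_\lambda\le\theta_0$ for all $\lambda\in\Lambda_0$ with some $\theta_0<1$, then the operator $\mathcal P_{-\max}$ with the field $\mu_0+\mu-\mu^*$ (defined by any potential of it) has an infinite-dimensional space of zero modes; 3. if $\alpha_\lambda\in[-\frac12,\frac12)$ for all $\lambda\in\Lambda_0$, then the same holds for the operator $\mathcal P_{-EV}$ with the field $\mu_0+\mu-\mu^*$. -/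

import Mathlib

open MeasureTheory
open scoped ContDiff ComplexConjugate

noncomputable section

/-- A signed Borel measure of locally finite variation on the plane, given as a difference
`pos - neg` of two nonnegative locally finite Borel measures. -/
structure SignedRadon where
  pos : Measure ℂ
  neg : Measure ℂ
  pos_locallyFinite : IsLocallyFiniteMeasure pos
  neg_locallyFinite : IsLocallyFiniteMeasure neg

namespace SignedRadon

theorem isLocallyFiniteMeasure_add {μ ν : Measure ℂ} (hμ : IsLocallyFiniteMeasure μ)
    (hν : IsLocallyFiniteMeasure ν) : IsLocallyFiniteMeasure (μ + ν) := by
  refine ⟨fun z => ?_⟩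
  obtain ⟨s, hs, hs'⟩ := μ.finiteAt_nhds z
  obtain ⟨t, ht, ht'⟩ := ν.finiteAt_nhds z
  refine ⟨s ∩ t, Filter.inter_mem hs ht, ?_⟩
  rw [Measure.add_apply]
  exact ENNReal.add_lt_top.2 ⟨(measure_mono Set.inter_subset_left).trans_lt hs',
    (measure_mono Set.inter_subset_right).trans_lt ht'⟩

instance : Add SignedRadon where
  add μ ν :=
    ⟨μ.pos + ν.pos, μ.neg + ν.neg,
      isLocallyFiniteMeasure_add μ.pos_locallyFinite ν.pos_locallyFinite,
      isLocallyFiniteMeasure_add μ.neg_locallyFinite ν.neg_locallyFinite⟩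

instance : Neg SignedRadon where
  neg μ := ⟨μ.neg, μ.pos, μ.neg_locallyFinite, μ.pos_locallyFinite⟩

instance : Sub SignedRadon where
  sub μ ν := μ + -ν

/-- `pos - neg` is the Jordan decomposition, so that `pos = μ₊` and `neg = μ₋`. -/
def IsJordan (μ : SignedRadon) : Prop :=
  μ.pos ⟂ₘ μ.neg

/-- A continuous measure: no atoms. -/
def IsContinuous (μ : SignedRadon) : Prop :=
  ∀ z : ℂ, μ.pos {z} = 0 ∧ μ.neg {z} = 0

/-- The value `μ({z})`. -/
def atom (μ : SignedRadon) (z : ℂ) : ℝ :=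
  (μ.pos {z}).toReal - (μ.neg {z}).toReal

/-- The discrete part of `μ` is `2π ∑_{l ∈ L} α_l δ_l`: an Aharonov-Bohm solenoid of intensity
`α_l` at each `l ∈ L`, and no other atoms. -/
def HasDiscretePart (μ : SignedRadon) (L : Set ℂ) (α : ℂ → ℝ) : Prop :=
  ∀ z : ℂ, μ.atom z = L.indicator (fun l => 2 * Real.pi * α l) z

/-- `ν` is the measure induced from `μ` by `Φ`, `ν(E) = μ(Φ⁻¹(E))`. The identity
`Φ_* μ₊ - Φ_* μ₋ = ν₊ - ν₋` is written without subtraction. -/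
def IsImage (Φ : ℂ → ℂ) (μ ν : SignedRadon) : Prop :=
  μ.pos.map Φ + ν.neg = μ.neg.map Φ + ν.pos

/-- `Ψ` is a scalar potential of the magnetic field `μ`: `ΔΨ = μ` in the sense of
distributions on the plane. -/
def IsPotential (μ : SignedRadon) (Ψ : ℂ → ℝ) : Prop :=
  LocallyIntegrable Ψ volume ∧
    ∀ φ : ℂ → ℝ, ContDiff ℝ ∞ φ → HasCompactSupport φ →
      ∫ z, Ψ z * Laplacian.laplacian φ z = ∫ z, φ z ∂μ.pos - ∫ z, φ z ∂μ.neg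

end SignedRadon

/-- Uniform discreteness: distinct points of `L` are at distance at least some `r > 0`. -/
def UniformlyDiscrete (L : Set ℂ) : Prop :=
  ∃ r : ℝ, 0 < r ∧ ∀ l ∈ L, ∀ m ∈ L, m ≠ l → r ≤ dist l m

/-- `near z` is a point of `L` closest to `z`, for every `z`; no condition if `L` is empty. -/
def IsNearestPoint (L : Set ℂ) (near : ℂ → ℂ) : Prop :=
  L.Nonempty → ∀ z : ℂ, near z ∈ L ∧ ∀ l ∈ L, dist z (near z) ≤ dist z l

open Classical in
/-- `α(z) ln |z - near z|`, replaced by zero if `L` is empty. -/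
def nearestLog (L : Set ℂ) (α : ℂ → ℝ) (near : ℂ → ℂ) (z : ℂ) : ℝ :=
  if L.Nonempty then α (near z) * Real.log ‖z - near z‖ else 0

/-- `Ψ(z) - α(z) ln |z - near z| ≥ γ |z|²` for large `|z|`. The points of `L`, where the
logarithm is infinite, are left out. -/
def QuadraticLowerBound (L : Set ℂ) (α : ℂ → ℝ) (near : ℂ → ℂ) (γ : ℝ) (Ψ : ℂ → ℝ) : Prop :=
  ∃ R : ℝ, ∀ z : ℂ, z ∉ L → R ≤ ‖z‖ → γ * ‖z‖ ^ 2 ≤ Ψ z - nearestLog L α near z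

/-- The integrals of `|ln |z - w||` in `w` over the disks of some radius `R₁` centred at `z` are
bounded uniformly in `z`. (The convention `Real.log 0 = 0` is harmless: an atom of `ν` at `p`
makes these integrals unbounded as `z → p`, `z ≠ p`, so the condition excludes atoms.) -/
def UniformLogBound (ν : Measure ℂ) : Prop :=
  ∃ A₁ R₁ : ℝ, 0 < R₁ ∧ ∀ z : ℂ,
    ∫⁻ w in Metric.ball z R₁, ENNReal.ofReal |Real.log ‖z - w‖| ∂ν ≤ ENNReal.ofReal A₁

/-- `|Φ(w) - w| ≤ a |w|^τ` for large `|w|`, with some `a ≥ 0` and `τ < 1`. -/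
def SublinearDisplacement (Φ : ℂ → ℂ) : Prop :=
  ∃ a τ R : ℝ, 0 ≤ a ∧ τ < 1 ∧ ∀ w : ℂ, R ≤ ‖w‖ → ‖Φ w - w‖ ≤ a * ‖w‖ ^ τ

/-- `∂ = (∂₁ - i ∂₂) / 2` for differentiable functions. -/
def wirtingerDel (φ : ℂ → ℂ) (z : ℂ) : ℂ :=
  (fderiv ℝ φ z 1 - Complex.I * fderiv ℝ φ z Complex.I) / 2

/-- `∂ f = g` in the sense of distributions on the open set `U`, `f` and `g` being functions
locally integrable in `U`. -/
def HasWeakDel (U : Set ℂ) (f g : ℂ → ℂ) : Prop :=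
  LocallyIntegrableOn f U volume ∧ LocallyIntegrableOn g U volume ∧
    ∀ φ : ℂ → ℂ, ContDiff ℝ ∞ φ → HasCompactSupport φ → tsupport φ ⊆ U →
      ∫ z, f z * wirtingerDel φ z = -∫ z, g z * φ z

/-- The Hilbert space `L₂(ℝ²)`. -/
abbrev PlaneL2 : Type := Lp ℂ 2 (volume : Measure ℂ)

/-- `ψ` lies in the domain of the form `4 ∫ |∂(e^Ψ ψ)|² e^{-2Ψ} dx`, with the derivative
`g = ∂(e^Ψ ψ)` taken in the sense of distributions on `U`. -/
def InFormDomain (U : Set ℂ) (Ψ : ℂ → ℝ) (ψ : PlaneL2) (g : ℂ → ℂ) : Prop :=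
  HasWeakDel U (fun z => (Real.exp (Ψ z) : ℂ) * ψ z) g ∧
    MemLp (fun z => (Real.exp (-Ψ z) : ℂ) * g z) 2 volume

/-- The graph of the operator associated with this form: `ψ` lies in the form domain, and
`p[ψ, φ] = ⟨h, φ⟩` for all `φ` in the form domain. -/
def PauliMinusGraph (U : Set ℂ) (Ψ : ℂ → ℝ) (ψ h : PlaneL2) : Prop :=
  ∃ g : ℂ → ℂ, InFormDomain U Ψ ψ g ∧
    ∀ (φ : PlaneL2) (k : ℂ → ℂ), InFormDomain U Ψ φ k →
      4 * ∫ z, g z * conj (k z) * (Real.exp (-2 * Ψ z) : ℂ) = inner ℂ φ h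

/-- The graph of the spin-down component `P_{-max}` of the maximal Pauli operator with scalar
potential `Ψ` and solenoids at the points of `L`: derivatives are taken outside `L`. -/
def PauliMinusMax (L : Set ℂ) (Ψ : ℂ → ℝ) : PlaneL2 → PlaneL2 → Prop :=
  PauliMinusGraph Lᶜ Ψ

/-- The graph of the spin-down component `P_{-EV}` of the Erdős-Vougalter Pauli operator with
scalar potential `Ψ`, for intensities in `[-1/2, 1/2)`: derivatives are taken in the plane. -/
def PauliMinusEV (Ψ : ℂ → ℝ) : PlaneL2 → PlaneL2 → Prop :=
  PauliMinusGraph Set.univ Ψ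

/-- The null space of the operator with graph `P` is infinite-dimensional. -/
def InfinitelyManyZeroModes (P : PlaneL2 → PlaneL2 → Prop) : Prop :=
  ∃ f : ℕ → PlaneL2, LinearIndependent ℂ f ∧ ∀ n, P (f n) 0

end

open Filter Topology Metric Set
open scoped Convolution
open ContinuousLinearMap (mul)

/-! The zero modes are explicit. Let `Ψ` be the given potential and `Ψ'` another potential of the
same field. By Weyl's lemma (`WeaklyHarmonicOn.exists_entire`) their difference is almost everywhere
the real part of an entire function `F`. Then `ψₙ = e^{-Ψ} conj(zⁿ e^F)` has modulus `|z|ⁿ e^{-Ψ'}`,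
while `e^Ψ ψₙ` is antiholomorphic in the whole plane, so that `∂` annihilates it on every set of
derivation. Both operators are thus served by a single potential `Ψ'` for which every `|z|^{2n}
e^{-2Ψ'}` is integrable (`infinitelyManyZeroModes_of_integrable`).

Such a `Ψ'` is `Ψ₀ + U`, where `U` is a potential of `μ - μ*` with `U = O((1 + |z|)^κ)`, `κ < 2`;
the perturbation then costs only part of `γ|z|²`. To construct `U` (`exists_potential_sub_image`),
the logarithmic kernel is split as `log = log⁺ - log⁺(1/·)`. The part `log⁺(1/·)` has bounded
potentials for `μ±` and `μ*±` by condition (C). The difference of the `log⁺` parts is transported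
back to `μ` and becomes the integral of `log⁺|z - w| - log⁺|z - Φ(w)|`, corrected by functions
affine in `z` as in a Weierstrass product of genus one. For large `w` the corrected kernel is
`O(|z|² |w|^{τ-3})`, integrable against a measure uniformly bounded on disks because `3 - τ > 2`.
For `w` comparable with `z` or smaller, the sublinear displacement again gives growth of order below
two (`exists_displacementKernel_le`).

Integrability of `|z|^{2n} e^{-2Ψ'}` has a local and a global side. Locally
(`SignedRadon.IsPotential.locallyIntegrable_exp`), `Ψ'` is an atomic logarithm plus the logarithmic
potential of a measure of small mass, up to terms bounded below; Jensen's inequality turns the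
exponential into an average of powers `|z - w|^{-t}`, integrable because intensities are below one.
At infinity the quadratic bound supplies Gaussian decay, and the remaining factor `|z -
λ₀(z)|^{-2α(z)}` is controlled by uniform discreteness near `Λ₀` and by `α ≥ -1/2` far from it. -/

/-! ### Laplacian in coordinates and Green's identity -/

theorem laplacian_eq_fderiv_fderiv {f : ℂ → ℝ} (hf : ContDiff ℝ 2 f) (z : ℂ) :
    Laplacian.laplacian f z = fderiv ℝ (fun y => fderiv ℝ f y 1) z 1 +
      fderiv ℝ (fun y => fderiv ℝ f y Complex.I) z Complex.I := by
  have hd : DifferentiableAt ℝ (fderiv ℝ f) z :=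
    (hf.fderiv_right (m := 1) (by norm_num)).differentiable (by norm_num) z
  rw [InnerProductSpace.laplacian_eq_iteratedFDeriv_complexPlane]
  simp only [iteratedFDeriv_two_apply]
  rw [fderiv_clm_apply hd (by fun_prop), fderiv_clm_apply hd (by fun_prop)]
  simp

theorem contDiff_fderiv_apply_const {f : ℂ → ℝ} {n m : WithTop ℕ∞} (hf : ContDiff ℝ n f)
    (hmn : m + 1 ≤ n) (v : ℂ) : ContDiff ℝ m (fun y => fderiv ℝ f y v) :=
  (hf.fderiv_right hmn).clm_apply contDiff_const

theorem tsupport_laplacian_subset (f : ℂ → ℝ) :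
    tsupport (Laplacian.laplacian f) ⊆ tsupport f := by
  refine closure_minimal (fun x hx => ?_) (isClosed_tsupport f)
  by_contra hx'
  have h0 : f =ᶠ[𝓝 x] fun _ => (0 : ℝ) := notMem_tsupport_iff_eventuallyEq.1 hx'
  have := (InnerProductSpace.laplacian_congr_nhds h0).eq_of_nhds
  apply hx
  rw [this, InnerProductSpace.laplacian_const]
  rfl

theorem hasCompactSupport_laplacian {f : ℂ → ℝ} (hf : HasCompactSupport f) :
    HasCompactSupport (Laplacian.laplacian f) :=
  hf.of_isClosed_subset (isClosed_tsupport _) (tsupport_laplacian_subset f)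

theorem continuous_laplacian {f : ℂ → ℝ} (hf : ContDiff ℝ 2 f) :
    Continuous (Laplacian.laplacian f : ℂ → ℝ) := by
  have : (Laplacian.laplacian f : ℂ → ℝ) = fun z => fderiv ℝ (fun y => fderiv ℝ f y 1) z 1 +
      fderiv ℝ (fun y => fderiv ℝ f y Complex.I) z Complex.I :=
    funext (laplacian_eq_fderiv_fderiv hf)
  rw [this]
  have h1 : ∀ v : ℂ, Continuous fun z => fderiv ℝ (fun y => fderiv ℝ f y v) z v := fun v =>
    (contDiff_fderiv_apply_const (m := 0) (contDiff_fderiv_apply_const (m := 1) hf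
      (by norm_num) v) (by norm_num) v).continuous
  exact (h1 1).add (h1 Complex.I)

theorem integral_mul_fderiv_fderiv_comm {g φ : ℂ → ℝ} (hg : ContDiff ℝ 2 g) (hφ : ContDiff ℝ 2 φ)
    (hφc : HasCompactSupport φ) (v : ℂ) :
    ∫ z, g z * fderiv ℝ (fun y => fderiv ℝ φ y v) z v =
      ∫ z, fderiv ℝ (fun y => fderiv ℝ g y v) z v * φ z := by
  have hg1 := contDiff_fderiv_apply_const (m := 1) hg (by norm_num) v
  have hφ1 := contDiff_fderiv_apply_const (m := 1) hφ (by norm_num) v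
  have hg2 := contDiff_fderiv_apply_const (m := 0) hg1 (by norm_num) v
  have hφ2 := contDiff_fderiv_apply_const (m := 0) hφ1 (by norm_num) v
  have hφ1c : HasCompactSupport (fun y => fderiv ℝ φ y v) :=
    hφc.of_isClosed_subset (isClosed_tsupport _) (tsupport_fderiv_apply_subset ℝ v)
  have hφ2c : HasCompactSupport (fun z => fderiv ℝ (fun y => fderiv ℝ φ y v) z v) :=
    hφ1c.of_isClosed_subset (isClosed_tsupport _) (tsupport_fderiv_apply_subset ℝ v)
  have key : ∀ a b : ℂ → ℝ, Continuous a → Continuous b → HasCompactSupport b →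
      Integrable (fun z => a z * b z) := fun a b ha hb hbc =>
    (ha.mul hb).integrable_of_hasCompactSupport hbc.mul_left
  rw [integral_mul_fderiv_eq_neg_fderiv_mul_of_integrable
    (key _ _ hg1.continuous hφ1.continuous hφ1c) (key _ _ hg.continuous hφ2.continuous hφ2c)
    (key _ _ hg.continuous hφ1.continuous hφ1c)
    (fun x _ => hg.differentiable (by norm_num) x)
    (fun x _ => hφ1.differentiable (by norm_num) x),
    integral_mul_fderiv_eq_neg_fderiv_mul_of_integrable
    (key _ _ hg2.continuous hφ.continuous hφc) (key _ _ hg1.continuous hφ1.continuous hφ1c)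
    (key _ _ hg1.continuous hφ.continuous hφc)
    (fun x _ => hg1.differentiable (by norm_num) x)
    (fun x _ => hφ.differentiable (by norm_num) x), neg_neg]

/-- Green's identity against a compactly supported function. -/
theorem integral_mul_laplacian_comm {g φ : ℂ → ℝ} (hg : ContDiff ℝ 2 g) (hφ : ContDiff ℝ 2 φ)
    (hφc : HasCompactSupport φ) :
    ∫ z, g z * Laplacian.laplacian φ z = ∫ z, Laplacian.laplacian g z * φ z := by
  simp only [laplacian_eq_fderiv_fderiv hg, laplacian_eq_fderiv_fderiv hφ, mul_add, add_mul]
  have hi : ∀ v : ℂ, Integrable fun z => g z * fderiv ℝ (fun y => fderiv ℝ φ y v) z v := fun v => by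
    have hφ2 := contDiff_fderiv_apply_const (m := 0)
      (contDiff_fderiv_apply_const (m := 1) hφ (by norm_num) v) (by norm_num) v
    refine (hg.continuous.mul hφ2.continuous).integrable_of_hasCompactSupport ?_
    refine HasCompactSupport.mul_left (hφc.of_isClosed_subset (isClosed_tsupport _) ?_)
    exact (tsupport_fderiv_apply_subset ℝ v).trans (tsupport_fderiv_apply_subset ℝ v)
  have hi' : ∀ v : ℂ, Integrable fun z => fderiv ℝ (fun y => fderiv ℝ g y v) z v * φ z :=
    fun v => by
    have hg2 := contDiff_fderiv_apply_const (m := 0)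
      (contDiff_fderiv_apply_const (m := 1) hg (by norm_num) v) (by norm_num) v
    exact (hg2.continuous.mul hφ.continuous).integrable_of_hasCompactSupport hφc.mul_left
  rw [integral_add (hi 1) (hi _), integral_add (hi' 1) (hi' _),
    integral_mul_fderiv_fderiv_comm hg hφ hφc, integral_mul_fderiv_fderiv_comm hg hφ hφc]

/-! ### Local integrability of singular kernels and the fundamental solution -/

theorem integrableOn_norm_rpow_neg {s : ℝ} (hs : s < 2) :
    IntegrableOn (fun z : ℂ => ‖z‖ ^ (-s)) (ball 0 1) := by
  rw [integrableOn_fun_norm_addHaar volume (f := fun r : ℝ => r ^ (-s))]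
  have h : IntegrableOn (fun y : ℝ => y ^ (1 - s)) (Ioo 0 1) :=
    (intervalIntegral.integrableOn_Ioo_rpow_iff zero_lt_one).2 (by linarith)
  refine h.congr_fun (fun y hy => ?_) measurableSet_Ioo
  simp only [Complex.finrank_real_complex, Nat.reduceSub, pow_one, smul_eq_mul]
  rw [sub_eq_add_neg, Real.rpow_add hy.1, Real.rpow_one]

/-- Negative powers of exponent less than two are integrable over disks, uniformly. -/
theorem exists_lintegral_norm_sub_rpow_le {s : ℝ} (hs0 : 0 ≤ s) (hs : s < 2) (ρ : ℝ) :
    ∃ K : ℝ, ∀ c w : ℂ,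
      ∫⁻ z in ball c ρ, ENNReal.ofReal (‖z - w‖ ^ (-s)) ≤ ENNReal.ofReal K := by
  have h1 : ∫⁻ z in ball (0 : ℂ) 1, ENNReal.ofReal (‖z‖ ^ (-s)) < ⊤ := by
    have := (integrableOn_norm_rpow_neg hs).2
    rw [hasFiniteIntegral_iff_ofReal] at this
    · exact this
    · exact ae_of_all _ fun z => Real.rpow_nonneg (norm_nonneg _) _
  have h2 : volume (ball (0 : ℂ) ρ) < ⊤ := measure_ball_lt_top
  refine ⟨((∫⁻ z in ball (0 : ℂ) 1, ENNReal.ofReal (‖z‖ ^ (-s))) +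
    volume (ball (0 : ℂ) ρ)).toReal, fun c w => ?_⟩
  rw [ENNReal.ofReal_toReal (ENNReal.add_lt_top.2 ⟨h1, h2⟩).ne]
  calc ∫⁻ z in ball c ρ, ENNReal.ofReal (‖z - w‖ ^ (-s))
      ≤ ∫⁻ z in ball c ρ, ((ball w 1).indicator
          (fun z => ENNReal.ofReal (‖z - w‖ ^ (-s))) z + 1) := by
        refine lintegral_mono fun z => ?_
        by_cases hz : z ∈ ball w 1
        · simp only [indicator_of_mem hz]
          exact le_self_add
        · simp only [indicator_of_notMem hz, zero_add]
          rw [ENNReal.ofReal_le_one]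
          rw [mem_ball, dist_eq_norm, not_lt] at hz
          exact Real.rpow_le_one_of_one_le_of_nonpos hz (by linarith)
    _ = (∫⁻ z in ball c ρ, (ball w 1).indicator
          (fun z => ENNReal.ofReal (‖z - w‖ ^ (-s))) z) + volume (ball c ρ) := by
        rw [lintegral_add_right _ measurable_const]
        simp
    _ ≤ (∫⁻ z, (ball w 1).indicator
          (fun z => ENNReal.ofReal (‖z - w‖ ^ (-s))) z) + volume (ball c ρ) := by
        gcongr
        exact Measure.restrict_le_self
    _ = _ := by
        congr 1
        · rw [← lintegral_indicator measurableSet_ball,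
            ← lintegral_sub_right_eq_self (fun z => (ball (0 : ℂ) 1).indicator
              (fun z => ENNReal.ofReal (‖z‖ ^ (-s))) z) w]
          congr 1
          ext z
          simp [indicator, dist_eq_norm]
        · simp [Complex.volume_ball]

theorem abs_log_le_inv_add_self {t : ℝ} (ht : 0 ≤ t) : |Real.log t| ≤ t ^ (-1 : ℝ) + t := by
  rcases ht.eq_or_lt with rfl | h
  · simp
  rw [Real.rpow_neg_one, abs_le]
  have h1 := Real.log_le_sub_one_of_pos h
  have h2 := Real.one_sub_inv_le_log_of_pos h
  have h3 : 0 < t⁻¹ := inv_pos.2 h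
  constructor <;> linarith

theorem locallyIntegrable_log_norm_sub (w : ℂ) :
    LocallyIntegrable (fun z : ℂ => Real.log ‖z - w‖) := by
  rw [locallyIntegrable_iff]
  intro k hk
  obtain ⟨R, hR⟩ := hk.isBounded.subset_ball w
  refine IntegrableOn.mono_set ?_ hR
  have hp : IntegrableOn (fun z : ℂ => ‖z - w‖ ^ (-1 : ℝ)) (ball w R) := by
    obtain ⟨K, hK⟩ := exists_lintegral_norm_sub_rpow_le (s := 1) (by norm_num) (by norm_num) R
    refine ⟨(by fun_prop : Measurable fun z : ℂ => ‖z - w‖ ^ (-1 : ℝ)).aestronglyMeasurable, ?_⟩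
    rw [hasFiniteIntegral_iff_ofReal (ae_of_all _ fun z => by positivity)]
    exact (hK w w).trans_lt ENNReal.ofReal_lt_top
  have hq : IntegrableOn (fun z : ℂ => ‖z - w‖) (ball w R) :=
    ((by fun_prop : Continuous fun z : ℂ => ‖z - w‖).continuousOn.integrableOn_compact
      (isCompact_closedBall w R)).mono_set ball_subset_closedBall
  refine Integrable.mono' (hp.add hq)
    (by fun_prop : Measurable fun z : ℂ => Real.log ‖z - w‖).aestronglyMeasurable ?_
  exact ae_of_all _ fun z => abs_log_le_inv_add_self (norm_nonneg _)

theorem hasFDerivAt_log_add_norm_sq {a : ℝ} (ha : 0 < a) (z : ℂ) :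
    HasFDerivAt (fun z : ℂ => Real.log (a + ‖z‖ ^ 2) / 2)
      ((a + ‖z‖ ^ 2)⁻¹ • innerSL ℝ z) z := by
  have h1 : HasFDerivAt (fun z : ℂ => a + ‖z‖ ^ 2) (2 • innerSL ℝ z) z :=
    (hasStrictFDerivAt_norm_sq z).hasFDerivAt.const_add a
  have h2 := (h1.log (by positivity)).mul_const (2⁻¹ : ℝ)
  simp only [← div_eq_mul_inv] at h2
  refine h2.congr_fderiv ?_
  ext
  simp
  ring

theorem contDiff_log_add_norm_sq {a : ℝ} (ha : 0 < a) :
    ContDiff ℝ 2 (fun z : ℂ => Real.log (a + ‖z‖ ^ 2) / 2) := by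
  have h : ContDiff ℝ 2 (fun z : ℂ => a + ‖z‖ ^ 2) := contDiff_const.add (contDiff_norm_sq ℝ)
  exact (h.log fun z => by positivity).div_const 2

/-- Smoothing `log |z|` to `log(a + |z|²) / 2` turns its Laplacian into a positive bump of total
mass `2π`, which concentrates at the origin as `a → 0`. -/
theorem laplacian_log_add_norm_sq {a : ℝ} (ha : 0 < a) (z : ℂ) :
    Laplacian.laplacian (fun z : ℂ => Real.log (a + ‖z‖ ^ 2) / 2) z =
      2 * a / (a + ‖z‖ ^ 2) ^ 2 := by
  rw [laplacian_eq_fderiv_fderiv (contDiff_log_add_norm_sq ha)]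
  simp only [(hasFDerivAt_log_add_norm_sq ha _).fderiv]
  have hq : a + ‖z‖ ^ 2 ≠ 0 := by positivity
  have h1 : HasFDerivAt (fun z : ℂ => a + ‖z‖ ^ 2) (2 • innerSL ℝ z) z :=
    (hasStrictFDerivAt_norm_sq z).hasFDerivAt.const_add a
  have key : ∀ v : ℂ, fderiv ℝ (fun y : ℂ => ((a + ‖y‖ ^ 2)⁻¹ • innerSL ℝ y) v) z v =
      ‖v‖ ^ 2 / (a + ‖z‖ ^ 2) - 2 * inner ℝ z v ^ 2 / (a + ‖z‖ ^ 2) ^ 2 := by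
    intro v
    have h2 : HasFDerivAt (fun y : ℂ => inner ℝ y v) ((innerSL ℝ).flip v) z :=
      ((innerSL ℝ).flip v).hasFDerivAt
    have h3 : HasFDerivAt (fun y : ℂ => (a + ‖y‖ ^ 2)⁻¹)
        (-((a + ‖z‖ ^ 2) ^ 2)⁻¹ • (2 • innerSL ℝ z)) z := by
      have := (hasDerivAt_inv hq).hasFDerivAt.comp z h1
      refine this.congr_fderiv ?_
      ext
      simp
      ring
    have h4 := h3.mul h2
    have : (fun y : ℂ => ((a + ‖y‖ ^ 2)⁻¹ • innerSL ℝ y) v) =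
        (fun y : ℂ => (a + ‖y‖ ^ 2)⁻¹) * fun y : ℂ => inner ℝ y v := by
      ext y; simp
    rw [this, h4.fderiv]
    simp only [add_apply, smul_apply, innerSL_apply_apply,
      ContinuousLinearMap.flip_apply, real_inner_self_eq_norm_sq, smul_eq_mul, nsmul_eq_mul,
      Nat.cast_ofNat]
    field_simp
    ring
  rw [key, key]
  have hn : ‖z‖ ^ 2 = z.re ^ 2 + z.im ^ 2 := by
    rw [Complex.sq_norm, Complex.normSq_apply]; ring
  simp only [Complex.inner, Complex.norm_I, norm_one]
  simp only [Complex.mul_re, Complex.conj_re, Complex.conj_im, Complex.I_re, one_mul, Complex.I_im]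
  rw [hn] at hq ⊢
  field_simp
  ring

theorem integral_inv_one_add_norm_sq_sq :
    ∫ z : ℂ, 1 / (Real.pi * (1 + ‖z‖ ^ 2) ^ 2) = 1 := by
  rw [integral_fun_norm_addHaar volume (fun r : ℝ => 1 / (Real.pi * (1 + r ^ 2) ^ 2))]
  have hlim : Tendsto (fun r : ℝ => -(1 / (2 * Real.pi * (1 + r ^ 2)))) atTop (𝓝 (-0)) := by
    refine Tendsto.neg (Tendsto.const_div_atTop ?_ 1)
    refine Tendsto.const_mul_atTop (by positivity) ?_
    exact tendsto_atTop_add_const_left _ _ (tendsto_pow_atTop (by norm_num))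
  -- In polar coordinates the radial integrand is `r / (π (1 + r²)²)`, with primitive `-1 / (2π (1 +
  -- r²))`.
  have := integral_Ioi_of_hasDerivAt_of_nonneg' (a := (0 : ℝ)) (l := -0)
    (g := fun r : ℝ => -(1 / (2 * Real.pi * (1 + r ^ 2))))
    (g' := fun y : ℝ => y ^ (2 - 1) • (1 / (Real.pi * (1 + y ^ 2) ^ 2))) ?_ ?_ hlim
  · simp only [Complex.finrank_real_complex]
    rw [this]
    simp only [measureReal_def, Complex.volume_ball]
    simp
  · intro x _
    have h : HasDerivAt (fun r : ℝ => 2 * Real.pi * (1 + r ^ 2)) (2 * Real.pi * (2 * x)) x := by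
      have := ((hasDerivAt_pow 2 x).const_add 1).const_mul (2 * Real.pi)
      simpa using this
    have h2 := (h.fun_inv (by positivity)).fun_neg
    simp only [one_div]
    refine h2.congr_deriv ?_
    simp only [smul_eq_mul]
    field_simp
    ring
  · intro x hx
    have : (0 : ℝ) < x := hx
    simp only [smul_eq_mul]
    positivity

/-- With `a = c⁻²`, Green's identity moves the Laplacian onto the smoothed logarithm, where it
becomes `2π c² p(cz)` for the unit-mass profile `p(z) = 1 / (π (1 + |z|²)²)`: an approximate
identity. -/
theorem tendsto_integral_log_add_norm_sq {φ : ℂ → ℝ} (hφ : ContDiff ℝ 2 φ)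
    (hφc : HasCompactSupport φ) :
    Tendsto (fun c : ℝ => ∫ z, Real.log ((c ^ 2)⁻¹ + ‖z‖ ^ 2) / 2 * Laplacian.laplacian φ z) atTop
      (𝓝 (2 * Real.pi * φ 0)) := by
  have hp := tendsto_integral_comp_smul_smul_of_integrable (μ := (volume : Measure ℂ))
    (φ := fun z : ℂ => 1 / (Real.pi * (1 + ‖z‖ ^ 2) ^ 2)) (g := φ) (fun x => by positivity)
    integral_inv_one_add_norm_sq_sq ?_ (hφ.continuous.integrable_of_hasCompactSupport hφc)
    hφ.continuous.continuousAt
  · refine (hp.const_mul (2 * Real.pi)).congr' ?_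
    filter_upwards [eventually_gt_atTop 0] with c hc
    have ha : (0 : ℝ) < (c ^ 2)⁻¹ := by positivity
    rw [integral_mul_laplacian_comm (contDiff_log_add_norm_sq ha) hφ hφc, ← integral_const_mul]
    congr 1
    ext z
    rw [laplacian_log_add_norm_sq ha]
    simp only [Complex.finrank_real_complex, norm_smul, smul_eq_mul, Real.norm_eq_abs, mul_pow,
      sq_abs]
    have h1 : (c ^ 2)⁻¹ + ‖z‖ ^ 2 = (1 + c ^ 2 * ‖z‖ ^ 2) / c ^ 2 := by field_simp
    rw [h1]
    field_simp
  · simp only [Complex.finrank_real_complex]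
    have h0 : Tendsto (fun x : ℂ => 1 / ‖x‖ ^ 2) (Bornology.cobounded ℂ) (𝓝 0) :=
      Tendsto.const_div_atTop ((tendsto_pow_atTop (by norm_num)).comp tendsto_norm_cobounded_atTop) 1
    refine squeeze_zero' (Eventually.of_forall fun x => by positivity) ?_ h0
    filter_upwards [tendsto_norm_cobounded_atTop.eventually (eventually_gt_atTop (0 : ℝ))] with x hx
    rw [mul_one_div, div_le_div_iff₀ (by positivity) (by positivity)]
    have := Real.pi_gt_three
    nlinarith [sq_nonneg (1 + ‖x‖ ^ 2), pow_pos hx 2, pow_pos hx 4]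

/-- `log ‖z - p‖ / (2π)` is the fundamental solution of the Laplace equation in the plane. -/
theorem integral_log_norm_sub_mul_laplacian {φ : ℂ → ℝ} (hφ : ContDiff ℝ 2 φ)
    (hφc : HasCompactSupport φ) (p : ℂ) :
    ∫ z, Real.log ‖z - p‖ * Laplacian.laplacian φ z = 2 * Real.pi * φ p := by
  suffices H : ∀ φ : ℂ → ℝ, ContDiff ℝ 2 φ → HasCompactSupport φ →
      ∫ z, Real.log ‖z‖ * Laplacian.laplacian φ z = 2 * Real.pi * φ 0 by
    have hs : ContDiff ℝ 2 (fun z => φ (z + p)) := hφ.comp (contDiff_id.add contDiff_const)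
    have hsc : HasCompactSupport (fun z => φ (z + p)) :=
      hφc.comp_homeomorph (Homeomorph.addRight p)
    have hl : ∀ z, Laplacian.laplacian (fun z => φ (z + p)) z = Laplacian.laplacian φ (z + p) := by
      intro z
      rw [laplacian_eq_fderiv_fderiv hs, laplacian_eq_fderiv_fderiv hφ]
      simp only [fderiv_comp_add_right]
      rw [fderiv_comp_add_right (f := fun y => fderiv ℝ φ y 1),
        fderiv_comp_add_right (f := fun y => fderiv ℝ φ y Complex.I)]
    have := H _ hs hsc
    simp only [hl, zero_add] at this
    rw [← this, ← integral_add_right_eq_self _ p]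
    simp
  clear hφ hφc φ
  intro φ hφ hφc
  refine tendsto_nhds_unique ?_ (tendsto_integral_log_add_norm_sq hφ hφc)
  have hΔ := continuous_laplacian hφ
  have hΔc := hasCompactSupport_laplacian hφc
  obtain ⟨R, hR⟩ := hΔc.isCompact.isBounded.subset_closedBall 0
  have hint : Integrable fun z : ℂ => Real.log ‖z‖ * Laplacian.laplacian φ z := by
    have := (locallyIntegrable_log_norm_sub 0).integrable_smul_right_of_hasCompactSupport hΔ hΔc
    simpa using this
  have hint2 : Integrable (Laplacian.laplacian φ : ℂ → ℝ) :=
    hΔ.integrable_of_hasCompactSupport hΔc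
  -- For `c ≥ 1` and `|z| ≤ R` the smoothed logarithm lies between `log |z|` and `1 + R²`, which
  -- gives the majorant.
  refine tendsto_integral_filter_of_dominated_convergence
    (fun z => |Real.log ‖z‖ * Laplacian.laplacian φ z| + (1 + R ^ 2) * |Laplacian.laplacian φ z|)
    ?_ ?_ (hint.abs.add (hint2.abs.const_mul _)) ?_
  · filter_upwards [eventually_gt_atTop 0] with c hc
    have ha : (0 : ℝ) < (c ^ 2)⁻¹ := by positivity
    exact ((contDiff_log_add_norm_sq ha).continuous.mul hΔ).aestronglyMeasurable
  · filter_upwards [eventually_ge_atTop 1] with c hc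
    have h0 : ∀ᵐ z : ℂ, z ≠ 0 := Measure.ae_ne volume 0
    filter_upwards [h0] with z hz
    by_cases hzR : z ∈ closedBall (0 : ℂ) R
    · rw [mem_closedBall_zero_iff] at hzR
      have ha : (0 : ℝ) < (c ^ 2)⁻¹ := by positivity
      have ha1 : (c ^ 2)⁻¹ ≤ 1 := inv_le_one_of_one_le₀ (by nlinarith)
      have hlo : Real.log ‖z‖ ≤ Real.log ((c ^ 2)⁻¹ + ‖z‖ ^ 2) / 2 := by
        have : Real.log (‖z‖ ^ 2) ≤ Real.log ((c ^ 2)⁻¹ + ‖z‖ ^ 2) :=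
          Real.log_le_log (by positivity) (by linarith)
        rw [Real.log_pow] at this
        push_cast at this
        linarith
      have hhi : Real.log ((c ^ 2)⁻¹ + ‖z‖ ^ 2) / 2 ≤ 1 + R ^ 2 := by
        have h1 := Real.log_le_sub_one_of_pos (show 0 < (c ^ 2)⁻¹ + ‖z‖ ^ 2 by positivity)
        have h2 : ‖z‖ ^ 2 ≤ R ^ 2 := by gcongr
        nlinarith [sq_nonneg R]
      rw [Real.norm_eq_abs, abs_mul, abs_mul, ← add_mul]
      gcongr
      rw [abs_le]
      constructor
      · have := neg_abs_le (Real.log ‖z‖)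
        nlinarith [sq_nonneg R]
      · have := abs_nonneg (Real.log ‖z‖)
        linarith
    · have : Laplacian.laplacian φ z = 0 := image_eq_zero_of_notMem_tsupport fun h => hzR (hR h)
      simp [this]
  · have h0 : ∀ᵐ z : ℂ, z ≠ 0 := Measure.ae_ne volume 0
    filter_upwards [h0] with z hz
    refine Tendsto.mul_const _ ?_
    have h1 : Tendsto (fun c : ℝ => (c ^ 2)⁻¹ + ‖z‖ ^ 2) atTop (𝓝 (0 + ‖z‖ ^ 2)) :=
      (tendsto_inv_atTop_zero.comp (tendsto_pow_atTop (by norm_num))).add_const _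
    have h2 := (h1.log (by positivity)).div_const 2
    convert h2 using 2
    rw [zero_add, Real.log_pow]
    push_cast
    ring

/-! ### Weyl's lemma -/

theorem fderiv_convolution_apply {H f : ℂ → ℝ} (hH : LocallyIntegrable H) (hf : ContDiff ℝ 1 f)
    (hfc : HasCompactSupport f) (x v : ℂ) :
    fderiv ℝ (H ⋆[mul ℝ ℝ] f) x v = (H ⋆[mul ℝ ℝ] fun y => fderiv ℝ f y v) x := by
  rw [(hfc.hasFDerivAt_convolution_right (mul ℝ ℝ) hH hf x).fderiv,
    convolution_precompR_apply _ hH (hfc.fderiv ℝ) (hf.continuous_fderiv one_ne_zero)]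

theorem laplacian_convolution {H f : ℂ → ℝ} (hH : LocallyIntegrable H) (hf : ContDiff ℝ 2 f)
    (hfc : HasCompactSupport f) (x : ℂ) :
    Laplacian.laplacian (H ⋆[mul ℝ ℝ] f) x = ∫ t, H t * Laplacian.laplacian f (x - t) := by
  have hc : ContDiff ℝ 2 (H ⋆[mul ℝ ℝ] f) :=
    hfc.contDiff_convolution_right (n := 2) (mul ℝ ℝ) hH hf
  have key : ∀ v : ℂ, fderiv ℝ (fun y => fderiv ℝ (H ⋆[mul ℝ ℝ] f) y v) x v =
      (H ⋆[mul ℝ ℝ] fun y => fderiv ℝ (fun y => fderiv ℝ f y v) y v) x := by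
    intro v
    have : (fun y => fderiv ℝ (H ⋆[mul ℝ ℝ] f) y v) = H ⋆[mul ℝ ℝ] fun y => fderiv ℝ f y v :=
      funext fun y => fderiv_convolution_apply hH (hf.of_le (by norm_num)) hfc y v
    rw [this, fderiv_convolution_apply hH (contDiff_fderiv_apply_const hf (by norm_num) v)
      (hfc.of_isClosed_subset (isClosed_tsupport _) (tsupport_fderiv_apply_subset ℝ v))]
  have hi : ∀ v : ℂ, Integrable fun t =>
      H t * (fun y => fderiv ℝ (fun y => fderiv ℝ f y v) y v) (x - t) := by
    intro v
    have hf2 := contDiff_fderiv_apply_const (m := 0)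
      (contDiff_fderiv_apply_const (m := 1) hf (by norm_num) v) (by norm_num) v
    exact HasCompactSupport.convolutionExists_right (mul ℝ ℝ)
      (hfc.of_isClosed_subset (isClosed_tsupport _) ((tsupport_fderiv_apply_subset ℝ v).trans
        (tsupport_fderiv_apply_subset ℝ v))) hH hf2.continuous x
  rw [laplacian_eq_fderiv_fderiv hc, key, key, convolution_mul, convolution_mul,
    ← integral_add (hi _) (hi _)]
  congr 1
  ext t
  rw [laplacian_eq_fderiv_fderiv hf]
  ring

theorem laplacian_comp_const_sub {f : ℂ → ℝ} (hf : ContDiff ℝ 2 f) (x t : ℂ) :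
    Laplacian.laplacian (fun t => f (x - t)) t = Laplacian.laplacian f (x - t) := by
  have hs : ContDiff ℝ 2 (fun t => f (x - t)) := hf.comp (contDiff_const.sub contDiff_id)
  have key : ∀ g : ℂ → ℝ, Differentiable ℝ g → ∀ y v : ℂ,
      fderiv ℝ (fun t => g (x - t)) y v = -fderiv ℝ g (x - y) v := by
    intro g hg y v
    have h1 : HasFDerivAt (fun t : ℂ => x - t) (-ContinuousLinearMap.id ℝ ℂ) y :=
      (hasFDerivAt_id y).const_sub x
    have h2 := (hg (x - y)).hasFDerivAt.comp y h1
    have h3 : fderiv ℝ (fun t => g (x - t)) y = _ := h2.fderiv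
    rw [h3]
    simp
  have hd : ∀ v : ℂ, Differentiable ℝ fun y => fderiv ℝ f y v := fun v =>
    (contDiff_fderiv_apply_const (m := 1) hf (by norm_num) v).differentiable (by norm_num)
  rw [laplacian_eq_fderiv_fderiv hs, laplacian_eq_fderiv_fderiv hf]
  simp only [key f (hf.differentiable (by norm_num))]
  simp only [fderiv_fun_neg, neg_apply]
  rw [key _ (hd 1), key _ (hd Complex.I)]
  ring

/-- A distribution given by a locally integrable function is harmonic on `U`. -/
def WeaklyHarmonicOn (U : Set ℂ) (H : ℂ → ℝ) : Prop :=
  ∀ φ : ℂ → ℝ, ContDiff ℝ ∞ φ → HasCompactSupport φ → tsupport φ ⊆ U →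
    ∫ z, H z * Laplacian.laplacian φ z = 0

/-- Derivatives fall on the smooth factor, and for `y` near `x` the function `t ↦ f (y - t)` is a
test function supported in `U`, so weak harmonicity applies to it directly. -/
theorem WeaklyHarmonicOn.harmonicAt_convolution {U : Set ℂ} {H f : ℂ → ℝ}
    (hw : WeaklyHarmonicOn U H) (hH : LocallyIntegrable H) (hf : ContDiff ℝ ∞ f) {ε ε' : ℝ}
    (hfs : tsupport f ⊆ closedBall 0 ε) (hε : ε < ε') {x : ℂ} (hx : ball x ε' ⊆ U) :
    InnerProductSpace.HarmonicAt (H ⋆[mul ℝ ℝ] f) x := by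
  have hfc : HasCompactSupport f :=
    (isCompact_closedBall 0 ε).of_isClosed_subset (isClosed_tsupport _) hfs
  have hf2 : ContDiff ℝ 2 f := contDiff_infty.1 hf 2
  refine ⟨(hfc.contDiff_convolution_right (n := 2) (mul ℝ ℝ) hH hf2).contDiffAt, ?_⟩
  filter_upwards [ball_mem_nhds x (sub_pos.2 hε)] with y hy
  rw [laplacian_convolution hH hf2 hfc, Pi.zero_apply]
  have := hw (fun t => f (y - t)) (hf.comp (contDiff_const.sub contDiff_id))
    (hfc.comp_homeomorph (Homeomorph.subLeft y)) ?_
  · simpa only [laplacian_comp_const_sub hf2] using this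
  · refine Subset.trans ?_ hx
    refine (closure_minimal (t := closedBall y ε) (fun t ht => ?_) isClosed_closedBall).trans ?_
    · have : y - t ∈ closedBall (0 : ℂ) ε := hfs (subset_tsupport f ht)
      rw [mem_closedBall_zero_iff] at this
      rwa [mem_closedBall', dist_eq_norm]
    · exact closedBall_subset_ball' (by rw [mem_ball] at hy; linarith)

/-- The integral is invariant under rotation of the argument of `G` about `x`. Averaging over all
angles and exchanging the integrals replaces `G` by its circle averages, which are `G x`. -/
theorem integral_radial_mul_of_harmonic {G : ℂ → ℝ} (hG : Continuous G) {x : ℂ} {δ : ℝ}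
    (hh : InnerProductSpace.HarmonicOnNhd G (closedBall x δ)) {ρ : ℝ → ℝ}
    (hρ : Continuous fun z : ℂ => ρ ‖z‖) (hρδ : ∀ r, δ ≤ r → ρ r = 0) :
    ∫ y, ρ ‖y‖ * G (x + y) = G x * ∫ y : ℂ, ρ ‖y‖ := by
  have hrot : ∀ θ : ℝ, ∫ y, ρ ‖y‖ * G (x + Complex.exp (θ * Complex.I) * y) =
      ∫ y, ρ ‖y‖ * G (x + y) := by
    intro θ
    have := (LinearIsometryEquiv.measurePreserving (rotation (Circle.exp θ))).integral_comp
      (rotation (Circle.exp θ)).toHomeomorph.measurableEmbedding (fun y => ρ ‖y‖ * G (x + y))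
    simpa using this
  have hint : Integrable (Function.uncurry fun (θ : ℝ) (y : ℂ) =>
      ρ ‖y‖ * G (x + Complex.exp (θ * Complex.I) * y))
      ((volume.restrict (Ioc 0 (2 * Real.pi))).prod volume) := by
    have hcont : Continuous (Function.uncurry fun (θ : ℝ) (y : ℂ) =>
        ρ ‖y‖ * G (x + Complex.exp (θ * Complex.I) * y)) := by
      refine (hρ.comp continuous_snd).mul (hG.comp ?_)
      fun_prop
    have hK : IntegrableOn (Function.uncurry fun (θ : ℝ) (y : ℂ) =>
        ρ ‖y‖ * G (x + Complex.exp (θ * Complex.I) * y))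
        (Icc 0 (2 * Real.pi) ×ˢ closedBall (0 : ℂ) δ) (volume.prod volume) :=
      hcont.continuousOn.integrableOn_compact (isCompact_Icc.prod (isCompact_closedBall 0 δ))
    have hK' : IntegrableOn (Function.uncurry fun (θ : ℝ) (y : ℂ) =>
        ρ ‖y‖ * G (x + Complex.exp (θ * Complex.I) * y))
        (Ioc 0 (2 * Real.pi) ×ˢ univ) (volume.prod volume) := by
      refine IntegrableOn.of_forall_sdiff_eq_zero (hK.mono_set
        (prod_mono_left Ioc_subset_Icc_self)) (measurableSet_Ioc.prod MeasurableSet.univ) ?_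
      rintro ⟨θ, y⟩ ⟨h1, h2⟩
      have : δ < ‖y‖ := by
        by_contra! h
        exact h2 ⟨h1.1, by simpa using h⟩
      simp [Function.uncurry, hρδ _ this.le]
    rw [IntegrableOn, ← Measure.prod_restrict, Measure.restrict_univ] at hK'
    exact hK'
  have h2pi : (0 : ℝ) < 2 * Real.pi := by positivity
  have hswap := integral_integral_swap hint
  simp only [hrot] at hswap
  have hin : ∀ y : ℂ, ∫ θ in Ioc 0 (2 * Real.pi),
      ρ ‖y‖ * G (x + Complex.exp (θ * Complex.I) * y) = ρ ‖y‖ * (2 * Real.pi * G x) := by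
    intro y
    rcases le_or_gt δ ‖y‖ with h | h
    · simp [hρδ _ h]
    rw [integral_const_mul]
    congr 1
    have hav : Real.circleAverage G x ‖y‖ = G x :=
      InnerProductSpace.HarmonicOnNhd.circleAverage_eq
        fun z hz => hh z (closedBall_subset_closedBall (by rw [abs_norm]; exact h.le) hz)
    rw [Real.circleAverage_eq_integral_add y.arg, smul_eq_mul, inv_mul_eq_iff_eq_mul₀ h2pi.ne',
      intervalIntegral.integral_of_le h2pi.le] at hav
    rw [← hav]
    congr 1
    ext θ
    congr 1
    rw [circleMap]
    conv_lhs => rw [← Complex.norm_mul_exp_arg_mul_I y]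
    push_cast
    rw [add_mul, Complex.exp_add]
    ring
  rw [integral_congr_ae (ae_of_all _ hin), integral_mul_const, integral_const] at hswap
  simp only [measureReal_def, Measure.restrict_apply MeasurableSet.univ, univ_inter,
    Real.volume_Ioc, sub_zero, ENNReal.toReal_ofReal h2pi.le, smul_eq_mul] at hswap
  apply mul_left_cancel₀ h2pi.ne'
  rw [hswap]
  ring

theorem exists_radial_mollifier {δ : ℝ} (hδ : 0 < δ) :
    ∃ ρ : ℝ → ℝ, ContDiff ℝ ∞ (fun z : ℂ => ρ ‖z‖) ∧ (∀ r, δ ≤ r → ρ r = 0) ∧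
      ∫ z : ℂ, ρ ‖z‖ = 1 := by
  let σ : ℝ → ℝ := fun r => Real.smoothTransition (1 - r ^ 2 / δ ^ 2)
  have hσ : ContDiff ℝ ∞ (fun z : ℂ => σ ‖z‖) :=
    Real.smoothTransition.contDiff.comp
      (contDiff_const.sub ((contDiff_norm_sq ℝ).div_const _))
  have hσ0 : ∀ r, δ ≤ r → σ r = 0 := fun r hr => by
    apply Real.smoothTransition.zero_of_nonpos
    rw [sub_nonpos, le_div_iff₀ (by positivity), one_mul]
    gcongr
  have hσc : HasCompactSupport (fun z : ℂ => σ ‖z‖) := by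
    refine HasCompactSupport.intro (isCompact_closedBall 0 δ) fun z hz => hσ0 _ ?_
    rw [mem_closedBall_zero_iff, not_le] at hz
    exact hz.le
  have hpos : 0 < ∫ z : ℂ, σ ‖z‖ := by
    refine hσ.continuous.integral_pos_of_hasCompactSupport_nonneg_nonzero hσc
      (fun z => Real.smoothTransition.nonneg _) (x := 0) ?_
    simp [σ]
  refine ⟨fun r => σ r / ∫ z : ℂ, σ ‖z‖, hσ.div_const _, fun r hr => by simp [hσ0 r hr], ?_⟩
  rw [integral_div, div_self hpos.ne']

/-- Weyl's lemma: a weakly harmonic function is almost everywhere equal to its mollification,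
which is harmonic. -/
theorem WeaklyHarmonicOn.exists_ae_eq_harmonic {U : Set ℂ} {H : ℂ → ℝ}
    (hw : WeaklyHarmonicOn U H) (hH : LocallyIntegrable H) {δ : ℝ} (hδ : 0 < δ) :
    ∃ h : ℂ → ℝ, Continuous h ∧ (∀ x, ball x (3 * δ) ⊆ U → InnerProductSpace.HarmonicAt h x) ∧
      ∀ᵐ x, ball x (3 * δ) ⊆ U → H x = h x := by
  obtain ⟨ρ, hρ, hρδ, hρ1⟩ := exists_radial_mollifier hδ
  have hρs : tsupport (fun z : ℂ => ρ ‖z‖) ⊆ closedBall 0 δ := by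
    refine closure_minimal (fun z hz => ?_) isClosed_closedBall
    by_contra h
    rw [mem_closedBall_zero_iff, not_le] at h
    exact hz (hρδ _ h.le)
  have hρc : HasCompactSupport (fun z : ℂ => ρ ‖z‖) :=
    (isCompact_closedBall 0 δ).of_isClosed_subset (isClosed_tsupport _) hρs
  have hhc : Continuous (H ⋆[mul ℝ ℝ] fun z => ρ ‖z‖) :=
    hρc.continuous_convolution_right (mul ℝ ℝ) hH hρ.continuous
  refine ⟨H ⋆[mul ℝ ℝ] fun z => ρ ‖z‖, hhc, fun x hx => ?_, ?_⟩
  · exact hw.harmonicAt_convolution hH hρ hρs (by linarith : δ < 3 * δ) hx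
  -- A second family of mollifiers, shrinking to the origin: `H ⋆ bₙ → H` almost everywhere and `(H
  -- ⋆ ρ) ⋆ bₙ → H ⋆ ρ` everywhere. It remains to see that the two sequences coincide at `x`.
  let b : ℕ → ContDiffBump (0 : ℂ) := fun n =>
    ⟨δ / (2 * (n + 1)), δ / (n + 1), by positivity, by
      gcongr
      linarith⟩
  have hb0 : Tendsto (fun n => (b n).rOut) atTop (𝓝 0) :=
    tendsto_const_div_atTop_nhds_zero_nat δ |>.comp (tendsto_add_atTop_nat 1) |>.congr
      fun n => by simp [b]
  have hbK : ∀ᶠ n in atTop, (b n).rOut ≤ 2 * (b n).rIn := Eventually.of_forall fun n => by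
    simp only [b]
    apply le_of_eq
    field_simp
  filter_upwards [ContDiffBump.ae_convolution_tendsto_right_of_locallyIntegrable
    (μ := (volume : Measure ℂ)) hb0 hbK hH] with x hx hxU
  have hlim := ContDiffBump.convolution_tendsto_right_of_continuous
    (μ := (volume : Measure ℂ)) hb0 hhc x
  refine tendsto_nhds_unique hx (hlim.congr fun n => ?_)
  have hswap : ∀ g : ℂ → ℝ, MeasureTheory.convolution ((b n).normed volume) g
      (ContinuousLinearMap.lsmul ℝ ℝ) volume = g ⋆[mul ℝ ℝ] (b n).normed volume := by
    intro g
    ext y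
    rw [convolution_lsmul, convolution_mul_swap]
    congr 1
    ext t
    rw [smul_eq_mul, mul_comm]
  rw [hswap, hswap]
  have hbs : tsupport ((b n).normed volume) ⊆ closedBall (0 : ℂ) δ := by
    rw [ContDiffBump.tsupport_normed_eq]
    refine closedBall_subset_closedBall ?_
    simp only [b]
    exact div_le_self hδ.le (by linarith [(n.cast_nonneg : (0 : ℝ) ≤ n)])
  have hbc : HasCompactSupport ((b n).normed (volume : Measure ℂ)) :=
    (b n).hasCompactSupport_normed
  have hbd : ContDiff ℝ ∞ ((b n).normed (volume : Measure ℂ)) := (b n).contDiff_normed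
  have assoc : ∀ f g : ℂ → ℝ, Continuous f → HasCompactSupport f → Continuous g →
      HasCompactSupport g → ((H ⋆[mul ℝ ℝ] f) ⋆[mul ℝ ℝ] g) x = (H ⋆[mul ℝ ℝ] (f ⋆[mul ℝ ℝ] g)) x := by
    intro f g hf hfc hg hgc
    refine convolution_assoc (mul ℝ ℝ) (mul ℝ ℝ) (mul ℝ ℝ) (mul ℝ ℝ) (fun a b c => mul_assoc a b c)
      hH.aestronglyMeasurable hf.aestronglyMeasurable hg.aestronglyMeasurable
      (ae_of_all _ (hfc.convolutionExists_right _ hH hf))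
      (ae_of_all _ (hgc.norm.convolutionExists_right _ hf.norm.locallyIntegrable hg.norm)) ?_
    refine HasCompactSupport.convolutionExists_right _ (hfc.norm.convolution _ hgc.norm)
      (fun y => (hH y).norm) ?_ x
    exact hgc.norm.continuous_convolution_right _ hf.norm.locallyIntegrable hg.norm
  -- Exchanging the mollifiers gives `(H ⋆ ρ) ⋆ bₙ = (H ⋆ bₙ) ⋆ ρ`. The inner function is harmonic
  -- at each point of the closed `δ`-disk about `x`, since the `2δ`-ball there still lies in the
  -- `3δ`-ball about `x`; by the mean value property the radial `ρ` then reproduces its value at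
  -- `x`.
  rw [assoc _ _ hρ.continuous hρc hbd.continuous hbc]
  have hcomm : ((fun z : ℂ => ρ ‖z‖) ⋆[mul ℝ ℝ] (b n).normed volume) =
      ((b n).normed volume ⋆[mul ℝ ℝ] fun z : ℂ => ρ ‖z‖) := by
    ext y
    rw [convolution_mul, convolution_mul_swap]
    congr 1
    ext t
    rw [mul_comm]
  rw [hcomm, ← assoc _ _ hbd.continuous hbc hρ.continuous hρc]
  have hGc : Continuous (H ⋆[mul ℝ ℝ] (b n).normed volume) :=
    hbc.continuous_convolution_right (mul ℝ ℝ) hH hbd.continuous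
  have hmv := integral_radial_mul_of_harmonic hGc (x := x) (δ := δ) (fun y hy => ?_)
    hρ.continuous hρδ
  · rw [hρ1, mul_one] at hmv
    rw [← hmv, convolution_mul, ← integral_add_left_eq_self _ x]
    congr 1
    ext y
    rw [mul_comm]
    simp
  · refine hw.harmonicAt_convolution hH hbd hbs (by linarith : δ < 2 * δ) ?_
    refine Subset.trans (ball_subset_ball' ?_) hxU
    rw [mem_closedBall] at hy
    linarith

theorem WeaklyHarmonicOn.exists_entire {H : ℂ → ℝ} (hw : WeaklyHarmonicOn univ H)
    (hH : LocallyIntegrable H) :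
    ∃ F : ℂ → ℂ, Differentiable ℂ F ∧ ∀ᵐ z, H z = (F z).re := by
  obtain ⟨h, -, hh, hae⟩ := hw.exists_ae_eq_harmonic hH one_pos
  obtain ⟨F, hF, hFh⟩ := InnerProductSpace.HarmonicOnNhd.exists_analyticOnNhd_univ_re_eq
    (f := h) (fun x _ => hh x (subset_univ _))
  refine ⟨F, fun z => (hF z (mem_univ z)).differentiableAt, ?_⟩
  filter_upwards [hae] with z hz
  rw [hz (subset_univ _), ← hFh]

/-! ### Consequences of condition (C) -/

/-- A measure which is uniformly bounded on disks of a fixed radius integrates the weights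
`(1 + ‖w - z‖) ^ (-s)`, `s > 2`, uniformly in `z`. -/
theorem exists_lintegral_weight_le {ν : Measure ℂ} [SFinite ν] {ρ M : ℝ} (hρ : 0 < ρ)
    (hM : ∀ x, ν (ball x ρ) ≤ ENNReal.ofReal M) {s : ℝ} (hs : 2 < s) :
    ∃ J : ℝ, ∀ z, ∫⁻ w, ENNReal.ofReal ((1 + ‖w - z‖) ^ (-s)) ∂ν ≤ ENNReal.ofReal J := by
  let W : ℂ → ENNReal := fun w => ENNReal.ofReal ((1 + ‖w‖) ^ (-s))
  have hW : Measurable W := by fun_prop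
  have hWint : ∫⁻ w, W w < ⊤ := by
    have h := (integrable_one_add_norm (E := ℂ) (μ := volume) (r := s)
      (by simpa using hs)).2
    rwa [hasFiniteIntegral_iff_ofReal (ae_of_all _ fun z => by positivity)] at h
  let c := volume (ball (0 : ℂ) ρ)
  have hc0 : c ≠ 0 := (measure_ball_pos volume _ hρ).ne'
  have hct : c ≠ ⊤ := measure_ball_lt_top.ne
  let K : ENNReal := ENNReal.ofReal ((1 + ρ) ^ s)
  have hB : c⁻¹ * (K * ENNReal.ofReal M * ∫⁻ w, W w) ≠ ⊤ :=
    ENNReal.mul_ne_top (ENNReal.inv_ne_top.2 hc0)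
      (ENNReal.mul_ne_top (ENNReal.mul_ne_top ENNReal.ofReal_ne_top ENNReal.ofReal_ne_top) hWint.ne)
  refine ⟨(c⁻¹ * (K * ENNReal.ofReal M * ∫⁻ w, W w)).toReal, fun z => ?_⟩
  rw [ENNReal.ofReal_toReal hB, ← ENNReal.mul_le_iff_le_inv hc0 hct]
  have hmeas : MeasurableSet {p : ℂ × ℂ | dist p.2 p.1 < ρ} :=
    measurableSet_lt (by fun_prop) measurable_const
  have hcw : ∀ w : ℂ, volume (ball w ρ) = c := fun w => by simp [c, Complex.volume_ball]
  -- Each `w` is smeared over the disk of radius `ρ` about it. On that disk the weight changes by at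
  -- most the factor `K = (1 + ρ)^s`, and after exchanging the integrals only `ν (ball x ρ)` and a
  -- Lebesgue integral remain.
  calc c * ∫⁻ w, ENNReal.ofReal ((1 + ‖w - z‖) ^ (-s)) ∂ν
      = ∫⁻ w, ∫⁻ x, {p : ℂ × ℂ | dist p.2 p.1 < ρ}.indicator (fun p => W (p.1 - z)) (w, x)
          ∂volume ∂ν := by
        change c * ∫⁻ w, W (w - z) ∂ν = _
        rw [← lintegral_const_mul _ (show Measurable fun w => W (w - z) by fun_prop)]
        refine lintegral_congr fun w => ?_
        rw [← hcw w, mul_comm, ← setLIntegral_const, ← lintegral_indicator measurableSet_ball]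
        rfl
    _ ≤ ∫⁻ w, ∫⁻ x, {p : ℂ × ℂ | dist p.2 p.1 < ρ}.indicator
          (fun p => K * W (p.2 - z)) (w, x) ∂volume ∂ν := by
        refine lintegral_mono fun w => lintegral_mono fun x => ?_
        refine indicator_le_indicator' fun h => ?_
        have h : dist x w < ρ := h
        simp only [W, K]
        rw [← ENNReal.ofReal_mul (by positivity)]
        refine ENNReal.ofReal_le_ofReal ?_
        have h1 : 1 + ‖x - z‖ ≤ (1 + ρ) * (1 + ‖w - z‖) := by
          have h2 : ‖x - z‖ ≤ ‖x - w‖ + ‖w - z‖ := norm_sub_le_norm_sub_add_norm_sub ..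
          rw [dist_eq_norm] at h
          nlinarith [norm_nonneg (w - z)]
        rw [Real.rpow_neg (by positivity), Real.rpow_neg (by positivity), ← div_eq_mul_inv,
          inv_eq_one_div, div_le_div_iff₀ (by positivity) (by positivity), one_mul,
          ← Real.mul_rpow (by positivity) (by positivity)]
        exact Real.rpow_le_rpow (by positivity) h1 (by linarith)
    _ = ∫⁻ x, ∫⁻ w, {p : ℂ × ℂ | dist p.2 p.1 < ρ}.indicator
          (fun p => K * W (p.2 - z)) (w, x) ∂ν := by
        refine lintegral_lintegral_swap (f := fun w x => {p : ℂ × ℂ | dist p.2 p.1 < ρ}.indicator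
          (fun p => K * W (p.2 - z)) (w, x)) ?_
        refine (Measurable.indicator ?_ hmeas).aemeasurable
        exact (hW.comp (measurable_snd.sub_const z)).const_mul K
    _ = ∫⁻ x, K * W (x - z) * ν (ball x ρ) := by
        refine lintegral_congr fun x => ?_
        rw [← setLIntegral_const, ← lintegral_indicator measurableSet_ball]
        refine lintegral_congr fun w => ?_
        simp only [indicator, mem_ofPred_eq, mem_ball, dist_comm]
    _ ≤ ∫⁻ x, K * ENNReal.ofReal M * W (x - z) := by
        refine lintegral_mono fun x => ?_
        rw [mul_assoc, mul_assoc, mul_comm (ENNReal.ofReal M)]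
        gcongr
        exact hM x
    _ = K * ENNReal.ofReal M * ∫⁻ w, W w := by
        rw [lintegral_const_mul _ (show Measurable fun w => W (w - z) by fun_prop),
          lintegral_sub_right_eq_self W z]

/-- The logarithm may vanish at distance one from the centre, so the radius is first cut to `r ≤
1/2`. Seen from a centre shifted by `r/4`, the disk of radius `r/8` about `x` lies at distances
between `r/8` and `3r/8`, where `|log| ≥ 1/2`. -/
theorem UniformLogBound.exists_measure_ball_le {ν : Measure ℂ} (h : UniformLogBound ν) :
    ∃ ρ M : ℝ, 0 < ρ ∧ ∀ x, ν (ball x ρ) ≤ ENNReal.ofReal M := by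
  obtain ⟨A, R, hR, hA⟩ := h
  let r := min R (1 / 2)
  have hr : 0 < r := lt_min hR (by norm_num)
  have hrR : r ≤ R := min_le_left ..
  have hr2 : r ≤ 1 / 2 := min_le_right ..
  refine ⟨r / 8, 2 * A, by positivity, fun x => ?_⟩
  have hdist : ∀ w ∈ ball x (r / 8), r / 8 ≤ ‖x + (r / 4 : ℝ) - w‖ ∧
      ‖x + (r / 4 : ℝ) - w‖ ≤ 3 * r / 8 := by
    intro w hw
    rw [mem_ball', dist_eq_norm] at hw
    have h1 : ‖((r / 4 : ℝ) : ℂ)‖ = r / 4 := by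
      rw [Complex.norm_real, Real.norm_eq_abs, abs_of_pos (by positivity)]
    have h2 : x + (r / 4 : ℝ) - w = ((r / 4 : ℝ) : ℂ) + (x - w) := by ring
    have h3 := norm_add_le ((r / 4 : ℝ) : ℂ) (x - w)
    have h4 := norm_sub_le (((r / 4 : ℝ) : ℂ) + (x - w)) (x - w)
    rw [add_sub_cancel_right] at h4
    rw [h2]
    constructor <;> linarith
  have hsub : ball x (r / 8) ⊆ ball (x + (r / 4 : ℝ)) R := fun w hw => by
    rw [mem_ball', dist_eq_norm]
    linarith [(hdist w hw).2]
  have hlow : ENNReal.ofReal (1 / 2) * ν (ball x (r / 8)) ≤ ENNReal.ofReal A := by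
    refine le_trans ?_ (hA (x + (r / 4 : ℝ)))
    rw [← setLIntegral_const]
    refine le_trans ?_ (lintegral_mono_set hsub)
    refine setLIntegral_mono (by fun_prop) fun w hw => ENNReal.ofReal_le_ofReal ?_
    obtain ⟨h1, h2⟩ := hdist w hw
    have h3 : Real.log ‖x + (r / 4 : ℝ) - w‖ ≤ Real.log (1 / 2) :=
      Real.log_le_log (by linarith) (by linarith)
    rw [one_div, Real.log_inv] at h3
    have := Real.log_two_gt_d9
    rw [abs_of_neg (by linarith)]
    linarith
  calc ν (ball x (r / 8)) = ENNReal.ofReal 2 * (ENNReal.ofReal (1 / 2) * ν (ball x (r / 8))) := by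
        rw [← mul_assoc, ← ENNReal.ofReal_mul (by norm_num)]
        norm_num
    _ ≤ ENNReal.ofReal 2 * ENNReal.ofReal A := by gcongr
    _ = ENNReal.ofReal (2 * A) := (ENNReal.ofReal_mul (by norm_num)).symm

/-- Condition (C) controls only the disk of radius `R`, which may be less than one; on the rest of
the unit disk `log⁺(1/·)` is at most `|log R|` and is absorbed by an integrable weight. -/
theorem UniformLogBound.exists_lintegral_posLog_inv_le {ν : Measure ℂ} [SFinite ν]
    (h : UniformLogBound ν) :
    ∃ B : ℝ, 0 ≤ B ∧
      ∀ z, ∫⁻ w, ENNReal.ofReal (Real.posLog ‖z - w‖⁻¹) ∂ν ≤ ENNReal.ofReal B := by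
  obtain ⟨ρ, M, hρ, hM⟩ := h.exists_measure_ball_le
  obtain ⟨J, hJ⟩ := exists_lintegral_weight_le hρ hM (s := 3) (by norm_num)
  obtain ⟨A, R, hR, hA⟩ := h
  -- The factor `8 = 2³` makes `8 (1 + |w - z|)⁻³ ≥ 1` for `|w - z| < 1`.
  refine ⟨max A 0 + |Real.log R| * 8 * max J 0, by positivity, fun z => ?_⟩
  have hpt : ∀ w, ENNReal.ofReal (Real.posLog ‖z - w‖⁻¹) ≤
      (ball z R).indicator (fun w => ENNReal.ofReal |Real.log ‖z - w‖|) w +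
        ENNReal.ofReal (|Real.log R| * 8) * ENNReal.ofReal ((1 + ‖w - z‖) ^ (-(3 : ℝ))) := by
    intro w
    rw [Real.posLog, Real.log_inv]
    by_cases hw : w ∈ ball z R
    · rw [indicator_of_mem hw]
      refine le_trans (ENNReal.ofReal_le_ofReal ?_) le_self_add
      exact max_le (abs_nonneg _) (neg_le_abs _)
    · rw [indicator_of_notMem hw, zero_add, ← ENNReal.ofReal_mul (by positivity)]
      refine ENNReal.ofReal_le_ofReal (max_le (by positivity) ?_)
      rw [mem_ball', dist_eq_norm, not_lt] at hw
      rcases le_or_gt 1 ‖z - w‖ with h1 | h1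
      · exact (neg_nonpos.2 (Real.log_nonneg h1)).trans (by positivity)
      · have h2 : -Real.log ‖z - w‖ ≤ |Real.log R| := by
          have := Real.log_le_log hR hw
          have := neg_abs_le (Real.log R)
          linarith
        have h3 : (1 : ℝ) ≤ 8 * (1 + ‖w - z‖) ^ (-(3 : ℝ)) := by
          rw [Real.rpow_neg (by positivity), ← div_eq_mul_inv, le_div_iff₀ (by positivity), one_mul]
          have h4 : 1 + ‖w - z‖ ≤ 2 := by rw [norm_sub_rev]; linarith
          have : (1 + ‖w - z‖) ^ (3 : ℝ) ≤ 2 ^ (3 : ℝ) :=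
            Real.rpow_le_rpow (by positivity) h4 (by norm_num)
          norm_num at this ⊢
          exact this
        calc -Real.log ‖z - w‖ ≤ |Real.log R| * 1 := by rw [mul_one]; exact h2
          _ ≤ |Real.log R| * (8 * (1 + ‖w - z‖) ^ (-(3 : ℝ))) := by gcongr
          _ = _ := by ring
  calc ∫⁻ w, ENNReal.ofReal (Real.posLog ‖z - w‖⁻¹) ∂ν
      ≤ ∫⁻ w, ((ball z R).indicator (fun w => ENNReal.ofReal |Real.log ‖z - w‖|) w +
        ENNReal.ofReal (|Real.log R| * 8) * ENNReal.ofReal ((1 + ‖w - z‖) ^ (-(3 : ℝ)))) ∂ν :=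
        lintegral_mono hpt
    _ = (∫⁻ w in ball z R, ENNReal.ofReal |Real.log ‖z - w‖| ∂ν) +
        ENNReal.ofReal (|Real.log R| * 8) *
          ∫⁻ w, ENNReal.ofReal ((1 + ‖w - z‖) ^ (-(3 : ℝ))) ∂ν := by
        rw [lintegral_add_right _ (by fun_prop), lintegral_indicator measurableSet_ball,
          lintegral_const_mul _ (by fun_prop)]
    _ ≤ ENNReal.ofReal A + ENNReal.ofReal (|Real.log R| * 8) * ENNReal.ofReal J := by
        gcongr
        · exact hA z
        · exact hJ z
    _ ≤ ENNReal.ofReal (max A 0) + ENNReal.ofReal (|Real.log R| * 8) * ENNReal.ofReal (max J 0) := by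
        gcongr
        · exact le_max_left ..
        · exact le_max_left ..
    _ = _ := by
        rw [← ENNReal.ofReal_mul (by positivity), ← ENNReal.ofReal_add (by positivity)
          (by positivity)]

/-! ### Estimates of the displacement kernel -/

theorem abs_log_sub_log_le_div {A B d m : ℝ} (hm : 0 < m) (hA : m ≤ A) (hB : m ≤ B)
    (hd : |A - B| ≤ d) : |Real.log A - Real.log B| ≤ d / m := by
  have hd0 : 0 ≤ d := (abs_nonneg _).trans hd
  rw [abs_le] at hd
  have key : ∀ x y : ℝ, m ≤ x → m ≤ y → y - x ≤ d → Real.log y - Real.log x ≤ d / m := by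
    intro x y hx hy h
    have hx0 : 0 < x := hm.trans_le hx
    have hy0 : 0 < y := hm.trans_le hy
    rw [← Real.log_div hy0.ne' hx0.ne']
    calc Real.log (y / x) ≤ y / x - 1 := Real.log_le_sub_one_of_pos (div_pos hy0 hx0)
      _ = (y - x) / x := by field_simp
      _ ≤ d / x := by gcongr
      _ ≤ d / m := by gcongr
  rw [abs_le]
  constructor
  · linarith [key A B hA hB (by linarith)]
  · exact key B A hB hA (by linarith)

theorem abs_posLog_sub_posLog_le {s t : ℝ} (hs : 0 ≤ s) (ht : 0 ≤ t) :
    |Real.posLog s - Real.posLog t| ≤ |s - t| := by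
  rw [Real.posLog_eq_log_max_one hs, Real.posLog_eq_log_max_one ht]
  have := abs_log_sub_log_le_div (d := |s - t|) one_pos (le_max_left 1 s) (le_max_left 1 t)
    (by simpa using abs_max_sub_max_le_max 1 s 1 t)
  simpa using this

theorem posLog_le_self {t : ℝ} (ht : 0 ≤ t) : Real.posLog t ≤ t := by
  have := abs_posLog_sub_posLog_le ht le_rfl
  simp only [Real.posLog_zero, sub_zero, abs_of_nonneg ht] at this
  exact (le_abs_self _).trans this

/-- Decay of the difference of two logarithms; the power `1 + η` of the distance absorbs the
logarithmic divergence near the singularity. -/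
theorem abs_log_sub_log_le_rpow {A B d η : ℝ} (hA : 1 ≤ A) (hB : 1 ≤ B) (hd : |A - B| ≤ d)
    (hd1 : 1 ≤ d) (hη : 0 < η) (hη1 : η ≤ 1) :
    |Real.log A - Real.log B| ≤ (2 * d) ^ (1 + η) / (η * A) := by
  have hA0 : 0 < A := by linarith
  have h2d : 2 * d ≤ (2 * d) ^ (1 + η) := by
    conv_lhs => rw [← Real.rpow_one (2 * d)]
    exact Real.rpow_le_rpow_of_exponent_le (by linarith) (by linarith)
  rcases le_or_gt (2 * d) A with h | h
  · have hAB : A / 2 ≤ B := by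
      rw [abs_le] at hd
      linarith
    calc |Real.log A - Real.log B| ≤ d / (A / 2) :=
          abs_log_sub_log_le_div (by linarith) (by linarith) hAB hd
      _ = 2 * d / A := by field_simp
      _ ≤ (2 * d) ^ (1 + η) / A := by gcongr
      _ ≤ (2 * d) ^ (1 + η) / (η * A) := by
          gcongr
          nlinarith
  · rcases le_or_gt B A with hBA | hBA
    · have h1 : 0 ≤ Real.log B := Real.log_nonneg hB
      have h2 : Real.log B ≤ Real.log A := Real.log_le_log (by linarith) hBA
      rw [abs_of_nonneg (by linarith)]
      calc Real.log A - Real.log B ≤ Real.log A := by linarith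
        _ ≤ A ^ η / η := Real.log_le_rpow_div hA0.le hη
        _ = A ^ (1 + η) / (η * A) := by
            rw [Real.rpow_add hA0, Real.rpow_one]
            field_simp
        _ ≤ (2 * d) ^ (1 + η) / (η * A) := by gcongr
    · calc |Real.log A - Real.log B| ≤ d / A := abs_log_sub_log_le_div hA0 le_rfl hBA.le hd
        _ ≤ (2 * d) ^ (1 + η) / A := by
            gcongr
            linarith
        _ ≤ (2 * d) ^ (1 + η) / (η * A) := by
            gcongr
            nlinarith

/-- The function `Log(1 - x) + x` has derivative `-x / (1 - x)`, of modulus at most `2s` on the disk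
of radius `s ≤ 1/2`. Cancelling the linear term of the logarithm is what yields the small factor
`s`, hence one more power of decay in `w`. -/
theorem abs_log_norm_one_sub_add_re_le {ζ ξ : ℂ} {s : ℝ} (hs : s ≤ 1 / 2) (hζ : ‖ζ‖ ≤ s)
    (hξ : ‖ξ‖ ≤ s) :
    |(Real.log ‖1 - ζ‖ + ζ.re) - (Real.log ‖1 - ξ‖ + ξ.re)| ≤ 2 * s * ‖ζ - ξ‖ := by
  let F : ℂ → ℂ := fun x => Complex.log (1 - x) + x
  have hlow : ∀ x ∈ closedBall (0 : ℂ) s, 1 / 2 ≤ ‖1 - x‖ := by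
    intro x hx
    rw [mem_closedBall_zero_iff] at hx
    have := norm_sub_norm_le (1 : ℂ) x
    rw [norm_one] at this
    linarith
  have hd : ∀ x ∈ closedBall (0 : ℂ) s, HasDerivWithinAt F (-1 / (1 - x) + 1) (closedBall 0 s) x := by
    intro x hx
    have hslit : 1 - x ∈ Complex.slitPlane := by
      left
      rw [mem_closedBall_zero_iff] at hx
      have := Complex.re_le_norm x
      rw [Complex.sub_re, Complex.one_re]
      linarith
    have h1 : HasDerivAt (fun x : ℂ => 1 - x) (-1) x := (hasDerivAt_id x).const_sub 1
    exact ((h1.clog hslit).add (hasDerivAt_id x)).hasDerivWithinAt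
  have hb : ∀ x ∈ closedBall (0 : ℂ) s, ‖-1 / (1 - x) + 1‖ ≤ 2 * s := by
    intro x hx
    have h1 := hlow x hx
    have hne : 1 - x ≠ 0 := fun h => by
      rw [h, norm_zero] at h1
      linarith
    have h2 : -1 / (1 - x) + 1 = -x / (1 - x) := by
      field_simp
      ring
    rw [mem_closedBall_zero_iff] at hx
    rw [h2, norm_div, norm_neg, div_le_iff₀ (by linarith)]
    nlinarith [norm_nonneg x]
  have hmv := (convex_closedBall (0 : ℂ) s).norm_image_sub_le_of_norm_hasDerivWithin_le hd hb
    (mem_closedBall_zero_iff.2 hξ) (mem_closedBall_zero_iff.2 hζ)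
  have hre : (F ζ - F ξ).re = (Real.log ‖1 - ζ‖ + ζ.re) - (Real.log ‖1 - ξ‖ + ξ.re) := by
    simp [F, Complex.log_re]
  rw [← hre]
  exact (Complex.abs_re_le_norm _).trans hmv

/-- The kernel whose integral against a measure is, up to bounded terms, a potential of the
difference between the measure and its image under `Φ`. -/
noncomputable def displacementKernel (Φ : ℂ → ℂ) (R : ℝ) (z w : ℂ) : ℝ :=
  Real.posLog ‖z - w‖ - Real.posLog ‖z - Φ w‖ +
    if ‖w‖ < R then Real.posLog ‖Φ w‖
    else Real.log ‖Φ w‖ - Real.log ‖w‖ + (z / w).re - (z / Φ w).re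

/-- No bound on `Φ` is available for small `w`. The added `log⁺|Φ w|` compensates for it, because
`log⁺` is 1-Lipschitz and `||z - Φ w| - |Φ w|| ≤ |z|`. -/
theorem displacementKernel_le_of_lt {Φ : ℂ → ℂ} {R : ℝ} {z w : ℂ} (hw : ‖w‖ < R) :
    |displacementKernel Φ R z w| ≤ (2 + R) * (1 + ‖z‖) := by
  rw [displacementKernel, if_pos hw]
  have h1 : Real.posLog ‖z - w‖ ≤ ‖z‖ + R :=
    (posLog_le_self (norm_nonneg _)).trans ((norm_sub_le _ _).trans (by linarith))
  have h2 := abs_posLog_sub_posLog_le (norm_nonneg (z - Φ w)) (norm_nonneg (Φ w))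
  have h3 : |‖z - Φ w‖ - ‖Φ w‖| ≤ ‖z‖ := by
    have := abs_norm_sub_norm_le (Φ w - z) (Φ w)
    rw [norm_sub_rev (Φ w) z] at this
    simpa using this
  have h4 := abs_le.1 (h2.trans h3)
  have h6 := norm_nonneg w
  have h7 : 0 ≤ Real.posLog ‖z - w‖ := Real.posLog_nonneg
  rw [abs_le]
  constructor <;> nlinarith

theorem displacementKernel_le_of_far {Φ : ℂ → ℂ} {R : ℝ} {z w : ℂ} (hwR : R ≤ ‖w‖)
    (hΦ : ‖Φ w - w‖ ≤ ‖w‖ / 2) (hw : 4 * (1 + ‖z‖) ≤ ‖w‖) :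
    |displacementKernel Φ R z w| ≤ 8 * (1 + ‖z‖) ^ 2 * ‖Φ w - w‖ / ‖w‖ ^ 3 := by
  have hz := norm_nonneg z
  have hu : ‖w‖ / 2 ≤ ‖Φ w‖ := by
    have := norm_sub_norm_le w (w - Φ w)
    rw [sub_sub_cancel, norm_sub_rev w (Φ w)] at this
    linarith
  have hw0 : 0 < ‖w‖ := by linarith
  have hu0 : 0 < ‖Φ w‖ := by linarith
  have hwne : w ≠ 0 := norm_pos_iff.1 hw0
  have hune : Φ w ≠ 0 := norm_pos_iff.1 hu0
  have hζ : ‖z / w‖ ≤ 2 * ‖z‖ / ‖w‖ := by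
    rw [norm_div]
    gcongr
    linarith
  have hξ : ‖z / Φ w‖ ≤ 2 * ‖z‖ / ‖w‖ := by
    rw [norm_div, div_le_div_iff₀ hu0 hw0]
    nlinarith
  have hs : 2 * ‖z‖ / ‖w‖ ≤ 1 / 2 := by
    rw [div_le_div_iff₀ hw0 two_pos]
    linarith
  have hsplit : ∀ v : ℂ, v ≠ 0 → 1 + ‖z‖ ≤ ‖v‖ → ‖z / v‖ ≤ 2 * ‖z‖ / ‖w‖ →
      Real.posLog ‖z - v‖ = Real.log ‖v‖ + Real.log ‖1 - z / v‖ := by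
    intro v hv hv1 hv2
    have h1 : 1 ≤ ‖z - v‖ := by
      have := norm_sub_norm_le v z
      rw [norm_sub_rev] at this
      linarith
    have h2 : z - v = -(v * (1 - z / v)) := by
      field_simp
      ring
    have h3 : 1 - z / v ≠ 0 := fun h => by
      rw [h2, h, mul_zero, neg_zero, norm_zero] at h1
      linarith
    rw [Real.posLog_eq_log (by rwa [abs_norm]), h2, norm_neg, norm_mul,
      Real.log_mul (norm_ne_zero_iff.2 hv) (norm_ne_zero_iff.2 h3)]
  -- Here `log⁺ = log` at both points, and the correction terms turn the kernel into a difference of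
  -- logarithms of genus-one factors at `z / w` and `z / Φ w`.
  have hD : displacementKernel Φ R z w = (Real.log ‖1 - z / w‖ + (z / w).re) -
      (Real.log ‖1 - z / Φ w‖ + (z / Φ w).re) := by
    rw [displacementKernel, if_neg (not_lt.2 hwR), hsplit w hwne (by linarith) hζ,
      hsplit _ hune (by linarith) hξ]
    ring
  rw [hD]
  refine (abs_log_norm_one_sub_add_re_le hs hζ hξ).trans ?_
  have hdiff : ‖z / w - z / Φ w‖ ≤ 2 * ‖z‖ * ‖Φ w - w‖ / ‖w‖ ^ 2 := by
    have : z / w - z / Φ w = z * (Φ w - w) / (w * Φ w) := by field_simp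
    rw [this, norm_div, norm_mul, norm_mul, div_le_div_iff₀ (by positivity) (by positivity)]
    have h1 : 0 ≤ ‖z‖ * ‖Φ w - w‖ := by positivity
    nlinarith [mul_le_mul_of_nonneg_left hu (mul_nonneg h1 hw0.le)]
  calc 2 * (2 * ‖z‖ / ‖w‖) * ‖z / w - z / Φ w‖
      ≤ 2 * (2 * ‖z‖ / ‖w‖) * (2 * ‖z‖ * ‖Φ w - w‖ / ‖w‖ ^ 2) := by gcongr
    _ = 8 * ‖z‖ ^ 2 * ‖Φ w - w‖ / ‖w‖ ^ 3 := by
        field_simp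
        ring
    _ ≤ _ := by
        gcongr
        linarith

/-- The correction terms no longer cancel anything and are estimated separately. The difference of
the `log⁺` is measured by a uniform bound `d ≥ 1` of the displacement; the loss `(2d)^{1+η}` is
affordable because `d` is later a multiple of `(1 + |z|)^τ`. -/
theorem displacementKernel_le_of_near {Φ : ℂ → ℂ} {R : ℝ} {z w : ℂ} (hwR : R ≤ ‖w‖) (hR : 1 ≤ R)
    (hΦ : ‖Φ w - w‖ ≤ ‖w‖ / 2) (hw : ‖w‖ ≤ 4 * (1 + ‖z‖)) {d η : ℝ} (hd1 : 1 ≤ d)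
    (hd : ‖Φ w - w‖ ≤ d) (hη : 0 < η) (hη1 : η ≤ 1) :
    |displacementKernel Φ R z w| ≤ 2 * (2 * d) ^ (1 + η) / (η * (1 + ‖w - z‖)) +
      10 * (1 + ‖z‖) * ‖Φ w - w‖ / ‖w‖ ^ 2 := by
  have hu : ‖w‖ / 2 ≤ ‖Φ w‖ := by
    have := norm_sub_norm_le w (w - Φ w)
    rw [sub_sub_cancel, norm_sub_rev w (Φ w)] at this
    linarith
  have hw0 : 0 < ‖w‖ := by linarith
  have hu0 : 0 < ‖Φ w‖ := by linarith
  have hwne : w ≠ 0 := norm_pos_iff.1 hw0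
  have hune : Φ w ≠ 0 := norm_pos_iff.1 hu0
  have h1 : |Real.posLog ‖z - w‖ - Real.posLog ‖z - Φ w‖| ≤
      2 * (2 * d) ^ (1 + η) / (η * (1 + ‖w - z‖)) := by
    rw [Real.posLog_eq_log_max_one (norm_nonneg _), Real.posLog_eq_log_max_one (norm_nonneg _)]
    refine (abs_log_sub_log_le_rpow (le_max_left _ _) (le_max_left _ _) (d := d) ?_ hd1 hη
      hη1).trans ?_
    · have h2 : |max 1 ‖z - w‖ - max 1 ‖z - Φ w‖| ≤ |‖z - w‖ - ‖z - Φ w‖| := by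
        simpa using abs_max_sub_max_le_max 1 ‖z - w‖ 1 ‖z - Φ w‖
      have h3 := abs_norm_sub_norm_le (z - w) (z - Φ w)
      rw [sub_sub_sub_cancel_left] at h3
      exact h2.trans (h3.trans hd)
    · have h2 : 1 + ‖w - z‖ ≤ 2 * max 1 ‖z - w‖ := by
        rw [norm_sub_rev]
        linarith [le_max_left 1 ‖z - w‖, le_max_right 1 ‖z - w‖]
      rw [div_le_div_iff₀ (by positivity) (by positivity)]
      have h3 : 0 ≤ (2 * d) ^ (1 + η) * η := by positivity
      nlinarith [mul_le_mul_of_nonneg_left h2 h3]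
  have h2 : |Real.log ‖Φ w‖ - Real.log ‖w‖| ≤ 8 * (1 + ‖z‖) * ‖Φ w - w‖ / ‖w‖ ^ 2 := by
    refine (abs_log_sub_log_le_div (m := ‖w‖ / 2) (by positivity) hu (by linarith)
      (abs_norm_sub_norm_le (Φ w) w)).trans ?_
    rw [div_le_div_iff₀ (by positivity) (by positivity)]
    have h3 : 0 ≤ ‖Φ w - w‖ * ‖w‖ := by positivity
    nlinarith [mul_le_mul_of_nonneg_left hw h3]
  have h3 : |(z / w).re - (z / Φ w).re| ≤ 2 * (1 + ‖z‖) * ‖Φ w - w‖ / ‖w‖ ^ 2 := by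
    rw [← Complex.sub_re]
    refine (Complex.abs_re_le_norm _).trans ?_
    have : z / w - z / Φ w = z * (Φ w - w) / (w * Φ w) := by field_simp
    rw [this, norm_div, norm_mul, norm_mul, div_le_div_iff₀ (by positivity) (by positivity)]
    have h1 : 0 ≤ ‖z‖ * ‖Φ w - w‖ := by positivity
    have h2 : 0 ≤ ‖Φ w - w‖ * (‖w‖ * ‖Φ w‖) := by positivity
    nlinarith [mul_le_mul_of_nonneg_left hu (mul_nonneg h1 hw0.le)]
  rw [displacementKernel, if_neg (not_lt.2 hwR)]
  have h4 : 10 * (1 + ‖z‖) * ‖Φ w - w‖ / ‖w‖ ^ 2 = 8 * (1 + ‖z‖) * ‖Φ w - w‖ / ‖w‖ ^ 2 +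
      2 * (1 + ‖z‖) * ‖Φ w - w‖ / ‖w‖ ^ 2 := by ring
  rw [h4]
  rw [abs_le] at h1 h2 h3 ⊢
  constructor <;> linarith [h1.1, h1.2, h2.1, h2.2, h3.1, h3.2]

/-- The kernel is dominated by two integrable weights times a power of `1 + ‖z‖` of exponent
less than two. -/
theorem exists_displacementKernel_le {Φ : ℂ → ℂ} {R a τ : ℝ} (hR : 1 ≤ R) (ha : 0 ≤ a)
    (hτ0 : 0 < τ) (hτ1 : τ < 1) (hΦ : ∀ w, R ≤ ‖w‖ → ‖Φ w - w‖ ≤ a * ‖w‖ ^ τ)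
    (hΦ2 : ∀ w, R ≤ ‖w‖ → ‖Φ w - w‖ ≤ ‖w‖ / 2) :
    ∃ C κ m : ℝ, 0 ≤ C ∧ κ < 2 ∧ 2 < m ∧ ∀ z w, |displacementKernel Φ R z w| ≤
      C * (1 + ‖z‖) ^ κ * ((1 + ‖w‖) ^ (-m) + (1 + ‖w - z‖) ^ (-m)) := by
  -- This makes `κ = 1 + τ + 2η = (3 + τ) / 2 < 2`, while `m = 2 + η` exceeds the dimension. The
  -- three regimes are `|w| < R`, `|w| ≥ 4T` and `R ≤ |w| < 4T`, with `T = 1 + |z|`.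
  obtain ⟨η, hη⟩ : ∃ η, η = (1 - τ) / 4 := ⟨_, rfl⟩
  have hη0 : 0 < η := by linarith
  have hη1 : η ≤ 1 := by linarith
  obtain ⟨m, hm⟩ : ∃ m, m = 2 + η := ⟨_, rfl⟩
  obtain ⟨κ, hκ⟩ : ∃ κ, κ = 1 + τ + 2 * η := ⟨_, rfl⟩
  let C₁ := (2 + R) * (1 + R) ^ m
  let C₂ := 8 * a * 2 ^ m
  let C₃ := 10 * a * 2 ^ m * 4 ^ (τ + η)
  let C₄ := 2 * (2 * (1 + 4 * a)) ^ (1 + η) / η * 6 ^ (1 + η)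
  have hC₁ : 0 ≤ C₁ := by positivity
  have hC₂ : 0 ≤ C₂ := by positivity
  have hC₃ : 0 ≤ C₃ := by positivity
  have hC₄ : 0 ≤ C₄ := by positivity
  refine ⟨C₁ + C₂ + C₃ + C₄, κ, m, by positivity, by linarith, by linarith, fun z w => ?_⟩
  have hT1 : 1 ≤ 1 + ‖z‖ := by linarith [norm_nonneg z]
  have hT0 : 0 < 1 + ‖z‖ := by linarith
  obtain ⟨T, hT⟩ : ∃ T, T = 1 + ‖z‖ := ⟨_, rfl⟩
  rw [← hT] at hT1 hT0 ⊢
  have hW₂ : 0 ≤ (1 + ‖w - z‖) ^ (-m) := by positivity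
  have hTle : ∀ e, e ≤ κ → T ^ e ≤ T ^ κ := fun e he =>
    Real.rpow_le_rpow_of_exponent_le hT1 he
  rcases lt_or_ge ‖w‖ R with hwR | hwR
  · have h1 : |displacementKernel Φ R z w| ≤ C₁ * T ^ κ * (1 + ‖w‖) ^ (-m) := by
      refine (displacementKernel_le_of_lt hwR).trans ?_
      rw [← hT]
      have h2 : T ≤ T ^ κ := by simpa using hTle 1 (by linarith)
      have h3 : 1 ≤ (1 + R) ^ m * (1 + ‖w‖) ^ (-m) := by
        rw [Real.rpow_neg (by positivity), ← div_eq_mul_inv, le_div_iff₀ (by positivity), one_mul]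
        exact Real.rpow_le_rpow (by positivity) (by linarith) (by linarith)
      calc (2 + R) * T = (2 + R) * T * 1 := by ring
        _ ≤ (2 + R) * T ^ κ * ((1 + R) ^ m * (1 + ‖w‖) ^ (-m)) := by gcongr
        _ = _ := by simp only [C₁]; ring
    refine h1.trans ?_
    gcongr <;> linarith
  have hw1 : 1 ≤ ‖w‖ := hR.trans hwR
  have hw0 : 0 < ‖w‖ := by linarith
  have hwm : ‖w‖ ^ (-m) ≤ 2 ^ m * (1 + ‖w‖) ^ (-m) := by
    rw [Real.rpow_neg (by positivity), Real.rpow_neg (by positivity), ← div_eq_mul_inv,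
      inv_eq_one_div, div_le_div_iff₀ (by positivity) (by positivity), one_mul,
      ← Real.mul_rpow (by positivity) (by positivity)]
    exact Real.rpow_le_rpow (by positivity) (by linarith) (by linarith)
  have hd := hΦ w hwR
  rcases le_or_gt (4 * T) ‖w‖ with hfar | hnear
  · have h1 : |displacementKernel Φ R z w| ≤ C₂ * T ^ κ * (1 + ‖w‖) ^ (-m) := by
      refine (displacementKernel_le_of_far hwR (hΦ2 w hwR) (by rwa [← hT])).trans ?_
      rw [← hT]
      -- The power `|w|^{τ-3}` decays faster than the weight of exponent `m` needs. The surplus `τ -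
      -- 1 + η` is negative, so `|w| ≥ T` converts it into a gain in `T`.
      have h2 : ‖w‖ ^ τ / ‖w‖ ^ 3 = ‖w‖ ^ (-m) * ‖w‖ ^ (τ - 1 + η) := by
        rw [← Real.rpow_add hw0, ← Real.rpow_natCast, ← Real.rpow_sub hw0]
        congr 1
        push_cast
        linarith
      have h3 : ‖w‖ ^ (τ - 1 + η) ≤ T ^ (τ - 1 + η) :=
        Real.rpow_le_rpow_of_nonpos hT0 (by linarith) (by linarith)
      have h4 : T ^ 2 * T ^ (τ - 1 + η) ≤ T ^ κ := by
        rw [← Real.rpow_natCast, ← Real.rpow_add hT0]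
        exact hTle _ (by push_cast; linarith)
      calc 8 * T ^ 2 * ‖Φ w - w‖ / ‖w‖ ^ 3 ≤ 8 * T ^ 2 * (a * ‖w‖ ^ τ) / ‖w‖ ^ 3 := by gcongr
        _ = 8 * a * T ^ 2 * (‖w‖ ^ τ / ‖w‖ ^ 3) := by ring
        _ = 8 * a * T ^ 2 * (‖w‖ ^ (-m) * ‖w‖ ^ (τ - 1 + η)) := by rw [h2]
        _ ≤ 8 * a * T ^ 2 * ((2 ^ m * (1 + ‖w‖) ^ (-m)) * T ^ (τ - 1 + η)) := by gcongr
        _ = 8 * a * (2 ^ m * (1 + ‖w‖) ^ (-m)) * (T ^ 2 * T ^ (τ - 1 + η)) := by ring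
        _ ≤ 8 * a * (2 ^ m * (1 + ‖w‖) ^ (-m)) * T ^ κ := by gcongr
        _ = _ := by simp only [C₂]; ring
    refine h1.trans ?_
    gcongr <;> linarith
  · have hTτ : 1 ≤ T ^ τ := Real.one_le_rpow hT1 hτ0.le
    have hdd : ‖Φ w - w‖ ≤ (1 + 4 * a) * T ^ τ := by
      have h4 : (4 : ℝ) ^ τ ≤ 4 := by
        conv_rhs => rw [← Real.rpow_one 4]
        exact Real.rpow_le_rpow_of_exponent_le (by norm_num) hτ1.le
      calc ‖Φ w - w‖ ≤ a * ‖w‖ ^ τ := hd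
        _ ≤ a * (4 * T) ^ τ := by gcongr
        _ = a * (4 ^ τ * T ^ τ) := by rw [Real.mul_rpow (by norm_num) hT0.le]
        _ ≤ a * (4 * T ^ τ) := by gcongr
        _ ≤ _ := by nlinarith
    have hd1 : 1 ≤ (1 + 4 * a) * T ^ τ := by nlinarith
    have h0 := displacementKernel_le_of_near hwR hR (hΦ2 w hwR) (by rw [← hT]; exact hnear.le)
      hd1 hdd hη0 hη1
    rw [← hT] at h0
    have h1 : 10 * T * ‖Φ w - w‖ / ‖w‖ ^ 2 ≤ C₃ * T ^ κ * (1 + ‖w‖) ^ (-m) := by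
      have h2 : ‖w‖ ^ τ / ‖w‖ ^ 2 = ‖w‖ ^ (-m) * ‖w‖ ^ (τ + η) := by
        rw [← Real.rpow_add hw0, ← Real.rpow_natCast, ← Real.rpow_sub hw0]
        congr 1
        push_cast
        linarith
      have h3 : ‖w‖ ^ (τ + η) ≤ 4 ^ (τ + η) * T ^ (τ + η) := by
        rw [← Real.mul_rpow (by norm_num) hT0.le]
        exact Real.rpow_le_rpow hw0.le hnear.le (by linarith)
      have h4 : T * T ^ (τ + η) ≤ T ^ κ := by
        calc T * T ^ (τ + η) = T ^ (1 + (τ + η)) := by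
              rw [Real.rpow_add hT0 1, Real.rpow_one]
          _ ≤ _ := hTle _ (by linarith)
      calc 10 * T * ‖Φ w - w‖ / ‖w‖ ^ 2 ≤ 10 * T * (a * ‖w‖ ^ τ) / ‖w‖ ^ 2 := by gcongr
        _ = 10 * a * T * (‖w‖ ^ τ / ‖w‖ ^ 2) := by ring
        _ = 10 * a * T * (‖w‖ ^ (-m) * ‖w‖ ^ (τ + η)) := by rw [h2]
        _ ≤ 10 * a * T * ((2 ^ m * (1 + ‖w‖) ^ (-m)) * (4 ^ (τ + η) * T ^ (τ + η))) := by gcongr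
        _ = 10 * a * (2 ^ m * (1 + ‖w‖) ^ (-m)) * 4 ^ (τ + η) * (T * T ^ (τ + η)) := by ring
        _ ≤ 10 * a * (2 ^ m * (1 + ‖w‖) ^ (-m)) * 4 ^ (τ + η) * T ^ κ := by gcongr
        _ = _ := by simp only [C₃]; ring
    have h2 : 2 * (2 * ((1 + 4 * a) * T ^ τ)) ^ (1 + η) / (η * (1 + ‖w - z‖)) ≤
        C₄ * T ^ κ * (1 + ‖w - z‖) ^ (-m) := by
      have hV0 : 0 < 1 + ‖w - z‖ := by positivity
      have hV : 1 + ‖w - z‖ ≤ 6 * T := by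
        have := norm_sub_le w z
        linarith
      -- The decay in `w - z` is only of order one; in this regime `1 + |w - z| ≤ 6T`, so the
      -- missing decay is bought with the factor `T^{1+η}`.
      have h3 : (1 + ‖w - z‖)⁻¹ ≤ 6 ^ (1 + η) * T ^ (1 + η) * (1 + ‖w - z‖) ^ (-m) := by
        rw [← Real.mul_rpow (by norm_num) hT0.le]
        calc (1 + ‖w - z‖)⁻¹ = (1 + ‖w - z‖) ^ (1 + η) * (1 + ‖w - z‖) ^ (-m) := by
              rw [← Real.rpow_add hV0, ← Real.rpow_neg_one]
              congr 1
              linarith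
          _ ≤ _ := by gcongr
      have h4 : (2 * ((1 + 4 * a) * T ^ τ)) ^ (1 + η) ≤
          (2 * (1 + 4 * a)) ^ (1 + η) * T ^ (τ + η) := by
        rw [← mul_assoc, Real.mul_rpow (by positivity) (by positivity), ← Real.rpow_mul hT0.le]
        gcongr
        nlinarith
      have h5 : T ^ (τ + η) * T ^ (1 + η) = T ^ κ := by
        rw [← Real.rpow_add hT0]
        congr 1
        linarith
      calc 2 * (2 * ((1 + 4 * a) * T ^ τ)) ^ (1 + η) / (η * (1 + ‖w - z‖))
          = 2 * (2 * ((1 + 4 * a) * T ^ τ)) ^ (1 + η) / η * (1 + ‖w - z‖)⁻¹ := by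
            rw [div_mul_eq_div_div, div_eq_mul_inv _ (1 + ‖w - z‖)]
        _ ≤ 2 * ((2 * (1 + 4 * a)) ^ (1 + η) * T ^ (τ + η)) / η *
            (6 ^ (1 + η) * T ^ (1 + η) * (1 + ‖w - z‖) ^ (-m)) := by gcongr
        _ = C₄ * (T ^ (τ + η) * T ^ (1 + η)) * (1 + ‖w - z‖) ^ (-m) := by simp only [C₄]; ring
        _ = _ := by rw [h5]
    refine h0.trans ((add_le_add h2 h1).trans ?_)
    have h3 : C₄ * T ^ κ * (1 + ‖w - z‖) ^ (-m) ≤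
        (C₁ + C₂ + C₃ + C₄) * T ^ κ * (1 + ‖w - z‖) ^ (-m) := by
      gcongr
      linarith
    have h4 : C₃ * T ^ κ * (1 + ‖w‖) ^ (-m) ≤
        (C₁ + C₂ + C₃ + C₄) * T ^ κ * (1 + ‖w‖) ^ (-m) := by
      gcongr
      linarith
    linarith

/-! ### The potential of a measure minus its image -/

theorem MeasureTheory.Integrable.fun_sub {ν : Measure ℂ} {f g : ℂ → ℝ} (hf : Integrable f ν)
    (hg : Integrable g ν) : Integrable (fun z => f z - g z) ν :=
  hf.sub hg

section KernelPotential

variable {ν : Measure ℂ} {k : ℂ → ℂ → ℝ} {b : ℂ → ℝ}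

theorem norm_integral_kernel_le (hb0 : ∀ z, 0 ≤ b z)
    (hkb : ∀ z, ∫⁻ w, ‖k z w‖ₑ ∂ν ≤ ENNReal.ofReal (b z)) (z : ℂ) :
    ‖∫ w, k z w ∂ν‖ ≤ b z := by
  rw [← ENNReal.ofReal_le_ofReal_iff (hb0 z), ofReal_norm]
  exact (enorm_integral_le_lintegral_enorm _).trans (hkb z)

variable [SFinite ν]

theorem locallyIntegrable_integral_kernel (hk : Measurable (Function.uncurry k))
    (hb : Continuous b) (hb0 : ∀ z, 0 ≤ b z)
    (hkb : ∀ z, ∫⁻ w, ‖k z w‖ₑ ∂ν ≤ ENNReal.ofReal (b z)) :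
    LocallyIntegrable fun z => ∫ w, k z w ∂ν := by
  refine (hb.locallyIntegrable (μ := volume)).mono
    (hk.stronglyMeasurable.integral_prod_right (ν := ν)).aestronglyMeasurable ?_
  exact ae_of_all _ fun z => by
    rw [Real.norm_of_nonneg (hb0 z)]
    exact norm_integral_kernel_le hb0 hkb z

theorem integrable_kernel_mul (hk : Measurable (Function.uncurry k))
    (hb : Continuous b) (hkb : ∀ z, ∫⁻ w, ‖k z w‖ₑ ∂ν ≤ ENNReal.ofReal (b z)) {χ : ℂ → ℝ}
    (hχ : Continuous χ) (hχc : HasCompactSupport χ) :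
    Integrable (Function.uncurry fun z w => k z w * χ z) (volume.prod ν) := by
  have hm : Measurable (Function.uncurry fun z w => k z w * χ z) :=
    hk.mul (hχ.measurable.comp measurable_fst)
  refine ⟨hm.aestronglyMeasurable, ?_⟩
  rw [hasFiniteIntegral_iff_enorm, lintegral_prod _ hm.enorm.aemeasurable]
  have hbχ : Integrable fun z => b z * χ z :=
    (hb.mul hχ).integrable_of_hasCompactSupport hχc.mul_left
  refine lt_of_le_of_lt (lintegral_mono fun z => ?_) hbχ.2
  calc ∫⁻ w, ‖Function.uncurry (fun z w => k z w * χ z) (z, w)‖ₑ ∂ν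
      = ∫⁻ w, ‖k z w‖ₑ * ‖χ z‖ₑ ∂ν := by simp [Function.uncurry, enorm_mul]
    _ = (∫⁻ w, ‖k z w‖ₑ ∂ν) * ‖χ z‖ₑ :=
        lintegral_mul_const _ (hk.comp (by fun_prop : Measurable fun w => (z, w))).enorm
    _ ≤ ‖b z‖ₑ * ‖χ z‖ₑ := by
        gcongr
        exact (hkb z).trans (Real.ofReal_le_enorm _)
    _ = ‖b z * χ z‖ₑ := (enorm_mul _ _).symm

theorem integrable_integral_kernel_mul (hk : Measurable (Function.uncurry k))
    (hb : Continuous b) (hkb : ∀ z, ∫⁻ w, ‖k z w‖ₑ ∂ν ≤ ENNReal.ofReal (b z)) {χ : ℂ → ℝ}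
    (hχ : Continuous χ) (hχc : HasCompactSupport χ) :
    Integrable (fun w => ∫ z, k z w * χ z) ν :=
  (integrable_kernel_mul hk hb hkb hχ hχc).integral_prod_right

theorem integral_integral_kernel_mul (hk : Measurable (Function.uncurry k))
    (hb : Continuous b) (hkb : ∀ z, ∫⁻ w, ‖k z w‖ₑ ∂ν ≤ ENNReal.ofReal (b z)) {χ : ℂ → ℝ}
    (hχ : Continuous χ) (hχc : HasCompactSupport χ) :
    ∫ z, (∫ w, k z w ∂ν) * χ z = ∫ w, (∫ z, k z w * χ z) ∂ν := by
  rw [← integral_integral_swap (integrable_kernel_mul hk hb hkb hχ hχc)]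
  simp only [integral_mul_const]

end KernelPotential

/-- Raising the exponent to at least `1/2` makes it positive, and enlarging `R` makes the
displacement at most half of `|w|`, since `τ < 1`. -/
theorem SublinearDisplacement.exists_bounds {Φ : ℂ → ℂ} (h : SublinearDisplacement Φ) :
    ∃ a τ R : ℝ, 0 ≤ a ∧ 0 < τ ∧ τ < 1 ∧ 1 ≤ R ∧
      (∀ w, R ≤ ‖w‖ → ‖Φ w - w‖ ≤ a * ‖w‖ ^ τ) ∧ ∀ w, R ≤ ‖w‖ → ‖Φ w - w‖ ≤ ‖w‖ / 2 := by
  obtain ⟨a, τ, R, ha, hτ, hΦ⟩ := h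
  obtain ⟨σ, hσ⟩ : ∃ σ, σ = max τ (1 / 2) := ⟨_, rfl⟩
  have hσ0 : 0 < σ := by rw [hσ]; exact lt_max_of_lt_right (by norm_num)
  have hσ1 : σ < 1 := by rw [hσ]; exact max_lt hτ (by norm_num)
  have hlim : Tendsto (fun t : ℝ => a * t ^ (-(1 - σ))) atTop (𝓝 (a * 0)) :=
    (tendsto_rpow_neg_atTop (by linarith)).const_mul a
  rw [mul_zero] at hlim
  obtain ⟨R₂, hR₂⟩ := eventually_atTop.1 (hlim.eventually (ge_mem_nhds (show (0 : ℝ) < 1 / 2 by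
    norm_num)))
  refine ⟨a, σ, max (max R R₂) 1, ha, hσ0, hσ1, le_max_right _ _, ?_, ?_⟩
  · intro w hw
    have hw1 : 1 ≤ ‖w‖ := (le_max_right _ _).trans hw
    refine (hΦ w ((le_max_left _ _).trans ((le_max_left _ _).trans hw))).trans ?_
    gcongr
    rw [hσ]
    exact le_max_left _ _
  · intro w hw
    have hw1 : 1 ≤ ‖w‖ := (le_max_right _ _).trans hw
    have h1 : ‖Φ w - w‖ ≤ a * ‖w‖ ^ σ := by
      refine (hΦ w ((le_max_left _ _).trans ((le_max_left _ _).trans hw))).trans ?_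
      gcongr
      rw [hσ]
      exact le_max_left _ _
    have h2 := hR₂ ‖w‖ ((le_max_right _ _).trans ((le_max_left _ _).trans hw))
    have h3 : ‖w‖ ^ σ = ‖w‖ ^ (-(1 - σ)) * ‖w‖ := by
      conv_rhs => rw [← Real.rpow_one ‖w‖, ← Real.rpow_mul (norm_nonneg _), one_mul]
      rw [← Real.rpow_add (by linarith)]
      congr 1
      ring
    rw [h3] at h1
    nlinarith

theorem measurable_displacementKernel {Φ : ℂ → ℂ} (hΦ : Measurable Φ) (R : ℝ) :
    Measurable (Function.uncurry (displacementKernel Φ R)) := by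
  have hp : Measurable Real.posLog := Real.continuous_posLog.measurable
  unfold displacementKernel Function.uncurry
  refine Measurable.add ?_ (Measurable.ite ?_ ?_ ?_)
  · fun_prop
  · exact measurableSet_lt (by fun_prop) measurable_const
  · fun_prop
  · fun_prop

theorem exists_lintegral_displacementKernel_le {Φ : ℂ → ℂ} {R a τ : ℝ} (hR : 1 ≤ R) (ha : 0 ≤ a)
    (hτ0 : 0 < τ) (hτ1 : τ < 1) (hΦ : ∀ w, R ≤ ‖w‖ → ‖Φ w - w‖ ≤ a * ‖w‖ ^ τ)
    (hΦ2 : ∀ w, R ≤ ‖w‖ → ‖Φ w - w‖ ≤ ‖w‖ / 2) {ν : Measure ℂ} [SFinite ν]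
    (hν : UniformLogBound ν) :
    ∃ C κ : ℝ, 0 ≤ C ∧ 0 ≤ κ ∧ κ < 2 ∧ ∀ z, ∫⁻ w, ‖displacementKernel Φ R z w‖ₑ ∂ν ≤
      ENNReal.ofReal (C * (1 + ‖z‖) ^ κ) := by
  obtain ⟨C, κ, m, hC, hκ, hm, hD⟩ := exists_displacementKernel_le hR ha hτ0 hτ1 hΦ hΦ2
  obtain ⟨ρ, M, hρ, hM⟩ := hν.exists_measure_ball_le
  obtain ⟨J, hJ⟩ := exists_lintegral_weight_le hρ hM hm
  refine ⟨C * (max J 0 + max J 0), max κ 0, by positivity, le_max_right _ _,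
    max_lt hκ two_pos, fun z => ?_⟩
  have hJ' : ∀ z, ∫⁻ w, ENNReal.ofReal ((1 + ‖w - z‖) ^ (-m)) ∂ν ≤ ENNReal.ofReal (max J 0) :=
    fun z => (hJ z).trans (ENNReal.ofReal_le_ofReal (le_max_left _ _))
  have hz1 : 1 ≤ 1 + ‖z‖ := by linarith [norm_nonneg z]
  calc ∫⁻ w, ‖displacementKernel Φ R z w‖ₑ ∂ν
      ≤ ∫⁻ w, ENNReal.ofReal (C * (1 + ‖z‖) ^ κ) * (ENNReal.ofReal ((1 + ‖w - 0‖) ^ (-m)) +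
          ENNReal.ofReal ((1 + ‖w - z‖) ^ (-m))) ∂ν := by
        refine lintegral_mono fun w => ?_
        rw [← ENNReal.ofReal_add (by positivity) (by positivity),
          ← ENNReal.ofReal_mul (by positivity), Real.enorm_eq_ofReal_abs, sub_zero]
        exact ENNReal.ofReal_le_ofReal (hD z w)
    _ = ENNReal.ofReal (C * (1 + ‖z‖) ^ κ) * (∫⁻ w, ENNReal.ofReal ((1 + ‖w - 0‖) ^ (-m)) ∂ν +
          ∫⁻ w, ENNReal.ofReal ((1 + ‖w - z‖) ^ (-m)) ∂ν) := by
        rw [lintegral_const_mul _ (by fun_prop), lintegral_add_right _ (by fun_prop)]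
    _ ≤ ENNReal.ofReal (C * (1 + ‖z‖) ^ κ) *
          (ENNReal.ofReal (max J 0) + ENNReal.ofReal (max J 0)) := by
        gcongr
        · exact hJ' 0
        · exact hJ' z
    _ = ENNReal.ofReal (C * (max J 0 + max J 0) * (1 + ‖z‖) ^ κ) := by
        rw [← ENNReal.ofReal_add (by positivity) (by positivity),
          ← ENNReal.ofReal_mul (by positivity)]
        congr 1
        ring
    _ ≤ _ := by
        refine ENNReal.ofReal_le_ofReal ?_
        gcongr
        exact le_max_left _ _

theorem integral_affine_mul_laplacian {φ : ℂ → ℝ} (hφ : ContDiff ℝ 2 φ)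
    (hφc : HasCompactSupport φ) (c q : ℂ) :
    ∫ z, (c + z * q).re * Laplacian.laplacian φ z = 0 := by
  have hc : ContDiff ℝ 2 (fun z : ℂ => (c + z * q).re) :=
    Complex.reCLM.contDiff.comp (contDiff_const.add (contDiff_id.mul contDiff_const))
  rw [integral_mul_laplacian_comm hc hφ hφc]
  have : ∀ z, Laplacian.laplacian (fun z : ℂ => (c + z * q).re) z = 0 := fun z => by
    have h : AnalyticAt ℂ (fun z : ℂ => c + z * q) z := by fun_prop
    exact h.harmonicAt_re.2.eq_of_nhds
  simp only [this, zero_mul, integral_zero]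

theorem integrable_posLog_mul {χ : ℂ → ℝ} (hχ : Continuous χ) (hχc : HasCompactSupport χ) (p : ℂ) :
    Integrable fun z => Real.posLog ‖z - p‖ * χ z := by
  have hp : Continuous fun z : ℂ => Real.posLog ‖z - p‖ := by fun_prop
  exact (hp.mul hχ).integrable_of_hasCompactSupport hχc.mul_left

/-- This is the fundamental solution, written with `log = log⁺ - log⁺(1/·)`. -/
theorem integral_posLog_sub_posLog_inv_mul_laplacian {φ : ℂ → ℝ} (hφ : ContDiff ℝ 2 φ)
    (hφc : HasCompactSupport φ) (p : ℂ) :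
    (∫ z, Real.posLog ‖z - p‖ * Laplacian.laplacian φ z) -
      (∫ z, Real.posLog ‖z - p‖⁻¹ * Laplacian.laplacian φ z) = 2 * Real.pi * φ p := by
  have hΔ := continuous_laplacian hφ
  have hΔc := hasCompactSupport_laplacian hφc
  have h1 := integrable_posLog_mul hΔ hΔc p
  have h2 : Integrable fun z : ℂ => Real.log ‖z - p‖ * Laplacian.laplacian φ z := by
    simpa using
      (locallyIntegrable_log_norm_sub p).integrable_smul_right_of_hasCompactSupport hΔ hΔc
  have h3 : (fun z : ℂ => Real.posLog ‖z - p‖⁻¹ * Laplacian.laplacian φ z) =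
      fun z => Real.posLog ‖z - p‖ * Laplacian.laplacian φ z -
        Real.log ‖z - p‖ * Laplacian.laplacian φ z := by
    ext z
    rw [← Real.posLog_sub_posLog_inv]
    ring
  rw [h3, integral_sub h1 h2, sub_sub_cancel, integral_log_norm_sub_mul_laplacian hφ hφc]

/-- For fixed `w` the correction is the real part of a complex affine function of `z`, hence
harmonic and invisible to the Laplacian. -/
theorem integral_displacementKernel_mul_laplacian {Φ : ℂ → ℂ} {R : ℝ} {φ : ℂ → ℝ}
    (hφ : ContDiff ℝ 2 φ) (hφc : HasCompactSupport φ) (w : ℂ) :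
    ∫ z, displacementKernel Φ R z w * Laplacian.laplacian φ z =
      (∫ z, Real.posLog ‖z - w‖ * Laplacian.laplacian φ z) -
        ∫ z, Real.posLog ‖z - Φ w‖ * Laplacian.laplacian φ z := by
  have hΔ := continuous_laplacian hφ
  have hΔc := hasCompactSupport_laplacian hφc
  obtain ⟨c, q, hcq⟩ : ∃ c q : ℂ, ∀ z, displacementKernel Φ R z w =
      Real.posLog ‖z - w‖ - Real.posLog ‖z - Φ w‖ + (c + z * q).re := by
    by_cases hw : ‖w‖ < R
    · refine ⟨(Real.posLog ‖Φ w‖ : ℝ), 0, fun z => ?_⟩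
      simp [displacementKernel, hw]
    · refine ⟨((Real.log ‖Φ w‖ - Real.log ‖w‖ : ℝ) : ℂ), w⁻¹ - (Φ w)⁻¹, fun z => ?_⟩
      rw [displacementKernel, if_neg hw, mul_sub, ← div_eq_mul_inv, ← div_eq_mul_inv,
        Complex.add_re, Complex.ofReal_re, Complex.sub_re]
      ring
  have h1 := integrable_posLog_mul hΔ hΔc w
  have h2 := integrable_posLog_mul hΔ hΔc (Φ w)
  have h3 : Integrable fun z : ℂ => (c + z * q).re * Laplacian.laplacian φ z := by
    have : Continuous fun z : ℂ => (c + z * q).re := by fun_prop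
    exact (this.mul hΔ).integrable_of_hasCompactSupport hΔc.mul_left
  simp only [hcq, add_mul, sub_mul]
  rw [integral_add (h1.fun_sub h2) h3, integral_sub h1 h2, integral_affine_mul_laplacian hφ hφc,
    add_zero]

/-- The difference of a measure and its image under a sublinear displacement has a potential of
growth slower than quadratic. -/
theorem exists_potential_sub_image {μ μs : SignedRadon} (hμpos : UniformLogBound μ.pos)
    (hμneg : UniformLogBound μ.neg) {Φ : ℂ → ℂ} (hΦm : Measurable Φ)
    (hΦ : SublinearDisplacement Φ) (hμs : SignedRadon.IsImage Φ μ μs)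
    (hμspos : UniformLogBound μs.pos) (hμsneg : UniformLogBound μs.neg) :
    ∃ U : ℂ → ℝ, (μ - μs).IsPotential U ∧
      ∃ C κ : ℝ, κ < 2 ∧ ∀ z, |U z| ≤ C * (1 + ‖z‖) ^ κ := by
  have := μ.pos_locallyFinite
  have := μ.neg_locallyFinite
  have := μs.pos_locallyFinite
  have := μs.neg_locallyFinite
  obtain ⟨a, τ, R, ha, hτ0, hτ1, hR, hΦ1, hΦ2⟩ := hΦ.exists_bounds
  obtain ⟨C₁, κ₁, hC₁, hκ₁, hκ₁', hD₁⟩ :=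
    exists_lintegral_displacementKernel_le hR ha hτ0 hτ1 hΦ1 hΦ2 hμpos
  obtain ⟨C₂, κ₂, hC₂, hκ₂, hκ₂', hD₂⟩ :=
    exists_lintegral_displacementKernel_le hR ha hτ0 hτ1 hΦ1 hΦ2 hμneg
  obtain ⟨B₁, hB₁, hV₁⟩ := hμpos.exists_lintegral_posLog_inv_le
  obtain ⟨B₂, hB₂, hV₂⟩ := hμneg.exists_lintegral_posLog_inv_le
  obtain ⟨B₃, hB₃, hV₃⟩ := hμspos.exists_lintegral_posLog_inv_le
  obtain ⟨B₄, hB₄, hV₄⟩ := hμsneg.exists_lintegral_posLog_inv_le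
  have hDm := measurable_displacementKernel hΦm R
  have hpm : Measurable Real.posLog := Real.continuous_posLog.measurable
  have hVm : Measurable (Function.uncurry fun z w : ℂ => Real.posLog ‖z - w‖⁻¹) := by
    unfold Function.uncurry
    fun_prop
  have hVe : ∀ {ν : Measure ℂ} {B : ℝ},
      (∀ z, ∫⁻ w, ENNReal.ofReal (Real.posLog ‖z - w‖⁻¹) ∂ν ≤ ENNReal.ofReal B) →
      ∀ z, ∫⁻ w, ‖Real.posLog ‖z - w‖⁻¹‖ₑ ∂ν ≤ ENNReal.ofReal ((fun _ => B) z) := by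
    intro ν B h z
    simpa only [Real.enorm_of_nonneg Real.posLog_nonneg] using h z
  replace hV₁ := hVe hV₁
  replace hV₂ := hVe hV₂
  replace hV₃ := hVe hV₃
  replace hV₄ := hVe hV₄
  have hbc : ∀ C κ : ℝ, 0 ≤ κ → Continuous fun z : ℂ => C * (1 + ‖z‖) ^ κ := fun C κ hκ =>
    continuous_const.mul ((by fun_prop : Continuous fun z : ℂ => 1 + ‖z‖).rpow_const
      fun z => Or.inr hκ)
  have hb₁ := hbc C₁ κ₁ hκ₁
  have hb₂ := hbc C₂ κ₂ hκ₂
  have hb₁0 : ∀ z : ℂ, 0 ≤ C₁ * (1 + ‖z‖) ^ κ₁ := fun z => by positivity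
  have hb₂0 : ∀ z : ℂ, 0 ≤ C₂ * (1 + ‖z‖) ^ κ₂ := fun z => by positivity
  let D := displacementKernel Φ R
  let N : ℂ → ℂ → ℝ := fun z w => Real.posLog ‖z - w‖⁻¹
  have hlD₁ := locallyIntegrable_integral_kernel hDm hb₁ hb₁0 hD₁
  have hlD₂ := locallyIntegrable_integral_kernel hDm hb₂ hb₂0 hD₂
  have hlV₁ := locallyIntegrable_integral_kernel hVm continuous_const (fun _ => hB₁) hV₁
  have hlV₂ := locallyIntegrable_integral_kernel hVm continuous_const (fun _ => hB₂) hV₂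
  have hlV₃ := locallyIntegrable_integral_kernel hVm continuous_const (fun _ => hB₃) hV₃
  have hlV₄ := locallyIntegrable_integral_kernel hVm continuous_const (fun _ => hB₄) hV₄
  -- The kernel `D` is integrated against `μ` only; the image measure enters solely through the
  -- bounded potentials of `N`.
  let G : ℂ → ℝ := fun z => (∫ w, D z w ∂μ.pos) - (∫ w, D z w ∂μ.neg) - (∫ w, N z w ∂μ.pos) +
    (∫ w, N z w ∂μ.neg) + (∫ w, N z w ∂μs.pos) - ∫ w, N z w ∂μs.neg
  have hG : LocallyIntegrable G :=
    ((((hlD₁.sub hlD₂).sub hlV₁).add hlV₂).add hlV₃).sub hlV₄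
  have h2pi : (0 : ℝ) < 2 * Real.pi := by positivity
  refine ⟨fun z => (2 * Real.pi)⁻¹ * G z, ⟨?_, ?_⟩, ?_⟩
  · exact hG.smul (2 * Real.pi)⁻¹
  · intro φ hφ hφc
    have hφ2 : ContDiff ℝ 2 φ := contDiff_infty.1 hφ 2
    have hΔ := continuous_laplacian hφ2
    have hΔc := hasCompactSupport_laplacian hφc
    let χ : ℂ → ℝ := Laplacian.laplacian φ
    let Lp : ℂ → ℝ := fun p => ∫ z, Real.posLog ‖z - p‖ * χ z
    let Lm : ℂ → ℝ := fun p => ∫ z, Real.posLog ‖z - p‖⁻¹ * χ z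
    -- `Lm` is integrable against each of the four measures by Fubini and (C), and `φ` has compact
    -- support. This is how `Lp` becomes integrable, although `log⁺` is unbounded at infinity.
    have hLpm : ∀ p, Lp p = Lm p + 2 * Real.pi * φ p := fun p => by
      have : Lp p - Lm p = _ := integral_posLog_sub_posLog_inv_mul_laplacian hφ2 hφc p
      linarith
    have hφi : ∀ (ν : Measure ℂ) [IsLocallyFiniteMeasure ν], Integrable φ ν := fun ν _ =>
      hφ.continuous.integrable_of_hasCompactSupport hφc
    have hLm₁ : Integrable Lm μ.pos := integrable_integral_kernel_mul hVm continuous_const hV₁ hΔ hΔc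
    have hLm₂ : Integrable Lm μ.neg := integrable_integral_kernel_mul hVm continuous_const hV₂ hΔ hΔc
    have hLm₃ : Integrable Lm μs.pos :=
      integrable_integral_kernel_mul hVm continuous_const hV₃ hΔ hΔc
    have hLm₄ : Integrable Lm μs.neg :=
      integrable_integral_kernel_mul hVm continuous_const hV₄ hΔ hΔc
    have hLp : ∀ {ν : Measure ℂ} [IsLocallyFiniteMeasure ν], Integrable Lm ν →
        Integrable Lp ν ∧ ∫ p, Lp p ∂ν = ∫ p, Lm p ∂ν + 2 * Real.pi * ∫ p, φ p ∂ν := by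
      intro ν _ h
      have h2 := (hφi ν).const_mul (2 * Real.pi)
      have h3 : Lp = fun p => Lm p + 2 * Real.pi * φ p := funext hLpm
      rw [h3]
      exact ⟨h.add h2, by rw [integral_add h h2, integral_const_mul]⟩
    obtain ⟨hLp₁, hLp₁'⟩ := hLp hLm₁
    obtain ⟨hLp₂, hLp₂'⟩ := hLp hLm₂
    obtain ⟨hLp₃, hLp₃'⟩ := hLp hLm₃
    obtain ⟨hLp₄, hLp₄'⟩ := hLp hLm₄
    have hDL : (fun w => ∫ z, D z w * χ z) = fun w => Lp w - Lp (Φ w) := funext fun w =>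
      integral_displacementKernel_mul_laplacian hφ2 hφc w
    -- The images of `μ±` are not assumed locally finite. Integrability of `Lp ∘ Φ` comes from that
    -- of `Lp` and of `Lp - Lp ∘ Φ`, the latter being the integral of the kernel against `χ`.
    have hLΦ₁ : Integrable (fun w => Lp (Φ w)) μ.pos := by
      have h := integrable_integral_kernel_mul hDm hb₁ hD₁ hΔ hΔc
      have h' : Integrable (fun w => Lp w - Lp (Φ w)) μ.pos := hDL ▸ h
      simpa using hLp₁.fun_sub h'
    have hLΦ₂ : Integrable (fun w => Lp (Φ w)) μ.neg := by
      have h := integrable_integral_kernel_mul hDm hb₂ hD₂ hΔ hΔc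
      have h' : Integrable (fun w => Lp w - Lp (Φ w)) μ.neg := hDL ▸ h
      simpa using hLp₂.fun_sub h'
    have hLpmeas : StronglyMeasurable Lp := by
      have hm : Measurable (Function.uncurry fun p z : ℂ => Real.posLog ‖z - p‖ * χ z) := by
        have : Measurable χ := hΔ.measurable
        unfold Function.uncurry
        fun_prop
      exact hm.stronglyMeasurable.integral_prod_right
    have hmap : ∀ ν : Measure ℂ, ∫ w, Lp (Φ w) ∂ν = ∫ p, Lp p ∂(ν.map Φ) := fun ν =>
      (integral_map hΦm.aemeasurable hLpmeas.aestronglyMeasurable).symm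
    have hmi : ∀ ν : Measure ℂ, Integrable (fun w => Lp (Φ w)) ν → Integrable Lp (ν.map Φ) :=
      fun ν h => (integrable_map_measure hLpmeas.aestronglyMeasurable hΦm.aemeasurable).2 h
    have himage : ∫ w, Lp (Φ w) ∂μ.pos + ∫ p, Lp p ∂μs.neg =
        ∫ w, Lp (Φ w) ∂μ.neg + ∫ p, Lp p ∂μs.pos := by
      rw [hmap, hmap, ← integral_add_measure (hmi _ hLΦ₁) hLp₄,
        ← integral_add_measure (hmi _ hLΦ₂) hLp₃, hμs]
    have hID₁ : ∫ z, (∫ w, D z w ∂μ.pos) * χ z = ∫ w, Lp w ∂μ.pos - ∫ w, Lp (Φ w) ∂μ.pos := by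
      rw [integral_integral_kernel_mul hDm hb₁ hD₁ hΔ hΔc, hDL, integral_sub hLp₁ hLΦ₁]
    have hID₂ : ∫ z, (∫ w, D z w ∂μ.neg) * χ z = ∫ w, Lp w ∂μ.neg - ∫ w, Lp (Φ w) ∂μ.neg := by
      rw [integral_integral_kernel_mul hDm hb₂ hD₂ hΔ hΔc, hDL, integral_sub hLp₂ hLΦ₂]
    have hIV₁ : ∫ z, (∫ w, N z w ∂μ.pos) * χ z = ∫ p, Lm p ∂μ.pos :=
      integral_integral_kernel_mul hVm continuous_const hV₁ hΔ hΔc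
    have hIV₂ : ∫ z, (∫ w, N z w ∂μ.neg) * χ z = ∫ p, Lm p ∂μ.neg :=
      integral_integral_kernel_mul hVm continuous_const hV₂ hΔ hΔc
    have hIV₃ : ∫ z, (∫ w, N z w ∂μs.pos) * χ z = ∫ p, Lm p ∂μs.pos :=
      integral_integral_kernel_mul hVm continuous_const hV₃ hΔ hΔc
    have hIV₄ : ∫ z, (∫ w, N z w ∂μs.neg) * χ z = ∫ p, Lm p ∂μs.neg :=
      integral_integral_kernel_mul hVm continuous_const hV₄ hΔ hΔc
    have hli : ∀ {g : ℂ → ℝ}, LocallyIntegrable g → Integrable fun z => g z * χ z := fun h => by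
      simpa using h.integrable_smul_right_of_hasCompactSupport hΔ hΔc
    have hGχ : ∫ z, G z * χ z = (∫ z, (∫ w, D z w ∂μ.pos) * χ z) -
        (∫ z, (∫ w, D z w ∂μ.neg) * χ z) - (∫ z, (∫ w, N z w ∂μ.pos) * χ z) +
        (∫ z, (∫ w, N z w ∂μ.neg) * χ z) + (∫ z, (∫ w, N z w ∂μs.pos) * χ z) -
        ∫ z, (∫ w, N z w ∂μs.neg) * χ z := by
      have e₁ := hli hlD₁
      have e₂ := hli hlD₂
      have e₃ := hli hlV₁
      have e₄ := hli hlV₂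
      have e₅ := hli hlV₃
      have e₆ := hli hlV₄
      simp only [G, sub_mul, add_mul]
      rw [integral_sub ((((e₁.fun_sub e₂).fun_sub e₃).fun_add e₄).fun_add e₅) e₆,
        integral_add (((e₁.fun_sub e₂).fun_sub e₃).fun_add e₄) e₅,
        integral_add ((e₁.fun_sub e₂).fun_sub e₃) e₄,
        integral_sub (e₁.fun_sub e₂) e₃, integral_sub e₁ e₂]
    have hpos : ∫ z, φ z ∂(μ - μs).pos = ∫ z, φ z ∂μ.pos + ∫ z, φ z ∂μs.neg :=
      integral_add_measure (hφi _) (hφi _)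
    have hneg : ∫ z, φ z ∂(μ - μs).neg = ∫ z, φ z ∂μ.neg + ∫ z, φ z ∂μs.pos :=
      integral_add_measure (hφi _) (hφi _)
    have hfin : ∫ z, G z * χ z = 2 * Real.pi *
        (∫ z, φ z ∂(μ - μs).pos - ∫ z, φ z ∂(μ - μs).neg) := by
      rw [hGχ, hID₁, hID₂, hIV₁, hIV₂, hIV₃, hIV₄, hpos, hneg]
      linarith
    calc ∫ z, (2 * Real.pi)⁻¹ * G z * Laplacian.laplacian φ z
        = (2 * Real.pi)⁻¹ * ∫ z, G z * χ z := by
          rw [← integral_const_mul]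
          simp only [χ, mul_assoc]
      _ = _ := by
          rw [hfin]
          field_simp
  · refine ⟨(2 * Real.pi)⁻¹ * (C₁ + C₂ + B₁ + B₂ + B₃ + B₄), max κ₁ κ₂, max_lt hκ₁' hκ₂',
      fun z => ?_⟩
    rw [abs_mul, abs_of_pos (inv_pos.2 h2pi), mul_assoc]
    gcongr
    have hz1 : 1 ≤ 1 + ‖z‖ := by linarith [norm_nonneg z]
    have hone : 1 ≤ (1 + ‖z‖) ^ max κ₁ κ₂ := Real.one_le_rpow hz1 (hκ₁.trans (le_max_left _ _))
    have n₁ := norm_integral_kernel_le hb₁0 hD₁ z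
    have n₂ := norm_integral_kernel_le hb₂0 hD₂ z
    have n₃ := norm_integral_kernel_le (fun _ => hB₁) hV₁ z
    have n₄ := norm_integral_kernel_le (fun _ => hB₂) hV₂ z
    have n₅ := norm_integral_kernel_le (fun _ => hB₃) hV₃ z
    have n₆ := norm_integral_kernel_le (fun _ => hB₄) hV₄ z
    have p₁ : C₁ * (1 + ‖z‖) ^ κ₁ ≤ C₁ * (1 + ‖z‖) ^ max κ₁ κ₂ := by
      gcongr
      exact le_max_left _ _
    have p₂ : C₂ * (1 + ‖z‖) ^ κ₂ ≤ C₂ * (1 + ‖z‖) ^ max κ₁ κ₂ := by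
      gcongr
      exact le_max_right _ _
    have p₃ : ∀ B : ℝ, 0 ≤ B → B ≤ B * (1 + ‖z‖) ^ max κ₁ κ₂ := fun B hB =>
      le_mul_of_one_le_right hB hone
    have q₁ := p₃ B₁ hB₁
    have q₂ := p₃ B₂ hB₂
    have q₃ := p₃ B₃ hB₃
    have q₄ := p₃ B₄ hB₄
    rw [Real.norm_eq_abs, abs_le] at n₁ n₂ n₃ n₄ n₅ n₆
    rw [abs_le]
    simp only [add_mul]
    constructor <;> simp only [G, D, N] <;>
      linarith [n₁.1, n₁.2, n₂.1, n₂.2, n₃.1, n₃.2, n₄.1, n₄.2, n₅.1, n₅.2, n₆.1, n₆.2]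

/-- Growth of order below two is eventually absorbed by any positive share `ε` of the quadratic
lower bound. -/
theorem exists_rpow_growth_le_sq (C κ : ℝ) (hκ : κ < 2) {ε : ℝ} (hε : 0 < ε) :
    ∃ R : ℝ, ∀ t, R ≤ t → C * (1 + t) ^ κ ≤ ε * t ^ 2 := by
  have hlim : Tendsto (fun t : ℝ => C * t ^ (-(2 - κ))) atTop (𝓝 (C * 0)) :=
    (tendsto_rpow_neg_atTop (by linarith)).const_mul C
  rw [mul_zero] at hlim
  obtain ⟨R, hR⟩ := eventually_atTop.1 (hlim.eventually (ge_mem_nhds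
    (show (0 : ℝ) < ε / 4 by positivity)))
  refine ⟨max R 1, fun t ht => ?_⟩
  have ht1 : 1 ≤ t := (le_max_right _ _).trans ht
  have h1 := hR (1 + t) (by linarith [(le_max_left R 1).trans ht])
  have h2 : (1 + t) ^ κ = (1 + t) ^ (-(2 - κ)) * (1 + t) ^ 2 := by
    rw [← Real.rpow_natCast, ← Real.rpow_add (by linarith)]
    congr 1
    push_cast
    ring
  have h3 : (1 + t) ^ 2 ≤ 4 * t ^ 2 := by nlinarith
  rw [h2, ← mul_assoc]
  nlinarith [mul_le_mul_of_nonneg_right h1 (sq_nonneg (1 + t))]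

theorem SignedRadon.IsPotential.add_sub {μ₀ μ μs : SignedRadon} {Ψ₀ U : ℂ → ℝ}
    (hΨ₀ : μ₀.IsPotential Ψ₀) (hU : (μ - μs).IsPotential U) :
    (μ₀ + μ - μs).IsPotential (fun z => Ψ₀ z + U z) := by
  refine ⟨hΨ₀.1.add hU.1, fun φ hφ hφc => ?_⟩
  have := μ₀.pos_locallyFinite
  have := μ₀.neg_locallyFinite
  have := μ.pos_locallyFinite
  have := μ.neg_locallyFinite
  have := μs.pos_locallyFinite
  have := μs.neg_locallyFinite
  have hφi : ∀ (ν : Measure ℂ) [IsLocallyFiniteMeasure ν], Integrable φ ν := fun ν _ =>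
    hφ.continuous.integrable_of_hasCompactSupport hφc
  have hφ2 : ContDiff ℝ 2 φ := contDiff_infty.1 hφ 2
  have hli : ∀ {g : ℂ → ℝ}, LocallyIntegrable g →
      Integrable fun z => g z * Laplacian.laplacian φ z := fun h => by
    simpa using h.integrable_smul_right_of_hasCompactSupport (continuous_laplacian hφ2)
      (hasCompactSupport_laplacian hφc)
  have h1 := hΨ₀.2 φ hφ hφc
  have h2 := hU.2 φ hφ hφc
  have e1 : ∫ z, φ z ∂(μ - μs).pos = ∫ z, φ z ∂μ.pos + ∫ z, φ z ∂μs.neg :=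
    integral_add_measure (hφi _) (hφi _)
  have e2 : ∫ z, φ z ∂(μ - μs).neg = ∫ z, φ z ∂μ.neg + ∫ z, φ z ∂μs.pos :=
    integral_add_measure (hφi _) (hφi _)
  have e3 : ∫ z, φ z ∂(μ₀ + μ - μs).pos =
      ∫ z, φ z ∂μ₀.pos + ∫ z, φ z ∂μ.pos + ∫ z, φ z ∂μs.neg := by
    rw [← integral_add_measure (hφi _) (hφi _)]
    exact integral_add_measure ((hφi _).add_measure (hφi _)) (hφi _)
  have e4 : ∫ z, φ z ∂(μ₀ + μ - μs).neg =
      ∫ z, φ z ∂μ₀.neg + ∫ z, φ z ∂μ.neg + ∫ z, φ z ∂μs.pos := by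
    rw [← integral_add_measure (hφi _) (hφi _)]
    exact integral_add_measure ((hφi _).add_measure (hφi _)) (hφi _)
  simp only [add_mul]
  rw [integral_add (hli hΨ₀.1) (hli hU.1), h1, h2, e1, e2, e3, e4]
  ring

/-- The potential bounded below by a quadratic function survives the displacement. -/
theorem exists_potential_quadraticLowerBound {μ₀ μ μs : SignedRadon} {L : Set ℂ} {α : ℂ → ℝ}
    {near : ℂ → ℂ} {γ γ' : ℝ} (hγ : γ' < γ) {Ψ₀ : ℂ → ℝ} (hΨ₀ : μ₀.IsPotential Ψ₀)
    (hlower : QuadraticLowerBound L α near γ Ψ₀) (hμpos : UniformLogBound μ.pos)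
    (hμneg : UniformLogBound μ.neg) {Φ : ℂ → ℂ} (hΦm : Measurable Φ)
    (hΦ : SublinearDisplacement Φ) (hμs : SignedRadon.IsImage Φ μ μs)
    (hμspos : UniformLogBound μs.pos) (hμsneg : UniformLogBound μs.neg) :
    ∃ Ψs : ℂ → ℝ, (μ₀ + μ - μs).IsPotential Ψs ∧ QuadraticLowerBound L α near γ' Ψs := by
  obtain ⟨U, hU, C, κ, hκ, hUb⟩ :=
    exists_potential_sub_image hμpos hμneg hΦm hΦ hμs hμspos hμsneg
  obtain ⟨R, hR⟩ := hlower
  obtain ⟨R₂, hR₂⟩ := exists_rpow_growth_le_sq C κ hκ (sub_pos.2 hγ)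
  refine ⟨fun z => Ψ₀ z + U z, hΨ₀.add_sub hU, max R R₂, fun z hz hzR => ?_⟩
  have h1 := hR z hz ((le_max_left _ _).trans hzR)
  have h2 := hR₂ ‖z‖ ((le_max_right _ _).trans hzR)
  have h3 := (abs_le.1 (hUb z)).1
  linarith

/-! ### Logarithmic potentials and local integrability of `exp (-2 Ψ)` -/

/-- The logarithmic potential of a measure. -/
noncomputable def logPotential (ν : Measure ℂ) (z : ℂ) : ℝ :=
  ∫ w, Real.log ‖z - w‖ ∂ν

section LogPotential

variable {ν : Measure ℂ} [IsFiniteMeasure ν] {p : ℂ}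

theorem integrable_log_norm_sub_prod (hν : ν (ball p 1)ᶜ = 0) (R : ℝ) :
    Integrable (Function.uncurry fun z w => Real.log ‖z - w‖)
      ((volume.restrict (ball p R)).prod ν) := by
  have hm : Measurable (Function.uncurry fun z w : ℂ => Real.log ‖z - w‖) := by
    unfold Function.uncurry
    fun_prop
  refine ⟨hm.aestronglyMeasurable, ?_⟩
  rw [hasFiniteIntegral_iff_enorm, lintegral_prod_symm _ hm.enorm.aemeasurable]
  obtain ⟨K, hK⟩ := exists_lintegral_norm_sub_rpow_le (s := 1) zero_le_one one_lt_two R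
  have hae : ∀ᵐ w ∂ν, ∫⁻ z in ball p R, ‖Function.uncurry (fun z w => Real.log ‖z - w‖) (z, w)‖ₑ ≤
      ENNReal.ofReal K + ENNReal.ofReal (R + 1) * volume (ball p R) := by
    have : ∀ᵐ w ∂ν, w ∈ ball p 1 := by
      rw [ae_iff]
      exact hν
    filter_upwards [this] with w hw
    calc ∫⁻ z in ball p R, ‖Function.uncurry (fun z w => Real.log ‖z - w‖) (z, w)‖ₑ
        ≤ ∫⁻ z in ball p R, (ENNReal.ofReal (‖z - w‖ ^ (-1 : ℝ)) + ENNReal.ofReal (R + 1)) := by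
          refine setLIntegral_mono (by fun_prop) fun z hz => ?_
          have h1 : ‖z - w‖ ≤ R + 1 := by
            rw [← dist_eq_norm]
            rw [mem_ball] at hz hw
            linarith [dist_triangle_right z w p]
          rw [← ENNReal.ofReal_add (by positivity) ((norm_nonneg _).trans h1),
            Real.enorm_eq_ofReal_abs]
          refine ENNReal.ofReal_le_ofReal ((abs_log_le_inv_add_self (norm_nonneg _)).trans ?_)
          gcongr
      _ ≤ _ := by
          rw [lintegral_add_right _ measurable_const, setLIntegral_const]
          gcongr
          exact hK p w
  refine (lintegral_mono_ae hae).trans_lt ?_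
  rw [lintegral_const]
  exact ENNReal.mul_lt_top (ENNReal.add_lt_top.2 ⟨ENNReal.ofReal_lt_top,
    ENNReal.mul_lt_top ENNReal.ofReal_lt_top measure_ball_lt_top⟩) (measure_lt_top _ _)

theorem locallyIntegrable_logPotential (hν : ν (ball p 1)ᶜ = 0) :
    LocallyIntegrable (logPotential ν) := by
  rw [locallyIntegrable_iff]
  intro k hk
  obtain ⟨R, hR⟩ := hk.isBounded.subset_ball p
  exact IntegrableOn.mono_set (integrable_log_norm_sub_prod hν R).integral_prod_left hR

theorem ae_integrable_log_norm_sub (hν : ν (ball p 1)ᶜ = 0) :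
    ∀ᵐ z, Integrable (fun w => Real.log ‖z - w‖) ν := by
  have h : ∀ n : ℕ, ∀ᵐ z, z ∈ ball p (n : ℝ) → Integrable (fun w => Real.log ‖z - w‖) ν :=
    fun n => (ae_restrict_iff' measurableSet_ball).1
      (integrable_log_norm_sub_prod hν n).prod_right_ae
  filter_upwards [ae_all_iff.2 h] with z hz
  obtain ⟨n, hn⟩ := exists_nat_gt (dist z p)
  exact hz n hn

theorem integral_logPotential_mul_laplacian (hν : ν (ball p 1)ᶜ = 0) {φ : ℂ → ℝ}
    (hφ : ContDiff ℝ 2 φ) (hφc : HasCompactSupport φ) :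
    ∫ z, logPotential ν z * Laplacian.laplacian φ z = 2 * Real.pi * ∫ w, φ w ∂ν := by
  have hΔ := continuous_laplacian hφ
  have hΔc := hasCompactSupport_laplacian hφc
  obtain ⟨R, hR⟩ := hΔc.isCompact.isBounded.subset_ball p
  obtain ⟨c, hc⟩ := hΔ.bounded_above_of_compact_support hΔc
  have hzero : ∀ z, z ∉ ball p R → Laplacian.laplacian φ z = 0 := fun z hz =>
    image_eq_zero_of_notMem_tsupport fun h => hz (hR h)
  have hint : Integrable (Function.uncurry fun z w => Real.log ‖z - w‖ * Laplacian.laplacian φ z)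
      ((volume.restrict (ball p R)).prod ν) :=
    (integrable_log_norm_sub_prod hν R).mul_bdd (hΔ.comp continuous_fst).aestronglyMeasurable
      (ae_of_all _ fun q => hc q.1)
  have hset : ∀ g : ℂ → ℝ, ∫ z, g z * Laplacian.laplacian φ z =
      ∫ z in ball p R, g z * Laplacian.laplacian φ z := fun g =>
    (setIntegral_eq_integral_of_forall_compl_eq_zero fun z hz => by rw [hzero z hz, mul_zero]).symm
  rw [hset, ← integral_const_mul]
  simp only [logPotential, ← integral_mul_const]
  rw [integral_integral_swap hint]
  congr 1
  ext w
  rw [← hset fun z => Real.log ‖z - w‖, integral_log_norm_sub_mul_laplacian hφ hφc]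

/-- Jensen's inequality for the exponential of a logarithmic potential. -/
theorem ofReal_exp_neg_logPotential_le {z : ℂ} {t : ℝ} (ht : t = ν.real univ / Real.pi)
    (hi : Integrable (fun w => Real.log ‖z - w‖) ν) :
    ENNReal.ofReal (Real.exp (-(logPotential ν z / Real.pi))) ≤
      1 + (ν univ)⁻¹ * ∫⁻ w, ENNReal.ofReal (Real.exp (-(t * Real.log ‖z - w‖))) ∂ν := by
  -- The summand `1` on the right serves only the zero measure, for which there is no average.
  rcases eq_zero_or_neZero ν with h0 | h0
  · simp [logPotential, h0]
  refine le_trans ?_ le_add_self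
  have hm0 : ν univ ≠ 0 := by simpa using h0.ne
  have hmt : ν univ ≠ ⊤ := measure_ne_top _ _
  have hmr : 0 < ν.real univ := ENNReal.toReal_pos hm0 hmt
  have hmeas : Measurable fun w => Real.exp (-(t * Real.log ‖z - w‖)) := by fun_prop
  by_cases htop : ∫⁻ w, ENNReal.ofReal (Real.exp (-(t * Real.log ‖z - w‖))) ∂ν = ⊤
  · rw [htop, ENNReal.mul_top (ENNReal.inv_ne_zero.2 hmt)]
    exact le_top
  have hgi : Integrable (fun w => Real.exp (-(t * Real.log ‖z - w‖))) ν := by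
    refine ⟨hmeas.aestronglyMeasurable, ?_⟩
    rw [hasFiniteIntegral_iff_ofReal (ae_of_all _ fun w => (Real.exp_pos _).le)]
    exact lt_top_iff_ne_top.2 htop
  have hJ := convexOn_exp.map_average_le Real.continuous_exp.continuousOn isClosed_univ
    (ae_of_all ν fun w => mem_univ (-(t * Real.log ‖z - w‖))) (hi.const_mul t).neg hgi
  rw [average_eq, average_eq, integral_neg, integral_const_mul] at hJ
  have he : (ν.real univ)⁻¹ • -(t * ∫ w, Real.log ‖z - w‖ ∂ν) =
      -(logPotential ν z / Real.pi) := by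
    rw [ht, logPotential, smul_eq_mul]
    field_simp
  rw [he, smul_eq_mul] at hJ
  refine (ENNReal.ofReal_le_ofReal hJ).trans (le_of_eq ?_)
  rw [ENNReal.ofReal_mul (by positivity), ENNReal.ofReal_inv_of_pos hmr, measureReal_def,
    ENNReal.ofReal_toReal hmt,
    ofReal_integral_eq_lintegral_ofReal hgi (ae_of_all _ fun w => (Real.exp_pos _).le)]

end LogPotential

/-- Disks centred at `p + t`, `t → 0`, see an atom at `p` with weight `|log t|`, which is unbounded.
-/
theorem UniformLogBound.measure_singleton {ν : Measure ℂ} (h : UniformLogBound ν) (p : ℂ) :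
    ν {p} = 0 := by
  obtain ⟨A, R, hR, hA⟩ := h
  by_contra h0
  have key : ∀ t : ℝ, 0 < t → t < R →
      ENNReal.ofReal |Real.log t| * ν {p} ≤ ENNReal.ofReal A := by
    intro t ht htR
    have hn : ‖p + (t : ℂ) - p‖ = t := by
      rw [add_sub_cancel_left, Complex.norm_real, Real.norm_of_nonneg ht.le]
    have hsub : ({p} : Set ℂ) ⊆ ball (p + (t : ℂ)) R := by
      rw [singleton_subset_iff, mem_ball', dist_eq_norm, hn]
      exact htR
    refine le_trans ?_ (hA (p + (t : ℂ)))
    refine le_trans (le_of_eq ?_) (lintegral_mono_set hsub)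
    rw [lintegral_singleton, hn]
  have hlim : Tendsto (fun t : ℝ => ENNReal.ofReal |Real.log t| * ν {p}) (𝓝[>] 0) (𝓝 ⊤) := by
    have h1 : Tendsto (fun t : ℝ => ENNReal.ofReal |Real.log t|) (𝓝[>] 0) (𝓝 ⊤) :=
      ENNReal.tendsto_ofReal_atTop.comp (tendsto_abs_atBot_atTop.comp Real.tendsto_log_nhdsGT_zero)
    have h2 := ENNReal.Tendsto.mul_const (b := ν {p}) h1 (Or.inl ENNReal.top_ne_zero)
    rwa [ENNReal.top_mul h0] at h2
  have hle : (⊤ : ENNReal) ≤ ENNReal.ofReal A := by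
    refine le_of_tendsto hlim ?_
    filter_upwards [Ioo_mem_nhdsGT hR] with t ht
    exact key t ht.1 ht.2
  exact absurd hle (not_le.2 ENNReal.ofReal_lt_top)

theorem exists_measure_punctured_ball_lt (ν : Measure ℂ) [IsLocallyFiniteMeasure ν] (p : ℂ)
    {ε : ENNReal} (hε : 0 < ε) :
    ∃ r₀ > 0, ∀ r ≤ r₀, ν (ball p r \ {p}) < ε := by
  obtain ⟨ρ, hρ, hfin⟩ : ∃ ρ > 0, ν (ball p ρ) < ⊤ := by
    obtain ⟨s, hs, hs'⟩ := ν.finiteAt_nhds p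
    obtain ⟨ρ, hρ, hsub⟩ := Metric.mem_nhds_iff.1 hs
    exact ⟨ρ, hρ, (measure_mono hsub).trans_lt hs'⟩
  let S : ℕ → Set ℂ := fun n => ball p (ρ / (n + 1)) \ {p}
  have hlim := tendsto_measure_iInter_atTop (μ := ν) (s := S)
    (fun n => (measurableSet_ball.diff (measurableSet_singleton p)).nullMeasurableSet)
    (fun n m hnm => by
      simp only [S]
      gcongr)
    ⟨0, ((measure_mono (fun z hz => by simpa using hz.1)).trans_lt hfin).ne⟩
  have hempty : ⋂ n, S n = ∅ := by
    rw [eq_empty_iff_forall_notMem]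
    intro z hz
    rw [mem_iInter] at hz
    have hzp : 0 < dist z p := dist_pos.2 (hz 0).2
    obtain ⟨n, hn⟩ := ((tendsto_const_div_atTop_nhds_zero_nat ρ).comp
      (tendsto_add_atTop_nat 1)).eventually (gt_mem_nhds hzp) |>.exists
    have h1 := (hz n).1
    simp only [Function.comp, Nat.cast_add, Nat.cast_one] at hn
    rw [mem_ball] at h1
    linarith
  rw [hempty, measure_empty] at hlim
  obtain ⟨n, hn⟩ := (hlim.eventually (gt_mem_nhds hε)).exists
  refine ⟨ρ / (n + 1), by positivity, fun r hr => ?_⟩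
  refine (measure_mono ?_).trans_lt hn
  exact sdiff_subset_sdiff_left (ball_subset_ball hr)

/-- The product of two powers is at most the larger of the two singularities raised to the total
exponent. Thus an atom and a nearby point of the measure are integrable together as soon as `s + t <
2`. -/
theorem exp_mul_exp_le_add {s t : ℝ} (hs : 0 ≤ s) (ht : 0 ≤ t) (x y : ℝ) :
    Real.exp (-(s * x)) * Real.exp (-(t * y)) ≤
      Real.exp (-((s + t) * x)) + Real.exp (-((s + t) * y)) := by
  rw [← Real.exp_add]
  rcases le_total x y with h | h
  · refine le_trans (Real.exp_le_exp.2 ?_) (le_add_of_nonneg_right (Real.exp_pos _).le)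
    nlinarith
  · refine le_trans (Real.exp_le_exp.2 ?_) (le_add_of_nonneg_left (Real.exp_pos _).le)
    nlinarith

theorem exists_lintegral_exp_log_le {s : ℝ} (hs0 : 0 ≤ s) (hs : s < 2) (ρ : ℝ) :
    ∃ K : ℝ, ∀ c w : ℂ, ∫⁻ z in ball c ρ, ENNReal.ofReal (Real.exp (-(s * Real.log ‖z - w‖))) ≤
      ENNReal.ofReal K := by
  obtain ⟨K, hK⟩ := exists_lintegral_norm_sub_rpow_le hs0 hs ρ
  refine ⟨K, fun c w => le_trans (le_of_eq (lintegral_congr_ae ?_)) (hK c w)⟩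
  refine ae_restrict_of_ae ?_
  filter_upwards [Measure.ae_ne volume w] with z hz
  rw [Real.rpow_def_of_pos (norm_pos_iff.2 (sub_ne_zero.2 hz))]
  congr 2
  ring

/-- The singular factor coming from an atom and from a measure of small mass is integrable. -/
theorem lintegral_exp_log_mul_lt_top {ν : Measure ℂ} [IsFiniteMeasure ν] {p : ℂ} {s t ρ : ℝ}
    (hs : 0 ≤ s) (ht : 0 ≤ t) (hst : s + t < 2) :
    ∫⁻ z in ball p ρ, ENNReal.ofReal (Real.exp (-(s * Real.log ‖z - p‖))) *
      (1 + (ν univ)⁻¹ * ∫⁻ w, ENNReal.ofReal (Real.exp (-(t * Real.log ‖z - w‖))) ∂ν) < ⊤ := by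
  obtain ⟨K₀, hK₀⟩ := exists_lintegral_exp_log_le hs (by linarith) ρ
  obtain ⟨K, hK⟩ := exists_lintegral_exp_log_le (add_nonneg hs ht) hst ρ
  let X : ℂ → ENNReal := fun z => ENNReal.ofReal (Real.exp (-(s * Real.log ‖z - p‖)))
  let Y : ℂ → ℂ → ENNReal := fun z w => ENNReal.ofReal (Real.exp (-(t * Real.log ‖z - w‖)))
  have hX : Measurable X := by fun_prop
  have hY : Measurable (Function.uncurry Y) := by
    unfold Function.uncurry
    fun_prop
  have hYz : ∀ z, Measurable (Y z) := fun z => by fun_prop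
  have hXY : Measurable (Function.uncurry fun z w => X z * Y z w) :=
    (hX.comp measurable_fst).mul hY
  calc ∫⁻ z in ball p ρ, X z * (1 + (ν univ)⁻¹ * ∫⁻ w, Y z w ∂ν)
      = ∫⁻ z in ball p ρ, (X z + (ν univ)⁻¹ * ∫⁻ w, X z * Y z w ∂ν) := by
        refine lintegral_congr fun z => ?_
        rw [lintegral_const_mul _ (hYz z)]
        ring
    _ = (∫⁻ z in ball p ρ, X z) +
        (ν univ)⁻¹ * ∫⁻ z in ball p ρ, ∫⁻ w, X z * Y z w ∂ν := by
        rw [lintegral_add_left hX, lintegral_const_mul _ hXY.lintegral_prod_right]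
    _ = (∫⁻ z in ball p ρ, X z) +
        (ν univ)⁻¹ * ∫⁻ w, (∫⁻ z in ball p ρ, X z * Y z w) ∂ν := by
        rw [lintegral_lintegral_swap hXY.aemeasurable]
    _ ≤ ENNReal.ofReal K₀ + (ν univ)⁻¹ *
          ∫⁻ _, (ENNReal.ofReal K + ENNReal.ofReal K) ∂ν := by
        gcongr with w
        · exact hK₀ p p
        · calc ∫⁻ z in ball p ρ, X z * Y z w
              ≤ ∫⁻ z in ball p ρ, (ENNReal.ofReal (Real.exp (-((s + t) * Real.log ‖z - p‖))) +
                  ENNReal.ofReal (Real.exp (-((s + t) * Real.log ‖z - w‖)))) := by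
                refine lintegral_mono fun z => ?_
                simp only [X, Y]
                rw [← ENNReal.ofReal_mul (Real.exp_pos _).le,
                  ← ENNReal.ofReal_add (Real.exp_pos _).le (Real.exp_pos _).le]
                exact ENNReal.ofReal_le_ofReal (exp_mul_exp_le_add hs ht _ _)
            _ ≤ _ := by
                rw [lintegral_add_left (by fun_prop)]
                gcongr
                · exact hK p p
                · exact hK p w
    _ < ⊤ := by
        rw [lintegral_const, mul_comm (ENNReal.ofReal K + ENNReal.ofReal K), ← mul_assoc]
        refine ENNReal.add_lt_top.2 ⟨ENNReal.ofReal_lt_top, ENNReal.mul_lt_top ?_ ?_⟩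
        · exact (ENNReal.inv_mul_le_one _).trans_lt ENNReal.one_lt_top
        · exact ENNReal.add_lt_top.2 ⟨ENNReal.ofReal_lt_top, ENNReal.ofReal_lt_top⟩

theorem integral_eq_atom_add_setIntegral {ν : Measure ℂ} {φ : ℂ → ℝ} (hφ : Integrable φ ν)
    {B : Set ℂ} {p : ℂ} (hsupp : tsupport φ ⊆ B) :
    ∫ z, φ z ∂ν = ν.real {p} * φ p + ∫ z in B \ {p}, φ z ∂ν := by
  rw [← integral_add_compl (measurableSet_singleton p) hφ, integral_singleton, smul_eq_mul]
  congr 1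
  refine setIntegral_eq_of_subset_of_forall_sdiff_eq_zero (measurableSet_singleton p).compl
    (fun z hz => hz.2) fun z hz => ?_
  exact image_eq_zero_of_notMem_tsupport fun h => hz.2 ⟨hsupp h, hz.1⟩

/-- If all atoms of a field have intensity less than one, then `exp (-2 Ψ)` is locally
integrable for each potential `Ψ`. -/
theorem SignedRadon.IsPotential.locallyIntegrable_exp {σ : SignedRadon} {Ψ : ℂ → ℝ}
    (hΨ : σ.IsPotential Ψ) (hatom : ∀ z, σ.atom z < 2 * Real.pi) :
    LocallyIntegrable fun z => Real.exp (-2 * Ψ z) := by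
  have := σ.pos_locallyFinite
  have := σ.neg_locallyFinite
  intro p
  have hpi := Real.pi_pos
  obtain ⟨a, ha⟩ : ∃ a, a = σ.atom p := ⟨_, rfl⟩
  have ha2 : a < 2 * Real.pi := ha ▸ hatom p
  -- An atom of mass `a` gives `e^{-2Ψ}` the singularity `|z - p|^{-a/π}`, with `a / π < 2`.
  -- Negative atoms only help. The mass of the positive part near `p` is then made less than `π (2 -
  -- s)`, so that Jensen's exponent `t` satisfies `s + t < 2`.
  obtain ⟨s, hs⟩ : ∃ s, s = max (a / Real.pi) 0 := ⟨_, rfl⟩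
  have hs0 : 0 ≤ s := hs ▸ le_max_right _ _
  have hs2 : s < 2 := by
    rw [hs]
    exact max_lt (by rwa [div_lt_iff₀ hpi]) two_pos
  have hsa : a / Real.pi ≤ s := hs ▸ le_max_left _ _
  obtain ⟨r₁, hr₁, hpos₁⟩ := exists_measure_punctured_ball_lt σ.pos p
    (ε := ENNReal.ofReal (Real.pi * (2 - s))) (ENNReal.ofReal_pos.2 (by
      have : 0 < 2 - s := by linarith
      positivity))
  obtain ⟨r₂, hr₂, hneg₂⟩ := exists_measure_punctured_ball_lt σ.neg p ENNReal.zero_lt_top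
  -- The bound `1/2` keeps all distances involved below one, so all logarithms are nonpositive; the
  -- negative part of the field then only raises `Ψ`.
  obtain ⟨r, hr⟩ : ∃ r, r = min (min r₁ r₂) (1 / 2) := ⟨_, rfl⟩
  have hr0 : 0 < r := by
    rw [hr]
    exact lt_min (lt_min hr₁ hr₂) (by norm_num)
  have hr12 : r ≤ 1 / 2 := hr ▸ min_le_right _ _
  have hposr := hpos₁ r (hr ▸ (min_le_left _ _).trans (min_le_left _ _))
  have hnegr := hneg₂ r (hr ▸ (min_le_left _ _).trans (min_le_right _ _))
  have hBm : MeasurableSet (ball p r \ {p}) := measurableSet_ball.diff (measurableSet_singleton p)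
  let P := σ.pos.restrict (ball p r \ {p})
  let Q := σ.neg.restrict (ball p r \ {p})
  have : IsFiniteMeasure P := ⟨by
    rw [Measure.restrict_apply_univ]
    exact hposr.trans ENNReal.ofReal_lt_top⟩
  have : IsFiniteMeasure Q := ⟨by
    rw [Measure.restrict_apply_univ]
    exact hnegr⟩
  have hcompl : ∀ ν : Measure ℂ, ν.restrict (ball p r \ {p}) (ball p 1)ᶜ = 0 := by
    intro ν
    rw [Measure.restrict_apply measurableSet_ball.compl]
    convert measure_empty (μ := ν)
    rw [eq_empty_iff_forall_notMem]
    rintro z ⟨hz, hz', -⟩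
    exact hz (ball_subset_ball (by linarith) hz')
  have hP := hcompl σ.pos
  have hQ := hcompl σ.neg
  obtain ⟨t, ht⟩ : ∃ t, t = P.real univ / Real.pi := ⟨_, rfl⟩
  have ht0 : 0 ≤ t := by
    rw [ht]
    positivity
  have hst : s + t < 2 := by
    have h1 : P.real univ < Real.pi * (2 - s) := by
      rw [measureReal_def, Measure.restrict_apply_univ]
      exact ENNReal.toReal_lt_of_lt_ofReal hposr
    have h2 : t < 2 - s := by
      rw [ht, div_lt_iff₀ hpi]
      linarith
    linarith
  let N : ℂ → ℝ := fun z => (2 * Real.pi)⁻¹ *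
    (a * Real.log ‖z - p‖ + logPotential P z - logPotential Q z)
  have hlog := locallyIntegrable_log_norm_sub p
  have hLP := locallyIntegrable_logPotential hP
  have hLQ := locallyIntegrable_logPotential hQ
  have hN : LocallyIntegrable N := (((hlog.smul a).add hLP).sub hLQ).smul (2 * Real.pi)⁻¹
  have hH : LocallyIntegrable fun z => Ψ z - N z := hΨ.1.sub hN
  -- Riesz decomposition: `N` is the potential of the part of the field in the ball, so the rest of
  -- `Ψ` is harmonic there.
  have hw : WeaklyHarmonicOn (ball p r) fun z => Ψ z - N z := by
    intro φ hφ hφc hsupp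
    have hφ2 : ContDiff ℝ 2 φ := contDiff_infty.1 hφ 2
    have hli : ∀ {g : ℂ → ℝ}, LocallyIntegrable g →
        Integrable fun z => g z * Laplacian.laplacian φ z := fun h => by
      simpa using h.integrable_smul_right_of_hasCompactSupport (continuous_laplacian hφ2)
        (hasCompactSupport_laplacian hφc)
    have hφi : ∀ (ν : Measure ℂ) [IsLocallyFiniteMeasure ν], Integrable φ ν := fun ν _ =>
      hφ.continuous.integrable_of_hasCompactSupport hφc
    have hNφ : ∫ z, N z * Laplacian.laplacian φ z = ∫ z, φ z ∂σ.pos - ∫ z, φ z ∂σ.neg := by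
      have e₁ := hli hlog
      have e₂ := hli hLP
      have e₃ := hli hLQ
      have h1 : ∫ z, N z * Laplacian.laplacian φ z = (2 * Real.pi)⁻¹ *
          (a * (∫ z, Real.log ‖z - p‖ * Laplacian.laplacian φ z) +
            (∫ z, logPotential P z * Laplacian.laplacian φ z) -
            ∫ z, logPotential Q z * Laplacian.laplacian φ z) := by
        rw [← integral_const_mul, ← integral_add (e₁.const_mul a) e₂,
          ← integral_sub ((e₁.const_mul a).fun_add e₂) e₃, ← integral_const_mul]
        congr 1
        ext z
        simp only [N]
        ring
      rw [h1, integral_log_norm_sub_mul_laplacian hφ2 hφc,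
        integral_logPotential_mul_laplacian hP hφ2 hφc,
        integral_logPotential_mul_laplacian hQ hφ2 hφc,
        integral_eq_atom_add_setIntegral (hφi σ.pos) (p := p) hsupp,
        integral_eq_atom_add_setIntegral (hφi σ.neg) (p := p) hsupp, ha,
        SignedRadon.atom]
      simp only [measureReal_def]
      field_simp
      ring
    simp only [sub_mul]
    rw [integral_sub (hli hΨ.1) (hli hN), hΨ.2 φ hφ hφc, hNφ, sub_self]
  -- With `δ = r / 6` the ball of radius `3δ = r / 2` about any point of `ball p (r / 2)` stays
  -- inside `ball p r`.
  obtain ⟨h, hc, -, hae⟩ := hw.exists_ae_eq_harmonic hH (show 0 < r / 6 by positivity)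
  obtain ⟨c, hcb⟩ := (isCompact_closedBall p r).exists_bound_of_continuousOn hc.continuousOn
  refine ⟨ball p (r / 2), ball_mem_nhds p (by positivity), ?_⟩
  have hmeas : AEStronglyMeasurable (fun z => Real.exp (-2 * Ψ z)) volume :=
    Real.continuous_exp.comp_aestronglyMeasurable (hΨ.1.aestronglyMeasurable.const_mul (-2))
  refine ⟨hmeas.restrict, ?_⟩
  rw [hasFiniteIntegral_iff_ofReal (ae_of_all _ fun z => (Real.exp_pos _).le)]
  have hpt : ∀ᵐ z ∂volume.restrict (ball p (r / 2)), ENNReal.ofReal (Real.exp (-2 * Ψ z)) ≤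
      ENNReal.ofReal (Real.exp (2 * c)) *
        (ENNReal.ofReal (Real.exp (-(s * Real.log ‖z - p‖))) * (1 + (P univ)⁻¹ *
          ∫⁻ w, ENNReal.ofReal (Real.exp (-(t * Real.log ‖z - w‖))) ∂P)) := by
    rw [ae_restrict_iff' measurableSet_ball]
    filter_upwards [hae, ae_integrable_log_norm_sub hP] with z hz hzP hzB
    have hzr : dist z p < r / 2 := hzB
    have h1 : Ψ z - N z = h z := hz (ball_subset_ball' (by linarith))
    have h2 : -c ≤ h z := (abs_le.1 (hcb z (ball_subset_closedBall
      (ball_subset_ball (by linarith) hzB)))).1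
    have h3 : logPotential Q z ≤ 0 := by
      refine integral_nonpos_of_ae ?_
      refine (ae_restrict_iff' hBm).2 (ae_of_all _ fun w hw => ?_)
      have hwr : dist w p < r := hw.1
      refine Real.log_nonpos (norm_nonneg _) ?_
      rw [← dist_eq_norm]
      linarith [dist_triangle_right z w p]
    have h4 : Real.log ‖z - p‖ ≤ 0 := by
      refine Real.log_nonpos (norm_nonneg _) ?_
      rw [← dist_eq_norm]
      linarith
    have h5 : -2 * Ψ z ≤ 2 * c + (-(s * Real.log ‖z - p‖) + -(logPotential P z / Real.pi)) := by
      have e2 : 2 * N z = a / Real.pi * Real.log ‖z - p‖ + logPotential P z / Real.pi -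
          logPotential Q z / Real.pi := by
        simp only [N]
        field_simp
      have e3 : logPotential Q z / Real.pi ≤ 0 := div_nonpos_of_nonpos_of_nonneg h3 hpi.le
      have e4 : s * Real.log ‖z - p‖ ≤ a / Real.pi * Real.log ‖z - p‖ :=
        mul_le_mul_of_nonpos_right hsa h4
      linarith
    calc ENNReal.ofReal (Real.exp (-2 * Ψ z))
        ≤ ENNReal.ofReal (Real.exp (2 * c) * (Real.exp (-(s * Real.log ‖z - p‖)) *
            Real.exp (-(logPotential P z / Real.pi)))) := by
          rw [← Real.exp_add, ← Real.exp_add]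
          exact ENNReal.ofReal_le_ofReal (Real.exp_le_exp.2 h5)
      _ ≤ _ := by
          rw [ENNReal.ofReal_mul (Real.exp_pos _).le, ENNReal.ofReal_mul (Real.exp_pos _).le]
          gcongr
          exact ofReal_exp_neg_logPotential_le ht hzP
  refine (lintegral_mono_ae hpt).trans_lt ?_
  rw [lintegral_const_mul' _ _ ENNReal.ofReal_ne_top]
  exact ENNReal.mul_lt_top ENNReal.ofReal_lt_top (lintegral_exp_log_mul_lt_top hs0 ht0 hst)

/-! ### Global integrability of weighted powers -/

theorem UniformlyDiscrete.countable {L : Set ℂ} (hL : UniformlyDiscrete L) : L.Countable := by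
  obtain ⟨r, hr, hsep⟩ := hL
  refine PairwiseDisjoint.countable_of_isOpen (s := fun l => ball l (r / 2)) (fun l hl m hm hlm => ?_)
    (fun l _ => isOpen_ball) (fun l _ => ⟨l, mem_ball_self (by positivity)⟩)
  exact ball_disjoint_ball (by linarith [hsep l hl m hm hlm.symm])

theorem IsNearestPoint.infDist_eq {L : Set ℂ} {near : ℂ → ℂ} (h : IsNearestPoint L near)
    (hL : L.Nonempty) (z : ℂ) : infDist z L = ‖z - near z‖ := by
  obtain ⟨h1, h2⟩ := h hL z
  rw [← dist_eq_norm]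
  exact le_antisymm (infDist_le_dist_of_mem h1) ((le_infDist hL).2 fun {l} hl => h2 l hl)

open Classical in
/-- The singular factor `d ^ (-s)`, where `d < ρ` is the distance to `L`. -/
noncomputable def distFactor (L : Set ℂ) (s ρ : ℝ) (z : ℂ) : ℝ :=
  if infDist z L < ρ then Real.exp (-(s * Real.log (infDist z L))) else 0

theorem distFactor_nonneg (L : Set ℂ) (s ρ : ℝ) (z : ℂ) : 0 ≤ distFactor L s ρ z := by
  unfold distFactor
  split_ifs
  · positivity
  · exact le_rfl

theorem measurable_distFactor (L : Set ℂ) (s ρ : ℝ) : Measurable (distFactor L s ρ) := by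
  have h : Measurable fun z => infDist z L := measurable_infDist
  unfold distFactor
  exact Measurable.ite (measurableSet_lt h measurable_const) (by fun_prop) measurable_const

/-- A small disk feels at most one point of `L`, so the measure with density `distFactor` is
uniformly bounded on such disks, and the weight estimate for such measures applies. -/
theorem exists_integrable_distFactor {L : Set ℂ} (hL : UniformlyDiscrete L) (hne : L.Nonempty)
    {near : ℂ → ℂ} (hnear : IsNearestPoint L near) {s : ℝ} (hs0 : 0 ≤ s) (hs : s < 2) :
    ∃ ρ : ℝ, 0 < ρ ∧
      Integrable fun z => distFactor L s ρ z * (1 + ‖z‖) ^ (-(3 : ℝ)) := by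
  obtain ⟨r, hr, hsep⟩ := hL
  -- If `z` is within `ρ` of `x` and of `L`, then `near z` and `near x` are both closer than `2ρ =
  -- r/2` to `x`, so separation forces them to coincide.
  obtain ⟨ρ, hρ⟩ : ∃ ρ, ρ = r / 4 := ⟨_, rfl⟩
  have hρ0 : 0 < ρ := by
    rw [hρ]
    positivity
  refine ⟨ρ, hρ0, ?_⟩
  obtain ⟨K, hK⟩ := exists_lintegral_exp_log_le hs0 hs ρ
  have hf := measurable_distFactor L s ρ
  have hfm : Measurable fun z => ENNReal.ofReal (distFactor L s ρ z) := hf.ennreal_ofReal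
  let ν : Measure ℂ := volume.withDensity fun z => ENNReal.ofReal (distFactor L s ρ z)
  have hball : ∀ x, ν (ball x ρ) ≤ ENNReal.ofReal K := by
    intro x
    rw [withDensity_apply _ measurableSet_ball]
    refine le_trans (setLIntegral_mono (g := fun z =>
      ENNReal.ofReal (Real.exp (-(s * Real.log ‖z - near x‖)))) (by fun_prop) fun z hz => ?_)
      (hK x (near x))
    refine ENNReal.ofReal_le_ofReal ?_
    unfold distFactor
    split_ifs with hd
    · have hzn := (hnear hne z).1
      have hxn := hnear hne x
      rw [hnear.infDist_eq hne] at hd ⊢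
      rw [← dist_eq_norm] at hd
      rw [mem_ball'] at hz
      have h1 : dist x (near z) < 2 * ρ := by linarith [dist_triangle x z (near z)]
      have h2 : dist x (near x) < 2 * ρ := (hxn.2 _ hzn).trans_lt h1
      have h3 : near x = near z := by
        by_contra hne'
        have := hsep _ hzn _ hxn.1 hne'
        linarith [dist_triangle_left (near z) (near x) x]
      rw [h3]
    · positivity
  obtain ⟨J, hJ⟩ := exists_lintegral_weight_le hρ0 hball (s := 3) (by norm_num)
  have hm : Measurable fun z : ℂ => distFactor L s ρ z * (1 + ‖z‖) ^ (-(3 : ℝ)) :=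
    hf.mul (by fun_prop)
  refine ⟨hm.aestronglyMeasurable, ?_⟩
  rw [hasFiniteIntegral_iff_ofReal (ae_of_all _ fun z =>
    mul_nonneg (distFactor_nonneg _ _ _ _) (by positivity))]
  refine lt_of_eq_of_lt ?_ ((hJ 0).trans_lt ENNReal.ofReal_lt_top)
  simp only [ν, sub_zero]
  rw [lintegral_withDensity_eq_lintegral_mul _ hfm (by fun_prop)]
  refine lintegral_congr fun z => ?_
  rw [ENNReal.ofReal_mul (distFactor_nonneg _ _ _ _)]
  rfl

/-- The three terms cover `d < ρ`, moderate distances and `d > 1`. In the last range `β ≥ -1/2`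
gives `d^{-2β} ≤ d`, which is linear growth at most. -/
theorem exp_neg_two_mul_log_le {d θ β ρ : ℝ} (hd : 0 < d) (hρ0 : 0 < ρ)
    (hθ : 0 ≤ θ) (hβ : -(1 / 2) ≤ β) (hβθ : β ≤ θ) :
    Real.exp (-2 * (β * Real.log d)) ≤
      (if d < ρ then Real.exp (-(2 * θ * Real.log d)) else 0) +
        (Real.exp (-(2 * θ * Real.log ρ)) + d) := by
  rcases lt_or_ge 1 d with h1 | h1
  · have h2 : 0 ≤ Real.log d := Real.log_nonneg h1.le
    have h3 : Real.exp (-2 * (β * Real.log d)) ≤ d := by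
      conv_rhs => rw [← Real.exp_log hd]
      exact Real.exp_le_exp.2 (by nlinarith)
    have h4 : (0 : ℝ) ≤ if d < ρ then Real.exp (-(2 * θ * Real.log d)) else 0 := by
      split_ifs
      · positivity
      · exact le_rfl
    have h5 := Real.exp_pos (-(2 * θ * Real.log ρ))
    linarith
  · have h2 : Real.log d ≤ 0 := Real.log_nonpos hd.le h1
    have h3 : Real.exp (-2 * (β * Real.log d)) ≤ Real.exp (-(2 * θ * Real.log d)) :=
      Real.exp_le_exp.2 (by nlinarith)
    have h5 := Real.exp_pos (-(2 * θ * Real.log ρ))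
    split_ifs with h
    · linarith
    · have h4 : Real.exp (-(2 * θ * Real.log d)) ≤ Real.exp (-(2 * θ * Real.log ρ)) := by
        have := Real.log_le_log hρ0 (not_lt.1 h)
        exact Real.exp_le_exp.2 (by nlinarith)
      linarith

theorem exists_pow_mul_exp_neg_sq_le (k : ℕ) {γ : ℝ} (hγ : 0 < γ) :
    ∃ C : ℝ, 0 ≤ C ∧ ∀ t : ℝ, 0 ≤ t → (1 + t) ^ k * Real.exp (-(γ * t ^ 2)) ≤ C := by
  refine ⟨k.factorial * Real.exp (1 + 1 / (4 * γ)), by positivity, fun t ht => ?_⟩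
  have h1 : (1 + t) ^ k ≤ k.factorial * Real.exp (1 + t) := by
    have h := Real.pow_div_factorial_le_exp (1 + t) (by linarith) k
    rwa [div_le_iff₀' (by positivity)] at h
  calc (1 + t) ^ k * Real.exp (-(γ * t ^ 2))
      ≤ k.factorial * Real.exp (1 + t) * Real.exp (-(γ * t ^ 2)) := by gcongr
    _ = k.factorial * Real.exp (1 + t - γ * t ^ 2) := by
        rw [mul_assoc, ← Real.exp_add]
        ring_nf
    _ ≤ _ := by
        gcongr
        have h2 : 1 + 1 / (4 * γ) - (1 + t - γ * t ^ 2) = (2 * γ * t - 1) ^ 2 / (4 * γ) := by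
          field_simp
          ring
        have h3 : 0 ≤ (2 * γ * t - 1) ^ 2 / (4 * γ) := by positivity
        linarith

/-- The weighted space of polynomials is contained in `L²`. -/
theorem integrable_pow_mul_exp_neg_two_mul {L : Set ℂ} {α : ℂ → ℝ} {near : ℂ → ℂ} {γ θ : ℝ}
    {Ψ : ℂ → ℝ} (hL : UniformlyDiscrete L) (hnear : IsNearestPoint L near) (hγ : 0 < γ)
    (hlower : QuadraticLowerBound L α near γ Ψ) (hθ1 : θ < 1)
    (hα : ∀ l ∈ L, -(1 / 2) ≤ α l ∧ α l ≤ θ) (hΨ : AEStronglyMeasurable Ψ)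
    (hexp : LocallyIntegrable fun z => Real.exp (-2 * Ψ z)) (n : ℕ) :
    Integrable fun z : ℂ => ‖z‖ ^ (2 * n) * Real.exp (-2 * Ψ z) := by
  obtain ⟨R, hR⟩ := hlower
  have hae : ∀ᵐ z : ℂ, z ∉ L := hL.countable.ae_notMem _
  -- The logarithmic factor is bounded by an integrably weighted singular part plus linear growth;
  -- when `L` is empty the factor is one, and `f = 0`, `C' = 1` do.
  obtain ⟨f, C', hf0, hC', hfi, hnl⟩ : ∃ (f : ℂ → ℝ) (C' : ℝ), (∀ z, 0 ≤ f z) ∧ 0 ≤ C' ∧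
      Integrable (fun z => f z * (1 + ‖z‖) ^ (-(3 : ℝ))) ∧
      ∀ z ∉ L, Real.exp (-2 * nearestLog L α near z) ≤ f z + C' * (1 + ‖z‖) := by
    by_cases hne : L.Nonempty
    · obtain ⟨ρ, hρ0, hint⟩ := exists_integrable_distFactor hL hne hnear
        (s := 2 * max θ 0) (by positivity) (by
          have := max_lt hθ1 zero_lt_one
          linarith)
      obtain ⟨l₀, hl₀⟩ := hne
      have hne : L.Nonempty := ⟨l₀, hl₀⟩
      refine ⟨distFactor L (2 * max θ 0) ρ,
        Real.exp (-(2 * max θ 0 * Real.log ρ)) + (1 + ‖l₀‖), distFactor_nonneg _ _ _, by positivity,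
        hint, fun z hz => ?_⟩
      have hzn := hnear hne z
      have hd : 0 < ‖z - near z‖ := norm_pos_iff.2 (sub_ne_zero.2 fun h => hz (h ▸ hzn.1))
      have h1 := exp_neg_two_mul_log_le hd hρ0 (le_max_right θ 0) (hα _ hzn.1).1
        ((hα _ hzn.1).2.trans (le_max_left θ 0))
      have h2 : ‖z - near z‖ ≤ ‖z‖ + ‖l₀‖ := by
        have h3 := hzn.2 l₀ hl₀
        rw [dist_eq_norm, dist_eq_norm] at h3
        exact h3.trans (norm_sub_le _ _)
      rw [nearestLog, if_pos hne, distFactor, hnear.infDist_eq hne]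
      refine h1.trans ?_
      have h4 := Real.exp_pos (-(2 * max θ 0 * Real.log ρ))
      have h5 := norm_nonneg z
      have h6 := norm_nonneg l₀
      have h7 : Real.exp (-(2 * max θ 0 * Real.log ρ)) + ‖z - near z‖ ≤
          (Real.exp (-(2 * max θ 0 * Real.log ρ)) + (1 + ‖l₀‖)) * (1 + ‖z‖) := by nlinarith
      linarith
    · refine ⟨fun _ => 0, 1, fun _ => le_rfl, zero_le_one, by simp, fun z _ => ?_⟩
      rw [nearestLog, if_neg hne]
      simp
  -- The Gaussian must absorb `2n` powers from the monomial, one from the linear growth and three to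
  -- create the weight `(1 + |z|)⁻³`.
  obtain ⟨C, hC, hCb⟩ := exists_pow_mul_exp_neg_sq_le (2 * n + 4) (show 0 < 2 * γ by positivity)
  have hin : IntegrableOn (fun z : ℂ => ‖z‖ ^ (2 * n) * Real.exp (-2 * Ψ z)) (closedBall 0 R) :=
    (hexp.integrableOn_isCompact (isCompact_closedBall 0 R)).continuousOn_mul
      (by fun_prop) (isCompact_closedBall 0 R)
  have hw : Integrable fun z : ℂ => (1 + ‖z‖) ^ (-(3 : ℝ)) :=
    integrable_one_add_norm (by
      rw [Complex.finrank_real_complex]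
      norm_num)
  have hmeas : AEStronglyMeasurable fun z : ℂ => ‖z‖ ^ (2 * n) * Real.exp (-2 * Ψ z) :=
    (by fun_prop : Continuous fun z : ℂ => ‖z‖ ^ (2 * n)).aestronglyMeasurable.mul
      (Real.continuous_exp.comp_aestronglyMeasurable (hΨ.const_mul (-2)))
  have hout : IntegrableOn (fun z : ℂ => ‖z‖ ^ (2 * n) * Real.exp (-2 * Ψ z))
      (closedBall 0 R)ᶜ := by
    refine Integrable.mono' ((hfi.const_mul C).add (hw.const_mul (C * C'))).integrableOn
      hmeas.restrict ?_
    rw [ae_restrict_iff' measurableSet_closedBall.compl]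
    filter_upwards [hae] with z hzL hzR
    rw [mem_compl_iff, mem_closedBall_zero_iff, not_le] at hzR
    have h1 := hR z hzL hzR.le
    have hz0 := norm_nonneg z
    have hW : (1 + ‖z‖) ^ (-(3 : ℝ)) = ((1 + ‖z‖) ^ 3)⁻¹ := by
      rw [Real.rpow_neg (by positivity)]
      norm_cast
    rw [Real.norm_of_nonneg (by positivity), Pi.add_apply, hW]
    have h2 : Real.exp (-2 * Ψ z) ≤ Real.exp (-(2 * γ * ‖z‖ ^ 2)) * (f z + C' * (1 + ‖z‖)) := by
      refine le_trans ?_ (mul_le_mul_of_nonneg_left (hnl z hzL) (Real.exp_pos _).le)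
      rw [← Real.exp_add]
      exact Real.exp_le_exp.2 (by linarith)
    have h3 : ‖z‖ ^ (2 * n) ≤ (1 + ‖z‖) ^ (2 * n) := by
      gcongr
      linarith
    have h4 := hCb ‖z‖ hz0
    have h5 : f z + C' * (1 + ‖z‖) ≤ (f z + C') * (1 + ‖z‖) := by nlinarith [hf0 z]
    calc ‖z‖ ^ (2 * n) * Real.exp (-2 * Ψ z)
        ≤ (1 + ‖z‖) ^ (2 * n) *
            (Real.exp (-(2 * γ * ‖z‖ ^ 2)) * ((f z + C') * (1 + ‖z‖))) := by
          refine mul_le_mul h3 (h2.trans ?_) (Real.exp_pos _).le (by positivity)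
          gcongr
      _ = ((1 + ‖z‖) ^ (2 * n + 4) * Real.exp (-(2 * γ * ‖z‖ ^ 2))) *
            ((f z + C') * ((1 + ‖z‖) ^ 3)⁻¹) := by
          field_simp
          ring
      _ ≤ C * ((f z + C') * ((1 + ‖z‖) ^ 3)⁻¹) := by
          refine mul_le_mul_of_nonneg_right h4 ?_
          exact mul_nonneg (add_nonneg (hf0 z) hC') (by positivity)
      _ = _ := by ring
  have := hin.union hout
  rwa [union_compl_self, integrableOn_univ] at this

/-! ### Zero modes and the conclusion -/

/-- Integration by parts moves the derivatives onto `conj G`, whose derivative in direction `v` is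
`conj(G') conj v`; the directions `1` and `I` then cancel in `∂`, as `conj G` is antiholomorphic. -/
theorem integral_conj_mul_wirtingerDel {G φ : ℂ → ℂ} (hG : Differentiable ℂ G)
    (hφ : ContDiff ℝ ∞ φ) (hφc : HasCompactSupport φ) :
    ∫ z, conj (G z) * wirtingerDel φ z = 0 := by
  have hφ1 : ContDiff ℝ 1 φ := contDiff_infty.1 hφ 1
  have hv : ∀ z, HasFDerivAt (fun z => conj (G z))
      ((Complex.conjCLE : ℂ →L[ℝ] ℂ).comp ((fderiv ℂ G z).restrictScalars ℝ)) z := fun z =>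
    Complex.conjCLE.hasFDerivAt.comp z ((hG z).hasFDerivAt.restrictScalars ℝ)
  have hfv : ∀ z v, fderiv ℝ (fun z => conj (G z)) z v = conj (deriv G z) * conj v := by
    intro z v
    rw [(hv z).fderiv]
    simp only [ContinuousLinearMap.comp_apply, ContinuousLinearMap.coe_restrictScalars',
      ContinuousLinearEquiv.coe_coe, Complex.conjCLE_apply, fderiv_eq_smul_deriv, smul_eq_mul,
      map_mul]
    ring
  have hGc : Continuous fun z => conj (G z) := Complex.continuous_conj.comp hG.continuous
  have hG'c : Continuous fun z => conj (deriv G z) :=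
    Complex.continuous_conj.comp (hG.contDiff (n := 1)).continuous_deriv_one
  have hφ'c : ∀ v, Continuous fun z => fderiv ℝ φ z v := fun v =>
    (hφ1.continuous_fderiv one_ne_zero).clm_apply continuous_const
  have hφ's : ∀ v, HasCompactSupport fun z => fderiv ℝ φ z v := fun v => hφc.fderiv_apply ℝ v
  have hi : ∀ v, Integrable fun z => conj (G z) * fderiv ℝ φ z v := fun v =>
    (hGc.mul (hφ'c v)).integrable_of_hasCompactSupport (hφ's v).mul_left
  have key : ∀ v, ∫ z, conj (G z) * fderiv ℝ φ z v =
      -(conj v * ∫ z, conj (deriv G z) * φ z) := by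
    intro v
    rw [integral_mul_fderiv_eq_neg_fderiv_mul_of_integrable ?_ (hi v)
      ((hGc.mul hφ.continuous).integrable_of_hasCompactSupport hφc.mul_left)
      (fun z _ => (hv z).differentiableAt) (fun z _ => hφ1.differentiable one_ne_zero z),
      ← integral_const_mul]
    · congr 2
      ext z
      rw [hfv]
      ring
    · simp only [hfv]
      exact ((hG'c.mul continuous_const).mul hφ.continuous).integrable_of_hasCompactSupport
        hφc.mul_left
  have hsplit : (fun z => conj (G z) * wirtingerDel φ z) = fun z =>
      2⁻¹ * (conj (G z) * fderiv ℝ φ z 1) -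
        2⁻¹ * Complex.I * (conj (G z) * fderiv ℝ φ z Complex.I) := by
    ext z
    rw [wirtingerDel]
    ring
  rw [hsplit, integral_sub ((hi 1).const_mul _) ((hi Complex.I).const_mul _), integral_const_mul,
    integral_const_mul, key, key, map_one, Complex.conj_I]
  linear_combination (2⁻¹ * ∫ z, conj (deriv G z) * φ z) * -Complex.I_mul_I

/-- A field with a potential `Ψ'` such that all `z ^ n * exp (-Ψ')` are square integrable has
infinitely many zero modes, for any other potential and any domain of derivation. -/
theorem infinitelyManyZeroModes_of_integrable {σ : SignedRadon} {Ψ Ψ' : ℂ → ℝ}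
    (hΨ : σ.IsPotential Ψ) (hΨ' : σ.IsPotential Ψ')
    (hint : ∀ n : ℕ, Integrable fun z : ℂ => ‖z‖ ^ (2 * n) * Real.exp (-2 * Ψ' z)) (U : Set ℂ) :
    InfinitelyManyZeroModes (PauliMinusGraph U Ψ) := by
  have hH : LocallyIntegrable fun z => Ψ z - Ψ' z := hΨ.1.sub hΨ'.1
  have hw : WeaklyHarmonicOn univ fun z => Ψ z - Ψ' z := by
    intro φ hφ hφc _
    have hφ2 : ContDiff ℝ 2 φ := contDiff_infty.1 hφ 2
    have hli : ∀ {g : ℂ → ℝ}, LocallyIntegrable g →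
        Integrable fun z => g z * Laplacian.laplacian φ z := fun h => by
      simpa using h.integrable_smul_right_of_hasCompactSupport (continuous_laplacian hφ2)
        (hasCompactSupport_laplacian hφc)
    simp only [sub_mul]
    rw [integral_sub (hli hΨ.1) (hli hΨ'.1), hΨ.2 φ hφ hφc, hΨ'.2 φ hφ hφc, sub_self]
  obtain ⟨F, hF, hFae⟩ := hw.exists_entire hH
  -- Since `|e^F| = e^{Ψ - Ψ'}` almost everywhere, the factor `e^F` replaces `e^{-Ψ}` by `e^{-Ψ'}`
  -- in the modulus of `ψ n` and leaves `e^Ψ ψ n` antiholomorphic.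
  let G : ℕ → ℂ → ℂ := fun n z => z ^ n * Complex.exp (F z)
  have hG : ∀ n, Differentiable ℂ (G n) := fun n => by fun_prop
  let ψ : ℕ → ℂ → ℂ := fun n z => (Real.exp (-Ψ z) : ℂ) * conj (G n z)
  have hGc : ∀ n, Continuous fun z => conj (G n z) := fun n =>
    Complex.continuous_conj.comp (hG n).continuous
  have hψm : ∀ n, AEStronglyMeasurable (ψ n) := fun n => by
    refine AEStronglyMeasurable.mul ?_ (hGc n).aestronglyMeasurable
    exact (Complex.continuous_ofReal.comp Real.continuous_exp).comp_aestronglyMeasurable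
      hΨ.1.aestronglyMeasurable.neg
  have hψ : ∀ n, MemLp (ψ n) 2 := fun n => by
    rw [memLp_two_iff_integrable_sq_norm (hψm n)]
    refine (hint n).congr ?_
    filter_upwards [hFae] with z hz
    simp only [ψ, G, norm_mul, RCLike.norm_conj, norm_pow, Complex.norm_exp, Complex.norm_real,
      Real.norm_of_nonneg (Real.exp_pos _).le, ← hz, mul_pow, ← Real.exp_nat_mul, ← pow_mul]
    rw [mul_left_comm, ← Real.exp_add, mul_comm n 2]
    push_cast
    ring_nf
  have hexp : ∀ z, (Real.exp (Ψ z) : ℂ) * (Real.exp (-Ψ z) : ℂ) = 1 := fun z => by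
    rw [← Complex.ofReal_mul, ← Real.exp_add, add_neg_cancel, Real.exp_zero, Complex.ofReal_one]
  have hcoe : ∀ n, (fun z => (Real.exp (Ψ z) : ℂ) * (hψ n).toLp (ψ n) z) =ᵐ[volume]
      fun z => conj (G n z) := fun n => by
    filter_upwards [(hψ n).coeFn_toLp] with z hz
    rw [hz]
    simp only [ψ]
    rw [← mul_assoc, hexp, one_mul]
  refine ⟨fun n => (hψ n).toLp (ψ n), ?_, fun n => ?_⟩
  · rw [linearIndependent_iff']
    intro s g hg i hi
    have h1 : ∀ᵐ z, ∑ j ∈ s, g j * (hψ j).toLp (ψ j) z = 0 := by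
      have e1 := Lp.coeFn_finsetSum s fun j => g j • (hψ j).toLp (ψ j)
      rw [hg] at e1
      have e2 : ∀ᵐ z, ∀ j, (g j • (hψ j).toLp (ψ j) : PlaneL2) z =
          g j * (hψ j).toLp (ψ j) z :=
        ae_all_iff.2 fun j => by
          filter_upwards [Lp.coeFn_smul (g j) ((hψ j).toLp (ψ j))] with z hz
          rw [hz, Pi.smul_apply, smul_eq_mul]
      filter_upwards [e1, e2, Lp.coeFn_zero ℂ 2 (volume : Measure ℂ)] with z h1 h2 h3
      rw [h3] at h1
      simp only [Finset.sum_apply, h2] at h1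
      exact h1.symm
    -- A linear relation among the modes, conjugated and divided by nowhere vanishing factors, says
    -- that this polynomial vanishes almost everywhere, hence identically by continuity.
    let q : Polynomial ℂ := ∑ j ∈ s, Polynomial.monomial j (conj (g j))
    have h2 : (fun z => q.eval z) =ᵐ[volume] fun _ => 0 := by
      filter_upwards [h1, ae_all_iff.2 hcoe] with z hz hc
      have h3 : ∑ j ∈ s, g j * conj (G j z) = 0 := by
        have : ∑ j ∈ s, g j * conj (G j z) =
            (Real.exp (Ψ z) : ℂ) * ∑ j ∈ s, g j * (hψ j).toLp (ψ j) z := by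
          rw [Finset.mul_sum]
          refine Finset.sum_congr rfl fun j _ => ?_
          rw [← hc j]
          ring
        rw [this, hz, mul_zero]
      have h4 : conj (q.eval z * Complex.exp (F z)) = 0 := by
        rw [← h3]
        simp only [q, G, Polynomial.eval_finsetSum, Polynomial.eval_monomial, map_mul, map_sum,
          Finset.sum_mul, Complex.conj_conj, mul_assoc]
      have h5 := (map_eq_zero (starRingEnd ℂ)).1 h4
      exact (mul_eq_zero.1 h5).resolve_right (Complex.exp_ne_zero _)
    have h3 : (fun z => q.eval z) = fun _ => 0 :=
      (Continuous.ae_eq_iff_eq volume q.continuous continuous_const).1 h2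
    have h4 : q = 0 := Polynomial.funext fun z => by simpa using congrFun h3 z
    have h5 : q.coeff i = conj (g i) := by
      simp only [q, Polynomial.finsetSum_coeff, Polynomial.coeff_monomial]
      rw [Finset.sum_ite_eq' s i, if_pos hi]
    rw [h4, Polynomial.coeff_zero] at h5
    exact (map_eq_zero (starRingEnd ℂ)).1 h5.symm
  · refine ⟨fun _ => 0, ⟨⟨?_, ?_, ?_⟩, ?_⟩, ?_⟩
    · have h1 : LocallyIntegrable fun z => (Real.exp (Ψ z) : ℂ) * (hψ n).toLp (ψ n) z :=
        (hGc n).locallyIntegrable.congr (hcoe n).symm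
      exact h1.locallyIntegrableOn U
    · exact (locallyIntegrable_const (0 : ℂ)).locallyIntegrableOn U
    · intro φ hφ hφc _
      have h1 : ∫ z, (Real.exp (Ψ z) : ℂ) * (hψ n).toLp (ψ n) z * wirtingerDel φ z =
          ∫ z, conj (G n z) * wirtingerDel φ z := by
        refine integral_congr_ae ?_
        filter_upwards [hcoe n] with z hz
        rw [hz]
      rw [h1, integral_conj_mul_wirtingerDel (hG n) hφ hφc]
      simp
    · simp
    · intro φ k _
      simp

theorem SignedRadon.atom_add_sub_of_continuous {μ₀ μ ν : SignedRadon} (hμ : μ.IsContinuous)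
    (hν : ν.IsContinuous) (z : ℂ) : (μ₀ + μ - ν).atom z = μ₀.atom z := by
  have hpos : (μ₀ + μ - ν).pos = μ₀.pos + μ.pos + ν.neg := rfl
  have hneg : (μ₀ + μ - ν).neg = μ₀.neg + μ.neg + ν.pos := rfl
  simp [SignedRadon.atom, hpos, hneg, (hμ z).1, (hμ z).2, (hν z).1, (hν z).2]

/-- A field with solenoids of intensities at most `θ < 1` and no other atoms has infinitely many
zero modes as soon as one of its potentials has quadratic growth. -/
theorem SignedRadon.HasDiscretePart.infinitelyManyZeroModes {σ : SignedRadon} {L : Set ℂ}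
    {α : ℂ → ℝ} {near : ℂ → ℂ} {γ θ : ℝ} {Ψ Ψ' : ℂ → ℝ} (hσ : σ.HasDiscretePart L α)
    (hL : UniformlyDiscrete L) (hnear : IsNearestPoint L near) (hγ : 0 < γ)
    (hΨ' : σ.IsPotential Ψ') (hlower : QuadraticLowerBound L α near γ Ψ') (hθ : θ < 1)
    (hα : ∀ l ∈ L, -(1 / 2) ≤ α l ∧ α l ≤ θ) (hΨ : σ.IsPotential Ψ) (U : Set ℂ) :
    InfinitelyManyZeroModes (PauliMinusGraph U Ψ) := by
  have hatom : ∀ z, σ.atom z < 2 * Real.pi := by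
    intro z
    rw [hσ z]
    by_cases hz : z ∈ L
    · rw [indicator_of_mem hz]
      have := (hα z hz).2
      nlinarith [Real.pi_pos]
    · rw [indicator_of_notMem hz]
      positivity
  exact infinitelyManyZeroModes_of_integrable hΨ hΨ'
    (integrable_pow_mul_exp_neg_two_mul hL hnear hγ hlower hθ hα hΨ'.1.aestronglyMeasurable
      (hΨ'.locallyIntegrable_exp hatom)) U

theorem mainTheorem9
    (μ₀ : SignedRadon) (L : Set ℂ) (α : ℂ → ℝ)
    (hL : UniformlyDiscrete L)
    (hdisc : μ₀.HasDiscretePart L α)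
    (near : ℂ → ℂ) (hnear : IsNearestPoint L near)
    (γ : ℝ) (hγ : 0 < γ)
    (Ψ₀ : ℂ → ℝ) (hΨ₀ : μ₀.IsPotential Ψ₀)
    (hlower : QuadraticLowerBound L α near γ Ψ₀)
    (μ : SignedRadon) (hμJ : μ.IsJordan) (hμc : μ.IsContinuous)
    (hμpos : UniformLogBound μ.pos) (hμneg : UniformLogBound μ.neg)
    (Φ : ℂ → ℂ) (hΦm : Measurable Φ) (hΦ : SublinearDisplacement Φ)
    (μs : SignedRadon) (hμs : SignedRadon.IsImage Φ μ μs) (hμsJ : μs.IsJordan)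
    (hμspos : UniformLogBound μs.pos) (hμsneg : UniformLogBound μs.neg) :
    (∃ γ' : ℝ, 0 < γ' ∧ γ' < γ ∧
      ∃ Ψs : ℂ → ℝ, (μ₀ + μ - μs).IsPotential Ψs ∧
        QuadraticLowerBound L α near γ' Ψs) ∧
    ((∃ θ₀ : ℝ, θ₀ < 1 ∧ ∀ l ∈ L, 0 < α l ∧ α l ≤ θ₀) →
      ∀ Ψ : ℂ → ℝ, (μ₀ + μ - μs).IsPotential Ψ →
        InfinitelyManyZeroModes (PauliMinusMax L Ψ)) ∧
    ((∀ l ∈ L, -(1 / 2) ≤ α l ∧ α l < 1 / 2) →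
      ∀ Ψ : ℂ → ℝ, (μ₀ + μ - μs).IsPotential Ψ →
        InfinitelyManyZeroModes (PauliMinusEV Ψ)) := by
  obtain ⟨Ψs, hΨs, hΨsl⟩ := exists_potential_quadraticLowerBound (half_lt_self hγ) hΨ₀ hlower
    hμpos hμneg hΦm hΦ hμs hμspos hμsneg
  -- The image measure has no atoms because (C) excludes them, so the solenoids are those of `μ₀`.
  have hdisc' : (μ₀ + μ - μs).HasDiscretePart L α := fun z =>
    (SignedRadon.atom_add_sub_of_continuous hμc
      (fun w => ⟨hμspos.measure_singleton w, hμsneg.measure_singleton w⟩) z).trans (hdisc z)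
  -- Both spectral claims are instances of `-1/2 ≤ α ≤ θ < 1`: with `θ` given for the maximal
  -- operator, and `θ = 1/2` for the other one.
  refine ⟨⟨γ / 2, half_pos hγ, half_lt_self hγ, Ψs, hΨs, hΨsl⟩, ?_, ?_⟩
  · rintro ⟨θ, hθ, hα⟩ Ψ hΨ
    exact hdisc'.infinitelyManyZeroModes hL hnear (half_pos hγ) hΨs hΨsl hθ
      (fun l hl => ⟨by linarith [(hα l hl).1], (hα l hl).2⟩) hΨ Lᶜ
  · intro hα Ψ hΨ
    exact hdisc'.infinitelyManyZeroModes hL hnear (half_pos hγ) hΨs hΨsl one_half_lt_one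
      (fun l hl => ⟨(hα l hl).1, (hα l hl).2.le⟩) hΨ univ
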